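/- Let $n>1$ and let $\pi_n:\mathbb P^2_{\mathbb C}\to\mathbb P^2_{\mathbb C}$, $\pi_n([x:y:z])=[x^n:y^n:z^n]$, be the Kummer cover. Let $\bar{\mathcal C}=\{F=0\}$ be a reduced projective plane curve ($F$ homogeneous and squarefree) and let $\bar{\mathcal C}_n=\pi_n^{-1}(\bar{\mathcal C})=\{F(x^n,y^n,z^n)=0\}$. The axes are the lines $\{x=0\}$, $\{y=0\}$, $\{z=0\}$. A point has type $\ell\in\{0,1,2\}$ if exactly $\ell+1$ of its homogeneous coordinates are nonzero. Let $Q\in\bar{\mathcal C}_n$ and $P=\pi_n(Q)\in\bar{\mathcal C}$, and assume that no axis through $P$ is a component of $\bar{\mathcal C}$. Write $\mu_P$ and $\mu_Q$ for the Milnor numbers of $(\bar{\mathcal C},P)$ and $(\bar{\mathcal C}_n,Q)$, where the Milnor number of a germ $f=0$ is $\dim_{\mathbb C}\mathbb C\{u,v\}/(f_u,f_v)$. Let $\delta_1,\dots,\delta_r$ be the branches of $\bar{\mathcal C}$ at $P$, given by the irreducible factors of a local equation in the ring $\mathbb C\{u,v\}$ of convergent power series. Let $\tilde\delta_i=\pi_n^{-1}(\delta_i)$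 be the germ at $Q$ defined by the pull-back of an equation of $\delta_i$, and let $\mu_{P,\delta_i}$ and $\mu_{Q,\tilde\delta_i}$ be the Milnor numbers of $(\delta_i,P)$ and $(\tilde\delta_i,Q)$. Local intersection numbers are $(f\cdot g)=\dim_{\mathbb C}\mathbb C\{u,v\}/(f,g)$. For an axis $\bar L$ through $P$ (equivalently, through $Q$) put $m_P^{\bar L}=(\bar{\mathcal C}\cdot\bar L)_P$, $m_{P,\delta_i}^{\bar L}=(\delta_i\cdot\bar L)_P$ and $m_{Q,\tilde\delta_i}^{\bar L}=(\tilde\delta_i\cdot\bar L)_Q$. Then all the Milnor and intersection numbers below are finite, and the following holds. (1) If $P$ has type $1$, then $P$ lies on a unique axis $\bar L$ and (a) $\mu_Q=n\mu_P+(m_P^{\bar L}-1)(n-1)$; (b) $\mu_{Q,\tilde\delta_i}=n\mu_{P,\delta_i}+(m_{P,\delta_i}^{\bar L}-1)(n-1)$ for every $i$; (c) $(\tilde\delta_i\cdot\tilde\delta_j)_Q=n(\delta_i\cdot\delta_j)_P$ if $i\neq j$; (d) $\tilde\delta_i$ has exactly $\gcd(n,m_{P,\delta_i}^{\bar L})$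 irreducible components. (2) If $P$ has type $0$, then $P$ lies on exactly two axes $\bar L_1,\bar L_2$ and (a) $\mu_Q=n^2\mu_P+(n-1)\bigl(n(m_P^{\bar L_1}+m_P^{\bar L_2}-1)-1\bigr)$; (b) $\mu_{Q,\tilde\delta_i}=n^2\mu_{P,\delta_i}+(n-1)\bigl(n(m_{P,\delta_i}^{\bar L_1}+m_{P,\delta_i}^{\bar L_2}-1)-1\bigr)$ and $m_{Q,\tilde\delta_i}^{\bar L_j}=n\,m_{P,\delta_i}^{\bar L_j}$ for every $i$ and $j=1,2$; (c) $(\tilde\delta_i\cdot\tilde\delta_j)_Q=n^2(\delta_i\cdot\delta_j)_P$ if $i\neq j$; (d) with $r_i=\gcd(n,m_{P,\delta_i}^{\bar L_1},m_{P,\delta_i}^{\bar L_2})$, the germ $\tilde\delta_i$ has exactly $n r_i$ irreducible components, and for each fixed $i$ these are analytically isomorphic to each other. -/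

import Mathlib

open scoped LinearAlgebra.Projectivization

noncomputable section

namespace KummerCover

/-! ### Convergent power series in two variables -/

/-- A formal power series in two variables over `ℂ` is convergent if it converges absolutely on
some polydisc of positive radius around the origin. -/
def IsConvergent (f : MvPowerSeries (Fin 2) ℂ) : Prop :=
  ∃ r : NNReal, 0 < r ∧ Summable fun m : Fin 2 →₀ ℕ => ‖MvPowerSeries.coeff m f‖₊ * r ^ m.degree

/-- The majorant `∑ₘ |aₘ| r^|m|` of a power series, as an extended nonnegative real. -/
def majorant (r : NNReal) (f : MvPowerSeries (Fin 2) ℂ) : ENNReal :=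
  ∑' m : Fin 2 →₀ ℕ, ((‖MvPowerSeries.coeff m f‖₊ * r ^ m.degree : NNReal) : ENNReal)

theorem isConvergent_iff (f : MvPowerSeries (Fin 2) ℂ) :
    IsConvergent f ↔ ∃ r : NNReal, 0 < r ∧ majorant r f ≠ ⊤ := by
  simp only [IsConvergent, majorant, ENNReal.tsum_coe_ne_top_iff_summable]

theorem majorant_mono {r s : NNReal} (h : r ≤ s) (f : MvPowerSeries (Fin 2) ℂ) :
    majorant r f ≤ majorant s f := by
  refine ENNReal.tsum_le_tsum fun m => ?_
  gcongr

theorem majorant_add (r : NNReal) (f g : MvPowerSeries (Fin 2) ℂ) :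
    majorant r (f + g) ≤ majorant r f + majorant r g := by
  rw [majorant, majorant, majorant, ← ENNReal.tsum_add]
  refine ENNReal.tsum_le_tsum fun m => ?_
  rw [← ENNReal.coe_add, ← add_mul, map_add]
  gcongr
  exact nnnorm_add_le _ _

theorem majorant_mul (r : NNReal) (f g : MvPowerSeries (Fin 2) ℂ) :
    majorant r (f * g) ≤ majorant r f * majorant r g := by
  have key : majorant r f * majorant r g =
      ∑' m : Fin 2 →₀ ℕ, ∑' p : Finset.HasAntidiagonal.antidiagonal m,
        ((‖MvPowerSeries.coeff p.1.1 f‖₊ * r ^ p.1.1.degree : NNReal) : ENNReal) *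
        ((‖MvPowerSeries.coeff p.1.2 g‖₊ * r ^ p.1.2.degree : NNReal) : ENNReal) := by
    rw [majorant, majorant, ← ENNReal.tsum_mul_right]
    simp_rw [← ENNReal.tsum_mul_left]
    rw [← ENNReal.tsum_prod, ← ENNReal.tsum_sigma,
      ← Finset.HasAntidiagonal.sigmaAntidiagonalEquivProd.tsum_eq]
    rfl
  rw [key, majorant]
  refine ENNReal.tsum_le_tsum fun m => ?_
  rw [tsum_fintype, Finset.univ_eq_attach,
    Finset.sum_attach (Finset.HasAntidiagonal.antidiagonal m) (fun p : (Fin 2 →₀ ℕ) × (Fin 2 →₀ ℕ) =>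
      ((‖MvPowerSeries.coeff p.1 f‖₊ * r ^ p.1.degree : NNReal) : ENNReal) *
      ((‖MvPowerSeries.coeff p.2 g‖₊ * r ^ p.2.degree : NNReal) : ENNReal)),
    MvPowerSeries.coeff_mul]
  simp_rw [← ENNReal.coe_mul]
  rw [← ENNReal.ofNNReal_finsetSum, ENNReal.coe_le_coe]
  calc _ ≤ (∑ p ∈ Finset.HasAntidiagonal.antidiagonal m,
        ‖MvPowerSeries.coeff p.1 f * MvPowerSeries.coeff p.2 g‖₊) * r ^ m.degree := by
        gcongr
        exact nnnorm_sum_le _ _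
    _ = _ := by
        rw [Finset.sum_mul]
        refine Finset.sum_congr rfl fun p hp => ?_
        rw [← Finset.HasAntidiagonal.mem_antidiagonal.mp hp, nnnorm_mul, map_add, pow_add]
        ring

theorem majorant_one (r : NNReal) : majorant r 1 ≤ 1 := by
  rw [majorant, tsum_eq_single 0]
  · simp
  · intro m hm
    simp [MvPowerSeries.coeff_one, hm]

theorem majorant_pow (r : NNReal) (f : MvPowerSeries (Fin 2) ℂ) (k : ℕ) :
    majorant r (f ^ k) ≤ majorant r f ^ k := by
  induction k with
  | zero => simpa using majorant_one r
  | succ k ih =>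
    rw [pow_succ, pow_succ]
    exact (majorant_mul r _ _).trans (by gcongr)

theorem isConvergent_coe (p : MvPolynomial (Fin 2) ℂ) :
    IsConvergent (p : MvPowerSeries (Fin 2) ℂ) := by
  refine ⟨1, one_pos, summable_of_ne_finset_zero (s := p.support) fun m hm => ?_⟩
  simp [MvPolynomial.notMem_support_iff.mp hm]

theorem IsConvergent.add {f g : MvPowerSeries (Fin 2) ℂ} (hf : IsConvergent f)
    (hg : IsConvergent g) : IsConvergent (f + g) := by
  rw [isConvergent_iff] at *
  obtain ⟨r, hr, h⟩ := hf
  obtain ⟨s, hs, h'⟩ := hg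
  refine ⟨min r s, lt_min hr hs, ne_top_of_le_ne_top (ENNReal.add_ne_top.mpr ⟨h, h'⟩) ?_⟩
  refine (majorant_add _ f g).trans (add_le_add ?_ ?_)
  · exact majorant_mono (min_le_left r s) f
  · exact majorant_mono (min_le_right r s) g

theorem IsConvergent.mul {f g : MvPowerSeries (Fin 2) ℂ} (hf : IsConvergent f)
    (hg : IsConvergent g) : IsConvergent (f * g) := by
  rw [isConvergent_iff] at *
  obtain ⟨r, hr, h⟩ := hf
  obtain ⟨s, hs, h'⟩ := hg
  refine ⟨min r s, lt_min hr hs, ne_top_of_le_ne_top (ENNReal.mul_ne_top h h') ?_⟩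
  refine (majorant_mul _ f g).trans (mul_le_mul' ?_ ?_)
  · exact majorant_mono (min_le_left r s) f
  · exact majorant_mono (min_le_right r s) g

/-- The partial derivatives of a convergent power series converge. -/
theorem IsConvergent.pderiv {f : MvPowerSeries (Fin 2) ℂ} (hf : IsConvergent f) (i : Fin 2) :
    IsConvergent (MvPowerSeries.pderiv ℂ i f) := by
  obtain ⟨r, hr, h⟩ := hf
  refine ⟨r / 2, by positivity, ?_⟩
  have h1 : Summable fun m : Fin 2 →₀ ℕ =>
      r⁻¹ * (‖MvPowerSeries.coeff (m + Finsupp.single i 1) f‖₊ *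
        r ^ (m + Finsupp.single i 1).degree) := by
    have hinj : Function.Injective fun m : Fin 2 →₀ ℕ => m + Finsupp.single i 1 :=
      fun a b hab => add_right_cancel hab
    have h0 := NNReal.summable_comp_injective h hinj
    rw [← NNReal.summable_coe] at h0 ⊢
    exact (h0.mul_left ((r⁻¹ : NNReal) : ℝ)).congr fun m => (NNReal.coe_mul _ _).symm
  refine NNReal.summable_of_le (fun m => ?_) h1
  have h2 : ((m i : NNReal) + 1) ≤ 2 ^ m.degree := by
    have h3 : m i + 1 ≤ 2 ^ m.degree :=
      (Nat.succ_le_of_lt (lt_of_le_of_lt (Finsupp.le_degree i m) Nat.lt_two_pow_self))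
    exact_mod_cast h3
  have h4 : ‖((m i : ℂ) + 1)‖₊ = (m i : NNReal) + 1 := by
    have := Complex.nnnorm_natCast (m i + 1)
    push_cast at this
    exact this
  have h5 : ‖MvPowerSeries.coeff m (MvPowerSeries.pderiv ℂ i f)‖₊ =
      ‖MvPowerSeries.coeff (m + Finsupp.single i 1) f‖₊ * ((m i : NNReal) + 1) := by
    rw [MvPowerSeries.coeff_pderiv, nnnorm_mul, h4]
  have h6 : (m + Finsupp.single i 1).degree = m.degree + 1 := by
    rw [map_add, Finsupp.degree_single]
  rw [h5, h6]
  generalize ‖MvPowerSeries.coeff (m + Finsupp.single i 1) f‖₊ = A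
  have hr' : r ≠ 0 := hr.ne'
  have h7 : ((m i : NNReal) + 1) / 2 ^ m.degree ≤ 1 := div_le_one_of_le₀ h2 zero_le
  have h8 : r⁻¹ * (A * r ^ (m.degree + 1)) = A * r ^ m.degree := by
    rw [pow_succ]
    field_simp
  have h9 : A * ((m i : NNReal) + 1) * (r / 2) ^ m.degree =
      A * r ^ m.degree * (((m i : NNReal) + 1) / 2 ^ m.degree) := by
    rw [div_pow]
    ring
  rw [h8, h9]
  exact mul_le_of_le_one_right zero_le h7

theorem majorant_le_of_constantCoeff_eq_zero {r s : NNReal} (hr : 0 < r) (hs : s ≤ r)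
    {f : MvPowerSeries (Fin 2) ℂ} (hf : MvPowerSeries.constantCoeff f = 0) :
    majorant s f ≤ ((s / r : NNReal) : ENNReal) * majorant r f := by
  rw [majorant, majorant, ← ENNReal.tsum_mul_left]
  refine ENNReal.tsum_le_tsum fun m => ?_
  rw [← ENNReal.coe_mul, ENNReal.coe_le_coe]
  by_cases hm : m = 0
  · subst hm
    rw [MvPowerSeries.coeff_zero_eq_constantCoeff_apply, hf]
    simp
  · have hd : m.degree ≠ 0 := by simpa [Finsupp.degree_eq_zero_iff] using hm
    have h1 : (s / r) ^ m.degree ≤ s / r :=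
      pow_le_of_le_one (by positivity) (div_le_one_of_le₀ hs (by positivity)) hd
    have h2 : s ^ m.degree = (s / r) ^ m.degree * r ^ m.degree := by
      rw [← mul_pow, div_mul_cancel₀ _ hr.ne']
    rw [h2]
    calc _ = (s / r) ^ m.degree * (‖MvPowerSeries.coeff m f‖₊ * r ^ m.degree) := by ring
      _ ≤ _ := by gcongr

theorem majorant_subst_le {r s : NNReal} {a : Fin 2 → MvPowerSeries (Fin 2) ℂ}
    (ha : ∀ i, MvPowerSeries.constantCoeff (a i) = 0) (has : ∀ i, majorant s (a i) ≤ r)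
    (f : MvPowerSeries (Fin 2) ℂ) : majorant s (MvPowerSeries.subst a f) ≤ majorant r f := by
  have hsub := MvPowerSeries.hasSubst_of_constantCoeff_zero ha
  have hprod : ∀ m : Fin 2 →₀ ℕ,
      majorant s (m.prod fun i e => a i ^ e) ≤ ((r ^ m.degree : NNReal) : ENNReal) := by
    intro m
    rw [Finsupp.prod_fintype _ _ (by simp), Finsupp.degree_eq_sum, Fin.prod_univ_two,
      Fin.sum_univ_two, pow_add, ENNReal.coe_mul, ENNReal.coe_pow, ENNReal.coe_pow]
    refine (majorant_mul _ _ _).trans (mul_le_mul' ?_ ?_)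
    · exact (majorant_pow _ _ _).trans (pow_le_pow_left' (has _) _)
    · exact (majorant_pow _ _ _).trans (pow_le_pow_left' (has _) _)
  calc majorant s (MvPowerSeries.subst a f)
      ≤ ∑' e : Fin 2 →₀ ℕ, ∑' m : Fin 2 →₀ ℕ,
          (‖MvPowerSeries.coeff m f‖₊ : ENNReal) *
          ((‖MvPowerSeries.coeff e (m.prod fun i e => a i ^ e)‖₊ * s ^ e.degree : NNReal) :
            ENNReal) := by
        refine ENNReal.tsum_le_tsum fun e => ?_
        rw [MvPowerSeries.coeff_subst hsub]
        have hfin := MvPowerSeries.coeff_subst_finite hsub f e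
        rw [finsum_eq_sum _ hfin]
        refine le_trans ?_ (ENNReal.sum_le_tsum hfin.toFinset)
        simp_rw [← ENNReal.coe_mul]
        rw [← ENNReal.ofNNReal_finsetSum, ENNReal.coe_le_coe]
        refine (mul_le_mul_left (nnnorm_sum_le _ _) _).trans ?_
        rw [Finset.sum_mul]
        refine Finset.sum_le_sum fun m _ => ?_
        rw [smul_eq_mul, nnnorm_mul, mul_assoc]
    _ = ∑' m : Fin 2 →₀ ℕ, (‖MvPowerSeries.coeff m f‖₊ : ENNReal) *
          majorant s (m.prod fun i e => a i ^ e) := by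
        rw [ENNReal.tsum_comm]
        simp_rw [ENNReal.tsum_mul_left]
        rfl
    _ ≤ majorant r f := by
        refine ENNReal.tsum_le_tsum fun m => ?_
        rw [ENNReal.coe_mul]
        gcongr
        exact hprod m

/-- Substituting convergent power series without constant term into a convergent power series
gives a convergent power series. -/
theorem IsConvergent.subst {f : MvPowerSeries (Fin 2) ℂ} (hf : IsConvergent f)
    {a : Fin 2 → MvPowerSeries (Fin 2) ℂ} (hconv : ∀ i, IsConvergent (a i))
    (ha : ∀ i, MvPowerSeries.constantCoeff (a i) = 0) :
    IsConvergent (MvPowerSeries.subst a f) := by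
  rw [isConvergent_iff] at hf
  obtain ⟨r, hr, hfr⟩ := hf
  have small : ∀ i, ∃ s : NNReal, 0 < s ∧ majorant s (a i) ≤ r := by
    intro i
    obtain ⟨t, ht, hat⟩ := (isConvergent_iff _).mp (hconv i)
    lift majorant t (a i) to NNReal using hat with M hM
    refine ⟨min t (t * r / (M + 1)), lt_min ht (by positivity), ?_⟩
    refine (majorant_le_of_constantCoeff_eq_zero ht (min_le_left _ _) (ha i)).trans ?_
    rw [← hM, ← ENNReal.coe_mul, ENNReal.coe_le_coe]
    calc min t (t * r / (M + 1)) / t * M ≤ (t * r / (M + 1)) / t * (M + 1) := by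
          gcongr
          · exact min_le_right _ _
          · exact le_self_add
      _ = r := by field_simp
  obtain ⟨s₀, hs₀, h₀⟩ := small 0
  obtain ⟨s₁, hs₁, h₁⟩ := small 1
  rw [isConvergent_iff]
  refine ⟨min s₀ s₁, lt_min hs₀ hs₁, ne_top_of_le_ne_top hfr (majorant_subst_le ha ?_ f)⟩
  intro i
  fin_cases i
  · exact (majorant_mono (min_le_left _ _) _).trans h₀
  · exact (majorant_mono (min_le_right _ _) _).trans h₁

/-- The ring `ℂ{u₀, u₁}` of convergent power series in two variables, i.e. the ring of germs at
the origin of holomorphic functions on `ℂ²`. -/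
def ConvSeries : Subalgebra ℂ (MvPowerSeries (Fin 2) ℂ) where
  carrier := {f | IsConvergent f}
  mul_mem' := IsConvergent.mul
  add_mem' := IsConvergent.add
  algebraMap_mem' c := by
    have h := isConvergent_coe (MvPolynomial.C c)
    rwa [MvPolynomial.coe_C] at h

/-! ### Local invariants of plane curve germs

A germ at the origin of a plane curve is given by an equation in `ℂ{u₀, u₁}`. -/

/-- The dimension of `ℂ{u₀, u₁} / I` over `ℂ`, possibly infinite. -/
def dimQuot (I : Ideal ConvSeries) : ℕ∞ :=
  Cardinal.toENat (Module.rank ℂ (ConvSeries ⧸ I))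

/-- The partial derivative on `ℂ{u₀, u₁}`. -/
def partialDeriv (i : Fin 2) (f : ConvSeries) : ConvSeries :=
  ⟨MvPowerSeries.pderiv ℂ i f.1, f.2.pderiv i⟩

/-- The Milnor number `dim ℂ{u₀, u₁} / (∂f/∂u₀, ∂f/∂u₁)` of the germ `f = 0`. -/
def milnorNumber (f : ConvSeries) : ℕ∞ :=
  dimQuot (Ideal.span {partialDeriv 0 f, partialDeriv 1 f})

/-- The local intersection number `dim ℂ{u₀, u₁} / (f, g)` of the germs `f = 0` and `g = 0`. -/
def intersectionNumber (f g : ConvSeries) : ℕ∞ :=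
  dimQuot (Ideal.span {f, g})

/-- `δ = 0` is a branch (an irreducible component) of the germ `f = 0`. -/
def IsBranch (δ f : ConvSeries) : Prop :=
  Irreducible δ ∧ δ ∣ f

/-- The set of irreducible components of the germ `f = 0`: irreducible divisors of `f`, where
associated equations (differing by a unit) define the same component. -/
def components (f : ConvSeries) : Set (Associates ConvSeries) :=
  Associates.mk '' {g | IsBranch g f}

/-- The plane curve germs `f = 0` and `g = 0` are analytically isomorphic: an analytic automorphism
of the germ of `ℂ²` at the origin (a `ℂ`-algebra automorphism of `ℂ{u₀, u₁}`) takes one to the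
other. -/
def AnalyticallyIsomorphic (f g : ConvSeries) : Prop :=
  ∃ φ : ConvSeries ≃ₐ[ℂ] ConvSeries, Associated (φ f) g

/-! ### The projective plane, the Kummer cover, and local equations -/

/-- The complex projective plane. -/
abbrev Plane : Type := ℙ ℂ (Fin 3 → ℂ)

theorem pow_ne_zero_of_ne_zero (n : ℕ) {v : Fin 3 → ℂ} (hv : v ≠ 0) : v ^ n ≠ 0 := by
  obtain ⟨i, hi⟩ := Function.ne_iff.mp hv
  exact Function.ne_iff.mpr ⟨i, by simpa using pow_ne_zero n hi⟩

/-- The Kummer cover `[x : y : z] ↦ [xⁿ : yⁿ : zⁿ]`. -/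
def kummerMap (n : ℕ) (Q : Plane) : Plane :=
  Projectivization.mk ℂ (Q.rep ^ n) (pow_ne_zero_of_ne_zero n Q.rep_nonzero)

/-- The Kummer cover can be computed with any homogeneous coordinates. -/
theorem kummerMap_mk (n : ℕ) (v : Fin 3 → ℂ) (hv : v ≠ 0) :
    kummerMap n (Projectivization.mk ℂ v hv) =
      Projectivization.mk ℂ (v ^ n) (pow_ne_zero_of_ne_zero n hv) := by
  obtain ⟨a, ha⟩ := Projectivization.exists_smul_eq_mk_rep ℂ v hv
  rw [kummerMap, Projectivization.mk_eq_mk_iff]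
  exact ⟨a ^ n, by rw [← ha, smul_pow]⟩

/-- `P` lies on the axis `X_j = 0`. -/
def OnAxis (P : Plane) (j : Fin 3) : Prop :=
  P.rep j = 0

/-- `P` is a point of type `ℓ`: exactly `ℓ + 1` of its homogeneous coordinates are nonzero. -/
def HasType (P : Plane) (l : ℕ) : Prop :=
  {j : Fin 3 | P.rep j ≠ 0}.ncard = l + 1

/-- `P` lies on the projective curve `F = 0`. -/
def OnCurve (F : MvPolynomial (Fin 3) ℂ) (P : Plane) : Prop :=
  MvPolynomial.eval P.rep F = 0

/-- The equation `F(xⁿ, yⁿ, zⁿ)` of the Kummer transform of the curve `F = 0`. -/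
def kummerTransform (n : ℕ) (F : MvPolynomial (Fin 3) ℂ) : MvPolynomial (Fin 3) ℂ :=
  MvPolynomial.expand n F

/-- The two affine coordinates of `P` in the chart `X_k ≠ 0`. -/
def affineCoord (k : Fin 3) (P : Plane) (i : Fin 2) : ℂ :=
  P.rep (k.succAbove i) / P.rep k

/-- The polynomial `G(X₀, X₁, X₂)` with `X_k = 1` and with the other two variables replaced by
`u₀ + c₀` and `u₁ + c₁` (in increasing order of the index), where `c` are the affine coordinates
of `P` in the chart `X_k ≠ 0`. -/
def localPolynomial (k : Fin 3) (P : Plane) (G : MvPolynomial (Fin 3) ℂ) :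
    MvPolynomial (Fin 2) ℂ :=
  MvPolynomial.aeval (k.insertNth (α := fun _ => MvPolynomial (Fin 2) ℂ) 1
    fun i => MvPolynomial.X i + MvPolynomial.C (affineCoord k P i)) G

/-- The local equation at `P` of the curve `G = 0` in the chart `X_k = 1`, with respect to the
affine coordinates translated so that `P` becomes the origin. -/
def localEq (k : Fin 3) (P : Plane) (G : MvPolynomial (Fin 3) ℂ) : ConvSeries :=
  ⟨((localPolynomial k P G : MvPolynomial (Fin 2) ℂ) : MvPowerSeries (Fin 2) ℂ),
    isConvergent_coe (localPolynomial k P G)⟩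

/-- The components `(u_i + c_i)ⁿ - c_iⁿ` of the Kummer cover near `Q`, in the chart `X_k ≠ 0` and the
translated affine coordinates at `Q = c` and at its image `cⁿ`. -/
def kummerLocal (n : ℕ) (k : Fin 3) (Q : Plane) (i : Fin 2) : MvPolynomial (Fin 2) ℂ :=
  (MvPolynomial.X i + MvPolynomial.C (affineCoord k Q i)) ^ n -
    MvPolynomial.C (affineCoord k Q i ^ n)

theorem constantCoeff_kummerLocal (n : ℕ) (k : Fin 3) (Q : Plane) (i : Fin 2) :
    MvPowerSeries.constantCoeff (kummerLocal n k Q i : MvPowerSeries (Fin 2) ℂ) = 0 := by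
  rw [← MvPowerSeries.coeff_zero_eq_constantCoeff_apply, MvPolynomial.coeff_coe,
    ← MvPolynomial.constantCoeff_eq]
  simp [kummerLocal]

theorem pullback_mem (n : ℕ) (k : Fin 3) (Q : Plane) (f : ConvSeries) :
    AlgHom.comp (MvPowerSeries.substAlgHom (MvPowerSeries.hasSubst_of_constantCoeff_zero
      (constantCoeff_kummerLocal n k Q))) ConvSeries.val f ∈ ConvSeries := by
  have h := IsConvergent.subst (f := f.1) f.2
    (a := fun i => (kummerLocal n k Q i : MvPowerSeries (Fin 2) ℂ))
    (fun i => isConvergent_coe _) (constantCoeff_kummerLocal n k Q)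
  rw [← MvPowerSeries.substAlgHom_apply
    (MvPowerSeries.hasSubst_of_constantCoeff_zero (constantCoeff_kummerLocal n k Q))] at h
  exact h

/-- The pull-back `g ↦ g ∘ π_n` from germs at `π_n(Q)` to germs at `Q` (in the chart `X_k ≠ 0`).
If `δ = 0` is a germ at `π_n(Q)`, its preimage under `π_n` at `Q` is the germ
`pullback n k Q δ = 0`. -/
def pullback (n : ℕ) (k : Fin 3) (Q : Plane) : ConvSeries →ₐ[ℂ] ConvSeries :=
  AlgHom.codRestrict
    (AlgHom.comp (MvPowerSeries.substAlgHom (MvPowerSeries.hasSubst_of_constantCoeff_zero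
      (constantCoeff_kummerLocal n k Q))) ConvSeries.val)
    ConvSeries (pullback_mem n k Q)

end KummerCover

end

noncomputable section

namespace KummerCover

/-! ### The ring of convergent power series -/

/-! In local coordinates the Kummer cover is a power map. At a point of type 0 it raises both
coordinates to the power `n`. At a point of type 1 the coordinate that does not vanish is
transformed by an invertible series, so up to an automorphism only the coordinate of the axis is
raised to the power `n` (`exists_pullback_eq`).

Intersection numbers: `ConvSeries` is free with basis `1, X b, …, X b ^ (n - 1)` over the image of
`powMap b n`, so extending an ideal along `powMap b n` multiplies the dimension of the quotient by
`n` (`dimQuot_map_powMap`).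

Milnor numbers: by the chain rule each partial derivative of a pull-back is, up to a unit, the
pull-back of a partial derivative times `X b ^ (n - 1)` for the ramified directions. Additivity of
intersection numbers (`intersectionNumber_mul_right`) then gives the formulas, because
differentiating along an axis lowers the order of the equation on that axis by one.

Components: by Newton–Puiseux (`exists_puiseux`) an irreducible germ other than `X 1 = 0` has a
primitive parametrization `(φ(t), t ^ N)`, and its pull-back by `t ↦ t ^ N` is the product of the
`N` conjugate graphs (`exists_param_of_irreducible`). This yields unique factorization, and also the
splitting: with `e = gcd(n, N)`, the pull-back by `X 1 ↦ X 1 ^ n` has the `e` components `(φ(ζ ^ a *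
t ^ (n / e)), t ^ (N / e))`. At type 0 each of them splits again under the second power map. Any two
final components differ by a rotation of the coordinates, since the product of all rotates of one of
them descends to a germ containing the branch.

Finiteness: relatively prime germs have finite intersection number, and a reduced germ through the
origin has finite Milnor number because a common prime factor of its partial derivatives would be a
repeated factor. Local equations are reduced (`squarefree_germ`) by Gauss's lemma and a Bézout
relation between `F` and a derivative.

Convergence is controlled by exponential bounds on coefficients, and by majorants in the implicit
function theorem. -/

theorem summable_pow_degree {s : NNReal} (hs : s < 1) :
    Summable fun m : Fin 2 →₀ ℕ => s ^ m.degree := by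
  have h : Summable fun i : ℕ => s ^ i := NNReal.summable_geometric hs
  have h2 : Summable fun p : ℕ × ℕ => s ^ p.1 * s ^ p.2 := by
    have h' : Summable fun i : ℕ => ((s : ℝ)) ^ i := by exact_mod_cast h
    have := h'.mul_of_nonneg h' (fun _ => by positivity) (fun _ => by positivity)
    rw [← NNReal.summable_coe]
    exact this.congr fun p => by simp
  let e : (Fin 2 →₀ ℕ) ≃ ℕ × ℕ := Finsupp.equivFunOnFinite.trans (finTwoArrowEquiv ℕ)
  refine (e.summable_iff.mpr h2).congr fun m => ?_
  simp [e, Finsupp.degree_eq_sum, Fin.sum_univ_two, pow_add]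

/-- The terms of a convergent sum are bounded by its value (Cauchy's estimate); conversely an
exponential bound gives a geometric majorant on a small polydisc. Series defined by their
coefficients are shown to converge through this criterion. -/
theorem isConvergent_iff_bound (f : MvPowerSeries (Fin 2) ℂ) :
    IsConvergent f ↔
      ∃ C ρ : NNReal, ∀ m, ‖MvPowerSeries.coeff m f‖₊ ≤ C * ρ ^ m.degree := by
  constructor
  · rintro ⟨r, hr, h⟩
    refine ⟨∑' m : Fin 2 →₀ ℕ, ‖MvPowerSeries.coeff m f‖₊ * r ^ m.degree, r⁻¹, fun m => ?_⟩
    have := h.le_tsum m (fun _ _ => by positivity)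
    calc ‖MvPowerSeries.coeff m f‖₊
        = (‖MvPowerSeries.coeff m f‖₊ * r ^ m.degree) * r⁻¹ ^ m.degree := by
          rw [mul_assoc, ← mul_pow, mul_inv_cancel₀ hr.ne', one_pow, mul_one]
      _ ≤ _ := by gcongr
  · rintro ⟨C, ρ, h⟩
    -- This radius `r` is positive even if `ρ = 0`, and `ρ * r < 1`.
    refine ⟨(2 * (ρ + 1))⁻¹, by positivity, ?_⟩
    have hlt : ρ * (2 * (ρ + 1))⁻¹ < 1 := by
      rw [← div_eq_mul_inv, div_lt_one (by positivity)]
      have : ρ < ρ + 1 := lt_add_one ρ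
      calc ρ < ρ + 1 := this
        _ ≤ 2 * (ρ + 1) := by rw [two_mul]; exact le_self_add
    refine NNReal.summable_of_le (fun m => ?_) ((summable_pow_degree hlt).mul_left C)
    calc _ ≤ C * ρ ^ m.degree * (2 * (ρ + 1))⁻¹ ^ m.degree := by gcongr; exact h m
      _ = _ := by rw [mul_pow]; ring

namespace ConvSeries

/-- The coefficients of a convergent power series. -/
def coeff (m : Fin 2 →₀ ℕ) : ConvSeries →ₗ[ℂ] ℂ :=
  (MvPowerSeries.coeff m).comp ConvSeries.val.toLinearMap

theorem coeff_eq (m : Fin 2 →₀ ℕ) (f : ConvSeries) : coeff m f = MvPowerSeries.coeff m f.1 := rfl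

theorem ext_coeff {f g : ConvSeries} (h : ∀ m, coeff m f = coeff m g) : f = g :=
  Subtype.ext (MvPowerSeries.ext h)

theorem exists_bound (f : ConvSeries) :
    ∃ C ρ : NNReal, 1 ≤ ρ ∧ ∀ m, ‖coeff m f‖₊ ≤ C * ρ ^ m.degree := by
  obtain ⟨C, ρ, h⟩ := (isConvergent_iff_bound f.1).mp f.2
  refine ⟨C, max 1 ρ, le_max_left _ _, fun m => (h m).trans ?_⟩
  gcongr
  exact le_max_right _ _

/-- The convergent power series with prescribed coefficients. -/
def ofCoeff (a : (Fin 2 →₀ ℕ) → ℂ) (h : ∃ C ρ : NNReal, ∀ m, ‖a m‖₊ ≤ C * ρ ^ m.degree) :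
    ConvSeries :=
  ⟨a, (isConvergent_iff_bound _).mpr h⟩

@[simp] theorem coeff_ofCoeff (a : (Fin 2 →₀ ℕ) → ℂ) (h) (m : Fin 2 →₀ ℕ) :
    coeff m (ofCoeff a h) = a m := rfl

/-- Moving coefficients along a map of exponents of at most linear growth preserves an exponential
bound. Division by a power of a coordinate, deletion of monomials and the components along `powMap`
all converge for this reason. -/
theorem exists_remap (f : ConvSeries) (p : (Fin 2 →₀ ℕ) → Prop) [DecidablePred p]
    (e : (Fin 2 →₀ ℕ) → Fin 2 →₀ ℕ) (k l : ℕ) (he : ∀ m, (e m).degree ≤ k * m.degree + l) :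
    ∃ g : ConvSeries, ∀ m, coeff m g = if p m then coeff (e m) f else 0 := by
  obtain ⟨C, ρ, hρ, h⟩ := exists_bound f
  refine ⟨ofCoeff (fun m => if p m then coeff (e m) f else 0) ⟨C * ρ ^ l, ρ ^ k, fun m => ?_⟩,
    fun m => rfl⟩
  split_ifs
  · calc _ ≤ C * ρ ^ (e m).degree := h _
      _ ≤ C * ρ ^ (k * m.degree + l) := by exact mul_le_mul_right (pow_le_pow_right₀ hρ (he m)) C
      _ = _ := by rw [pow_add, pow_mul]; ring
  · simp

/-- The coordinate functions. -/
def X (i : Fin 2) : ConvSeries :=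
  ⟨MvPowerSeries.X i, by
    have := isConvergent_coe (MvPolynomial.X i)
    rwa [MvPolynomial.coe_X] at this⟩

/-- The value at the origin. -/
def evalZero : ConvSeries →ₐ[ℂ] ℂ where
  toRingHom := MvPowerSeries.constantCoeff.comp ConvSeries.val.toRingHom
  commutes' c := by
    change MvPowerSeries.constantCoeff (algebraMap ℂ (MvPowerSeries (Fin 2) ℂ) c) = _
    rw [MvPowerSeries.algebraMap_apply]; simp

theorem evalZero_eq (f : ConvSeries) : evalZero f = MvPowerSeries.constantCoeff f.1 := rfl

theorem evalZero_eq_coeff (f : ConvSeries) : evalZero f = coeff 0 f := by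
  rw [evalZero_eq, coeff_eq, MvPowerSeries.coeff_zero_eq_constantCoeff_apply]

@[simp] theorem evalZero_X (i : Fin 2) : evalZero (X i) = 0 :=
  MvPowerSeries.constantCoeff_X i

theorem coeff_C (m : Fin 2 →₀ ℕ) (c : ℂ) :
    coeff m (algebraMap ℂ ConvSeries c) = if m = 0 then c else 0 := by
  change MvPowerSeries.coeff m (algebraMap ℂ (MvPowerSeries (Fin 2) ℂ) c) = _
  rw [MvPowerSeries.algebraMap_apply, MvPowerSeries.coeff_C]; simp

theorem coeff_X (m : Fin 2 →₀ ℕ) (i : Fin 2) :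
    coeff m (X i) = if m = Finsupp.single i 1 then 1 else 0 :=
  MvPowerSeries.coeff_X m i

/-! ### Divisibility by a coordinate and the order filtration. -/

theorem coeff_add_single_X_mul (m : Fin 2 →₀ ℕ) (i : Fin 2) (f : ConvSeries) :
    coeff (m + Finsupp.single i 1) (X i * f) = coeff m f := by
  change MvPowerSeries.coeff _ (MvPowerSeries.X i * f.1) = _
  rw [add_comm, MvPowerSeries.X_def, MvPowerSeries.coeff_add_monomial_mul, one_mul]
  rfl

theorem coeff_X_mul_of_eq_zero {m : Fin 2 →₀ ℕ} {i : Fin 2} (h : m i = 0) (f : ConvSeries) :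
    coeff m (X i * f) = 0 := by
  change MvPowerSeries.coeff _ (MvPowerSeries.X i * f.1) = _
  rw [MvPowerSeries.X_def, MvPowerSeries.coeff_monomial_mul, if_neg]
  intro h'
  have := h' i
  simp [h] at this

theorem coeff_X_pow_mul (k : ℕ) (m : Fin 2 →₀ ℕ) (i : Fin 2) (f : ConvSeries) :
    coeff m (X i ^ k * f) = if k ≤ m i then coeff (m - Finsupp.single i k) f else 0 := by
  change MvPowerSeries.coeff _ (MvPowerSeries.X i ^ k * f.1) = _
  rw [MvPowerSeries.X_pow_eq, MvPowerSeries.coeff_monomial_mul, one_mul]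
  have : Finsupp.single i k ≤ m ↔ k ≤ m i := by simp
  simp only [this]; rfl

theorem X_pow_dvd_iff (k : ℕ) (i : Fin 2) (f : ConvSeries) :
    X i ^ k ∣ f ↔ ∀ m : Fin 2 →₀ ℕ, m i < k → coeff m f = 0 := by
  constructor
  · rintro ⟨g, rfl⟩ m hm
    rw [coeff_X_pow_mul, if_neg (by omega)]
  · intro h
    obtain ⟨g, hg⟩ := exists_remap f (fun _ => True) (fun m => m + Finsupp.single i k) 1 k
      (fun m => by simp [Finsupp.degree_single])
    refine ⟨g, ext_coeff fun m => ?_⟩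
    rw [coeff_X_pow_mul]
    split_ifs with hk
    · rw [hg, if_pos trivial, tsub_add_cancel_of_le (by simpa using hk)]
    · exact h m (by omega)

theorem X_dvd_iff (i : Fin 2) (f : ConvSeries) :
    X i ∣ f ↔ ∀ m : Fin 2 →₀ ℕ, m i = 0 → coeff m f = 0 := by
  simpa using X_pow_dvd_iff 1 i f

theorem X_ne_zero (i : Fin 2) : X i ≠ 0 := by
  intro h
  have := coeff_X (Finsupp.single i 1) i
  rw [h] at this
  simp at this

/-- The ideal of power series of order at least `k`. -/
def orderIdeal (k : ℕ) : Ideal ConvSeries where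
  carrier := {f | ∀ m : Fin 2 →₀ ℕ, m.degree < k → coeff m f = 0}
  add_mem' hf hg m hm := by rw [map_add, hf m hm, hg m hm, add_zero]
  zero_mem' m _ := map_zero _
  smul_mem' c f hf m hm := by
    refine MvPowerSeries.coeff_of_lt_order (f := c.1 * f.1) ?_
    have h1 : (k : ℕ∞) ≤ f.1.order := MvPowerSeries.nat_le_order hf
    calc ((m.degree : ℕ) : ℕ∞) < k := by exact_mod_cast hm
      _ ≤ c.1.order + f.1.order := h1.trans le_add_self
      _ ≤ _ := MvPowerSeries.le_order_mul

theorem mem_orderIdeal_iff_order {k : ℕ} {f : ConvSeries} :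
    f ∈ orderIdeal k ↔ (k : ℕ∞) ≤ f.1.order := by
  refine ⟨fun h => MvPowerSeries.nat_le_order h, fun h m hm => ?_⟩
  exact MvPowerSeries.coeff_of_lt_order (lt_of_lt_of_le (by exact_mod_cast hm) h)

theorem mul_mem_orderIdeal {j k : ℕ} {f g : ConvSeries} (hf : f ∈ orderIdeal j)
    (hg : g ∈ orderIdeal k) : f * g ∈ orderIdeal (j + k) := by
  rw [mem_orderIdeal_iff_order] at *
  push_cast
  exact (add_le_add hf hg).trans MvPowerSeries.le_order_mul

theorem orderIdeal_antitone : Antitone orderIdeal :=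
  fun _ _ h _ hf m hm => hf m (hm.trans_le h)

theorem mem_orderIdeal_zero (f : ConvSeries) : f ∈ orderIdeal 0 := fun _ h => absurd h (by simp)

theorem mem_orderIdeal_one {f : ConvSeries} : f ∈ orderIdeal 1 ↔ evalZero f = 0 := by
  rw [evalZero_eq_coeff]
  refine ⟨fun h => h 0 (by simp), fun h m hm => ?_⟩
  have : m = 0 := by rw [← Finsupp.degree_eq_zero_iff]; omega
  rw [this, h]

/-- The order filtration is separated, so identities can be proved to order `k` by induction on `k`.
-/
theorem eq_zero_of_forall_mem_orderIdeal {f : ConvSeries} (h : ∀ k, f ∈ orderIdeal k) : f = 0 :=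
  ext_coeff fun m => by rw [h (m.degree + 1) m (by omega), map_zero]

/-- The part of a power series that does not involve `X i`, and the rest. -/
theorem exists_eq_add_X_mul (i : Fin 2) (f : ConvSeries) :
    ∃ g h : ConvSeries, f = g + X i * h ∧
      (∀ m, coeff m g = if m i = 0 then coeff m f else 0) ∧
      ∀ m, coeff m h = coeff (m + Finsupp.single i 1) f := by
  obtain ⟨g, hg⟩ := exists_remap f (fun m => m i = 0) id 1 0 (fun m => by simp)
  have : X i ∣ f - g := by
    rw [X_dvd_iff]
    intro m hm
    rw [map_sub, hg, if_pos hm, id, sub_self]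
  obtain ⟨h, hh⟩ := this
  refine ⟨g, h, by rw [← hh]; ring, hg, fun m => ?_⟩
  rw [← coeff_add_single_X_mul m i, ← hh, map_sub, hg, if_neg (by simp), sub_zero]

/-- All monomials containing `X b` go into the last term, so `g` involves `X a` alone. This lets
inductions stay inside series in one variable. -/
theorem exists_eq_C_add {a b : Fin 2} (hab : a ≠ b) (f : ConvSeries) :
    ∃ g h : ConvSeries, f = algebraMap ℂ ConvSeries (evalZero f) + X a * g + X b * h ∧
      ∀ m, coeff m g = if m b = 0 then coeff (m + Finsupp.single a 1) f else 0 := by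
  obtain ⟨f₀, h, hf, h0, -⟩ := exists_eq_add_X_mul b f
  obtain ⟨f₁, g, hf₀, h1, hg⟩ := exists_eq_add_X_mul a f₀
  have : f₁ = algebraMap ℂ ConvSeries (evalZero f) := by
    refine ext_coeff fun m => ?_
    rw [h1, h0, coeff_C, evalZero_eq_coeff]
    by_cases hm : m = 0
    · simp [hm]
    · rw [if_neg hm]
      by_cases ha : m a = 0
      · rw [if_pos ha, if_neg]
        intro hb
        apply hm
        ext i
        have : i = a ∨ i = b := by omega
        rcases this with rfl | rfl <;> simp [*]
      · rw [if_neg ha]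
  refine ⟨g, h, by rw [← this, ← hf₀, ← hf], fun m => ?_⟩
  rw [hg, h0]
  simp [hab]

theorem exists_eq_C_add' (f : ConvSeries) :
    ∃ g h : ConvSeries, f = algebraMap ℂ ConvSeries (evalZero f) + X 0 * g + X 1 * h := by
  obtain ⟨g, h, e, -⟩ := exists_eq_C_add (show (0 : Fin 2) ≠ 1 by decide) f
  exact ⟨g, h, e⟩

/-! ### Substitution -/

theorem hasSubst_sub (p : Fin 2 → ConvSeries) : MvPowerSeries.HasSubst fun i =>
    (p i - algebraMap ℂ ConvSeries (evalZero (p i))).1 :=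
  MvPowerSeries.hasSubst_of_constantCoeff_zero fun i => by rw [← evalZero_eq]; simp

/-- The substitution `X i ↦ p i - p i (0)`. -/
def sub (p : Fin 2 → ConvSeries) : ConvSeries →ₐ[ℂ] ConvSeries :=
  AlgHom.codRestrict
    (AlgHom.comp (MvPowerSeries.substAlgHom (hasSubst_sub p)) ConvSeries.val) ConvSeries fun f => by
    have := IsConvergent.subst f.2
      (fun i => (p i - algebraMap ℂ ConvSeries (evalZero (p i))).2)
      (fun i => by rw [← evalZero_eq]; simp)
    rw [← MvPowerSeries.substAlgHom_apply (hasSubst_sub p)] at this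
    exact this

theorem sub_val {p : Fin 2 → ConvSeries} (hp : ∀ i, evalZero (p i) = 0) (f : ConvSeries) :
    (sub p f).1 = MvPowerSeries.subst (fun i => (p i).1) f.1 := by
  change MvPowerSeries.substAlgHom (hasSubst_sub p) f.1 = _
  rw [MvPowerSeries.substAlgHom_apply]
  congr 1
  funext i
  simp [hp]

theorem sub_X' (p : Fin 2 → ConvSeries) (i : Fin 2) :
    sub p (X i) = p i - algebraMap ℂ ConvSeries (evalZero (p i)) :=
  Subtype.ext (MvPowerSeries.substAlgHom_X (hasSubst_sub p) i)

theorem sub_X {p : Fin 2 → ConvSeries} {i : Fin 2} (hp : evalZero (p i) = 0) :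
    sub p (X i) = p i := by
  rw [sub_X', hp, map_zero, sub_zero]

/-! ### Units -/

theorem isUnit_one_sub_X : IsUnit (1 - X 0) := by
  let g : ConvSeries := ofCoeff (fun m => if m 1 = 0 then 1 else 0) ⟨1, 1, fun m => by
    split_ifs <;> simp⟩
  refine IsUnit.of_mul_eq_one g (ext_coeff fun m => ?_)
  rw [sub_mul, one_mul, map_sub, ← map_one (algebraMap ℂ ConvSeries), coeff_C]
  have := coeff_X_pow_mul 1 m 0 g
  rw [pow_one] at this
  rw [this]
  simp only [g, coeff_ofCoeff]
  by_cases hm : m = 0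
  · simp [hm]
  · rw [if_neg hm]
    by_cases h1 : m 1 = 0
    · have h0 : 1 ≤ m 0 := by
        by_contra h0
        apply hm
        ext i
        fin_cases i
        · simpa using h0
        · exact h1
      simp [h1, h0]
    · simp [h1]

/-- With `c` the value at the origin, substituting `1 - c⁻¹ * f` for `X 0` carries the unit `1 - X
0` to `c⁻¹ * f`. Inverting the single series `1 - X 0` is therefore enough. -/
theorem isUnit_iff {f : ConvSeries} : IsUnit f ↔ evalZero f ≠ 0 := by
  refine ⟨fun h => (h.map evalZero).ne_zero, fun h => ?_⟩
  set c := evalZero f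
  have h1 : IsUnit (sub (fun _ => 1 - algebraMap ℂ ConvSeries c⁻¹ * f) (1 - X 0)) :=
    isUnit_one_sub_X.map _
  rw [map_sub, map_one, sub_X (by simp [c, h]), sub_sub_cancel] at h1
  exact isUnit_of_mul_isUnit_right h1

/-- Every endomorphism is local: `f - (φ f)(0)` has an image vanishing at the origin, so it is not a
unit, so it vanishes at the origin itself. -/
theorem evalZero_algHom (φ : ConvSeries →ₐ[ℂ] ConvSeries) (f : ConvSeries) :
    evalZero (φ f) = evalZero f := by
  by_contra h
  have h1 : ¬ IsUnit (f - algebraMap ℂ ConvSeries (evalZero (φ f))) := by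
    intro hu
    have := isUnit_iff.mp (hu.map φ)
    simp at this
  rw [isUnit_iff, not_not] at h1
  simp only [map_sub, AlgHom.commutes] at h1
  exact h (sub_eq_zero.mp h1).symm

/-- Endomorphisms are automatically continuous. In `f = c + X 0 * a + X 1 * b` the images of the
coordinates have no constant term, so each step of the induction gains one order. -/
theorem algHom_sub_mem {φ ψ : ConvSeries →ₐ[ℂ] ConvSeries} {k : ℕ}
    (h : ∀ i, φ (X i) - ψ (X i) ∈ orderIdeal k) (f : ConvSeries) :
    φ f - ψ f ∈ orderIdeal k := by
  have key : ∀ l ≤ k, ∀ f, φ f - ψ f ∈ orderIdeal l := by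
    intro l
    induction l with
    | zero => exact fun _ f => mem_orderIdeal_zero _
    | succ l ih =>
      intro hl f
      obtain ⟨a, b, e⟩ := exists_eq_C_add' f
      have : φ f - ψ f = φ (X 0) * (φ a - ψ a) + (φ (X 0) - ψ (X 0)) * ψ a +
          (φ (X 1) * (φ b - ψ b) + (φ (X 1) - ψ (X 1)) * ψ b) := by
        rw [e]
        simp only [map_add, map_mul, AlgHom.commutes]
        ring
      have hX : ∀ i, φ (X i) ∈ orderIdeal 1 := fun i => by
        rw [mem_orderIdeal_one, evalZero_algHom, evalZero_X]
      rw [this]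
      refine add_mem (add_mem ?_ ?_) (add_mem ?_ ?_)
      · rw [add_comm l]; exact mul_mem_orderIdeal (hX 0) (ih (by omega) a)
      · exact Ideal.mul_mem_right _ _ (orderIdeal_antitone hl (h 0))
      · rw [add_comm l]; exact mul_mem_orderIdeal (hX 1) (ih (by omega) b)
      · exact Ideal.mul_mem_right _ _ (orderIdeal_antitone hl (h 1))
  exact key k le_rfl f

/-- Identities between substitutions, rotations, restrictions and power maps can thus be checked on
the coordinates. -/
theorem algHom_ext {φ ψ : ConvSeries →ₐ[ℂ] ConvSeries} (h : ∀ i, φ (X i) = ψ (X i)) : φ = ψ := by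
  ext1 f
  refine sub_eq_zero.mp (eq_zero_of_forall_mem_orderIdeal fun k => algHom_sub_mem (fun i => ?_) f)
  rw [h, sub_self]
  exact zero_mem _

/-! ### Derivatives -/

theorem coeff_partialDeriv (i : Fin 2) (m : Fin 2 →₀ ℕ) (f : ConvSeries) :
    coeff m (partialDeriv i f) = coeff (m + Finsupp.single i 1) f * (m i + 1) :=
  MvPowerSeries.coeff_pderiv _ _

theorem partialDeriv_add (i : Fin 2) (f g : ConvSeries) :
    partialDeriv i (f + g) = partialDeriv i f + partialDeriv i g :=
  Subtype.ext (map_add (MvPowerSeries.pderiv ℂ i) f.1 g.1)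

theorem partialDeriv_mul (i : Fin 2) (f g : ConvSeries) :
    partialDeriv i (f * g) = f * partialDeriv i g + g * partialDeriv i f :=
  Subtype.ext ((MvPowerSeries.pderiv ℂ i).leibniz f.1 g.1)

theorem partialDeriv_C (i : Fin 2) (c : ℂ) : partialDeriv i (algebraMap ℂ ConvSeries c) = 0 :=
  Subtype.ext ((MvPowerSeries.pderiv ℂ i).map_algebraMap c)

theorem partialDeriv_X (i j : Fin 2) : partialDeriv i (X j) = if i = j then 1 else 0 := by
  apply Subtype.ext
  change MvPowerSeries.pderiv ℂ i (MvPowerSeries.X j) = _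
  rw [MvPowerSeries.pderiv_X, Pi.single_apply]
  simp only [eq_comm]
  split_ifs <;> rfl

theorem partialDeriv_pow (i : Fin 2) (f : ConvSeries) (n : ℕ) :
    partialDeriv i (f ^ n) = n * f ^ (n - 1) * partialDeriv i f := by
  apply Subtype.ext
  change MvPowerSeries.pderiv ℂ i (f.1 ^ n) = _
  rw [MvPowerSeries.pderiv_pow]
  rfl

/-- The chain rule. -/
theorem partialDeriv_algHom (φ : ConvSeries →ₐ[ℂ] ConvSeries) (i : Fin 2) (f : ConvSeries) :
    partialDeriv i (φ f) = φ (partialDeriv 0 f) * partialDeriv i (φ (X 0)) +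
      φ (partialDeriv 1 f) * partialDeriv i (φ (X 1)) := by
  -- For `f = c + X 0 * a + X 1 * b` the defect of the formula is `φ (X 0)` times the defect for `a`
  -- plus `φ (X 1)` times the defect for `b`, so its order exceeds every bound.
  have key : ∀ k f, partialDeriv i (φ f) - (φ (partialDeriv 0 f) * partialDeriv i (φ (X 0)) +
      φ (partialDeriv 1 f) * partialDeriv i (φ (X 1))) ∈ orderIdeal k := by
    intro k
    induction k with
    | zero => exact fun f => mem_orderIdeal_zero _
    | succ k ih =>
      intro f
      obtain ⟨a, b, e⟩ := exists_eq_C_add' f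
      generalize hc : evalZero f = c at e
      have h01 : (0 : Fin 2) ≠ 1 := by decide
      have hX : ∀ i, φ (X i) ∈ orderIdeal 1 := fun i => by
        rw [mem_orderIdeal_one, evalZero_algHom, evalZero_X]
      have := add_mem (mul_mem_orderIdeal (hX 0) (ih a)) (mul_mem_orderIdeal (hX 1) (ih b))
      rw [add_comm 1] at this
      convert this using 1
      rw [e]
      simp only [map_add, map_mul, AlgHom.commutes, partialDeriv_add, partialDeriv_mul,
        partialDeriv_C, partialDeriv_X, if_neg h01, if_neg h01.symm, if_true, map_zero, map_one]
      ring
  exact sub_eq_zero.mp (eq_zero_of_forall_mem_orderIdeal fun k => key k f)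

/-! ### Restriction to the coordinate axes -/

/-- The restriction to the axis with coordinate `X a`, seen as a power series in `X a`. -/
def axis (a : Fin 2) : ConvSeries →ₐ[ℂ] ConvSeries :=
  sub fun i => if i = a then X a else 0

@[simp] theorem axis_X_self (a : Fin 2) : axis a (X a) = X a := by
  rw [axis, sub_X] <;> simp

theorem axis_X_of_ne {a b : Fin 2} (hab : a ≠ b) : axis a (X b) = 0 := by
  rw [axis, sub_X] <;> simp [hab.symm]

theorem axis_eq_self {a b : Fin 2} (hab : a ≠ b) {f : ConvSeries}
    (hf : ∀ m : Fin 2 →₀ ℕ, m b ≠ 0 → coeff m f = 0) : axis a f = f := by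
  have key : ∀ k (f : ConvSeries), (∀ m : Fin 2 →₀ ℕ, m b ≠ 0 → coeff m f = 0) →
      axis a f - f ∈ orderIdeal k := by
    intro k
    induction k with
    | zero => exact fun f _ => mem_orderIdeal_zero _
    | succ k ih =>
      intro f hf
      obtain ⟨g, h, e, hg⟩ := exists_eq_C_add hab f
      generalize evalZero f = c at e
      have hg' : ∀ m : Fin 2 →₀ ℕ, m b ≠ 0 → coeff m g = 0 := fun m hm => by
        rw [hg, if_neg hm]
      have h0 : X b * h = 0 := by
        refine ext_coeff fun m => ?_
        rw [map_zero]
        by_cases hm : m b = 0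
        · exact coeff_X_mul_of_eq_zero hm h
        · have e1 : X b * h = f - algebraMap ℂ ConvSeries c - X a * g := by rw [e]; ring
          have e2 := coeff_X_pow_mul 1 m a g
          rw [pow_one] at e2
          rw [e1, map_sub, map_sub, hf m hm, coeff_C, if_neg (by rintro rfl; simp at hm), e2]
          split_ifs
          · rw [hg' _ (by simpa [hab] using hm)]; simp
          · simp
      have e2 : axis a f - f = X a * (axis a g - g) := by
        rw [e, h0, add_zero, map_add, map_mul, AlgHom.commutes, axis_X_self]
        ring
      rw [e2, add_comm k]
      exact mul_mem_orderIdeal (mem_orderIdeal_one.mpr (evalZero_X a)) (ih g hg')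
  exact sub_eq_zero.mp (eq_zero_of_forall_mem_orderIdeal fun k => key k f hf)

theorem coeff_axis {a b : Fin 2} (hab : a ≠ b) (m : Fin 2 →₀ ℕ) (f : ConvSeries) :
    coeff m (axis a f) = if m b = 0 then coeff m f else 0 := by
  obtain ⟨g, h, e, hg, -⟩ := exists_eq_add_X_mul b f
  have : axis a f = g := by
    conv_lhs => rw [e]
    rw [map_add, map_mul, axis_X_of_ne hab, zero_mul, add_zero]
    exact axis_eq_self hab fun m hm => by rw [hg, if_neg hm]
  rw [this, hg]

theorem axis_eq_zero_iff {a b : Fin 2} (hab : a ≠ b) {f : ConvSeries} :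
    axis a f = 0 ↔ X b ∣ f := by
  constructor
  · intro h
    rw [X_dvd_iff]
    intro m hm
    have := coeff_axis hab m f
    rwa [h, map_zero, if_pos hm, eq_comm] at this
  · rintro ⟨g, rfl⟩
    rw [map_mul, axis_X_of_ne hab, zero_mul]

theorem sub_axis_dvd {a b : Fin 2} (hab : a ≠ b) (f : ConvSeries) : X b ∣ f - axis a f := by
  rw [X_dvd_iff]
  intro m hm
  rw [map_sub, coeff_axis hab, if_pos hm, sub_self]

@[simp] theorem axis_axis (a : Fin 2) (f : ConvSeries) : axis a (axis a f) = axis a f := by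
  have : (axis a).comp (axis a) = axis a := algHom_ext fun i => by
    by_cases h : a = i
    · subst h; simp
    · simp [axis_X_of_ne h]
  exact DFunLike.congr_fun this f

/-- The restriction of `f` to the axis with coordinate `X a` has order `m`. -/
def HasAxisOrder (a : Fin 2) (f : ConvSeries) (m : ℕ) : Prop :=
  ∃ w, IsUnit w ∧ axis a f = X a ^ m * w

theorem coeff_single_axis (a : Fin 2) (i : ℕ) (f : ConvSeries) :
    coeff (Finsupp.single a i) (axis a f) = coeff (Finsupp.single a i) f := by
  obtain ⟨b, hb⟩ := exists_ne a
  rw [coeff_axis hb.symm, if_pos (by simp [hb])]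

theorem hasAxisOrder_iff {a : Fin 2} {f : ConvSeries} {m : ℕ} :
    HasAxisOrder a f m ↔
      (∀ i < m, coeff (Finsupp.single a i) f = 0) ∧ coeff (Finsupp.single a m) f ≠ 0 := by
  simp_rw [← coeff_single_axis a _ f]
  constructor
  · rintro ⟨w, hw, e⟩
    refine ⟨fun i hi => ?_, ?_⟩
    · rw [e, coeff_X_pow_mul, if_neg (by simpa using hi)]
    · rw [e, coeff_X_pow_mul, if_pos (by simp), tsub_self, ← evalZero_eq_coeff]
      exact isUnit_iff.mp hw
  · rintro ⟨h1, h2⟩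
    obtain ⟨b, hb⟩ := exists_ne a
    have hd : X a ^ m ∣ axis a f := by
      rw [X_pow_dvd_iff]
      intro d hd
      by_cases hdb : d b = 0
      · have : d = Finsupp.single a (d a) := by
          ext i
          have : i = a ∨ i = b := by omega
          rcases this with rfl | rfl
          · simp
          · simp [hdb, hb]
        rw [this]; exact h1 _ hd
      · rw [coeff_axis hb.symm, if_neg hdb]
    obtain ⟨w, hw⟩ := hd
    refine ⟨w, ?_, hw⟩
    rw [hw, coeff_X_pow_mul, if_pos (by simp), tsub_self, ← evalZero_eq_coeff] at h2
    exact isUnit_iff.mpr h2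

theorem HasAxisOrder.unique {a : Fin 2} {f : ConvSeries} {m m' : ℕ} (h : HasAxisOrder a f m)
    (h' : HasAxisOrder a f m') : m = m' := by
  rw [hasAxisOrder_iff] at h h'
  rcases lt_trichotomy m m' with h1 | h1 | h1
  · exact absurd (h'.1 m h1) h.2
  · exact h1
  · exact absurd (h.1 m' h1) h'.2

theorem HasAxisOrder.mul {a : Fin 2} {f g : ConvSeries} {m k : ℕ} (h : HasAxisOrder a f m)
    (h' : HasAxisOrder a g k) : HasAxisOrder a (f * g) (m + k) := by
  obtain ⟨w, hw, e⟩ := h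
  obtain ⟨w', hw', e'⟩ := h'
  exact ⟨w * w', hw.mul hw', by rw [map_mul, e, e']; ring⟩

theorem exists_hasAxisOrder {a : Fin 2} {f : ConvSeries} (h : axis a f ≠ 0) :
    ∃ m, HasAxisOrder a f m := by
  classical
  have : ∃ i, coeff (Finsupp.single a i) f ≠ 0 := by
    by_contra! hc
    apply h
    obtain ⟨b, hb⟩ := exists_ne a
    refine ext_coeff fun d => ?_
    rw [coeff_axis hb.symm, map_zero]
    split_ifs with hd
    · have : d = Finsupp.single a (d a) := by
        ext i
        have : i = a ∨ i = b := by omega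
        rcases this with rfl | rfl
        · simp
        · simp [hd, hb]
      rw [this, hc]
    · rfl
  refine ⟨Nat.find this, hasAxisOrder_iff.mpr ⟨fun i hi => ?_, Nat.find_spec this⟩⟩
  exact not_not.mp (Nat.find_min this hi)

theorem exists_hasAxisOrder_of_not_dvd {a b : Fin 2} (hab : a ≠ b) {f : ConvSeries}
    (h : ¬ X b ∣ f) : ∃ m, HasAxisOrder a f m :=
  exists_hasAxisOrder fun h0 => h ((axis_eq_zero_iff hab).mp h0)

theorem HasAxisOrder.axis_ne_zero {a : Fin 2} {f : ConvSeries} {m : ℕ} (h : HasAxisOrder a f m) :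
    axis a f ≠ 0 := by
  obtain ⟨w, hw, e⟩ := h
  rw [e]
  exact mul_ne_zero (pow_ne_zero _ (X_ne_zero a)) hw.ne_zero

theorem HasAxisOrder.pos_iff {a : Fin 2} {f : ConvSeries} {m : ℕ} (h : HasAxisOrder a f m) :
    0 < m ↔ evalZero f = 0 := by
  obtain ⟨w, hw, e⟩ := h
  rw [← evalZero_algHom (axis a), e, map_mul, map_pow, evalZero_X]
  rcases Nat.eq_zero_or_pos m with rfl | hm
  · simpa using isUnit_iff.mp hw
  · simp [hm, hm.ne']

/-! ### The implicit function theorem -/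

/-- The substitution `X 0 ↦ p`, `X 1 ↦ q`. -/
abbrev sub2 (p q : ConvSeries) : ConvSeries →ₐ[ℂ] ConvSeries := sub ![p, q]

theorem sub2_X0 {p q : ConvSeries} (h : evalZero p = 0) : sub2 p q (X 0) = p := sub_X h

theorem sub2_X1 {p q : ConvSeries} (h : evalZero q = 0) : sub2 p q (X 1) = q := sub_X h

theorem algHom_ext2 {φ ψ : ConvSeries →ₐ[ℂ] ConvSeries} (h0 : φ (X 0) = ψ (X 0))
    (h1 : φ (X 1) = ψ (X 1)) : φ = ψ :=
  algHom_ext fun i => by fin_cases i <;> assumption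

theorem algHom_eq_sub2 (φ : ConvSeries →ₐ[ℂ] ConvSeries) : φ = sub2 (φ (X 0)) (φ (X 1)) :=
  algHom_ext2 (by rw [sub2_X0]; rw [evalZero_algHom, evalZero_X])
    (by rw [sub2_X1]; rw [evalZero_algHom, evalZero_X])

theorem algHom_sub2 (φ : ConvSeries →ₐ[ℂ] ConvSeries) {p q : ConvSeries} (hp : evalZero p = 0)
    (hq : evalZero q = 0) (f : ConvSeries) : φ (sub2 p q f) = sub2 (φ p) (φ q) f := by
  have : φ.comp (sub2 p q) = sub2 (φ p) (φ q) := algHom_ext2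
    (by rw [AlgHom.comp_apply, sub2_X0 hp, sub2_X0]; rwa [evalZero_algHom])
    (by rw [AlgHom.comp_apply, sub2_X1 hq, sub2_X1]; rwa [evalZero_algHom])
  exact DFunLike.congr_fun this f

theorem sub2_algHom {p q : ConvSeries} (φ : ConvSeries →ₐ[ℂ] ConvSeries) (f : ConvSeries) :
    sub2 p q (φ f) = sub2 (sub2 p q (φ (X 0))) (sub2 p q (φ (X 1))) f :=
  DFunLike.congr_fun (algHom_eq_sub2 ((sub2 p q).comp φ)) f

/-! ### Majorants and the fixed point of a contraction. -/

theorem majorant_X_le (r : NNReal) (i : Fin 2) : majorant r (X i).1 ≤ r := by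
  rw [majorant, tsum_eq_single (Finsupp.single i 1)]
  · rw [← coeff_eq, coeff_X]; simp
  · intro m hm
    rw [← coeff_eq, coeff_X]; simp [hm]

theorem majorant_smul (r : NNReal) (c : ℂ) (f : ConvSeries) :
    majorant r (c • f).1 = ‖c‖₊ * majorant r f.1 := by
  rw [majorant, majorant, ← ENNReal.tsum_mul_left]
  refine tsum_congr fun m => ?_
  rw [← coeff_eq, map_smul, ← coeff_eq, smul_eq_mul, nnnorm_mul, mul_assoc, ENNReal.coe_mul]

theorem nnnorm_coeff_le_majorant (m : Fin 2 →₀ ℕ) (f : ConvSeries) :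
    (‖coeff m f‖₊ : ENNReal) ≤ majorant 1 f.1 := by
  have := ENNReal.le_tsum (f := fun m : Fin 2 →₀ ℕ =>
    ((‖MvPowerSeries.coeff m f.1‖₊ * 1 ^ m.degree : NNReal) : ENNReal)) m
  simpa [majorant, coeff_eq] using this

/-- The equation `u = h(u, t)` is solved by iteration from `0`. The shape `t * p + u ^ 2 * q` gains
one order of agreement at each step, and substitution preserves the bound `1` on majorants. Hence
the coefficients stabilise and the limit has coefficients of modulus at most `1`. -/
theorem exists_fixed_point {h p q : ConvSeries} (hh : h = X 1 * p + X 0 ^ 2 * q)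
    (hm : majorant 1 h.1 ≤ 1) :
    ∃ φ, evalZero φ = 0 ∧ axis 1 φ = φ ∧ sub2 φ (X 1) h = φ := by
  obtain ⟨Φ, hΦ0, hΦ⟩ : ∃ Φ : ℕ → ConvSeries, Φ 0 = 0 ∧ ∀ k, Φ (k + 1) = sub2 (Φ k) (X 1) h :=
    ⟨fun k => Nat.rec 0 (fun _ φ => sub2 φ (X 1) h) k, rfl, fun _ => rfl⟩
  have h0 : ∀ k, evalZero (Φ k) = 0 := by
    intro k
    cases k with
    | zero => rw [hΦ0, map_zero]
    | succ k => rw [hΦ, evalZero_algHom, hh]; simp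
  have hmaj : ∀ k, majorant 1 (Φ k).1 ≤ 1 := by
    intro k
    induction k with
    | zero =>
      have : majorant 1 (Φ 0).1 = 0 := by
        rw [hΦ0]
        change majorant 1 (0 : MvPowerSeries (Fin 2) ℂ) = 0
        simp [majorant]
      rw [this]; exact zero_le
    | succ k ih =>
      have hz : ∀ i, evalZero (![Φ k, X 1] i) = 0 := fun i => by fin_cases i <;> simp [h0]
      rw [hΦ, sub2, sub_val hz]
      refine (majorant_subst_le hz (r := 1) (fun i => ?_) _).trans hm
      fin_cases i
      · exact ih
      · exact majorant_X_le 1 1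
  have hax : ∀ k, axis 1 (Φ k) = Φ k := by
    intro k
    induction k with
    | zero => rw [hΦ0, map_zero]
    | succ k ih => rw [hΦ, algHom_sub2 _ (h0 k) (evalZero_X 1), ih, axis_X_self]
  have hstep : ∀ k, Φ (k + 1) - Φ k ∈ orderIdeal (k + 1) := by
    intro k
    induction k with
    | zero =>
      rw [mem_orderIdeal_one, map_sub, h0, h0, sub_zero]
    | succ k ih =>
      have hd := fun f => algHom_sub_mem (φ := sub2 (Φ (k + 1)) (X 1)) (ψ := sub2 (Φ k) (X 1))
        (k := k + 1) (fun i => by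
          fin_cases i
          · change sub2 _ _ (X 0) - sub2 _ _ (X 0) ∈ _
            rw [sub2_X0 (h0 _), sub2_X0 (h0 _)]; exact ih
          · change sub2 _ _ (X 1) - sub2 _ _ (X 1) ∈ _
            rw [sub2_X1 (evalZero_X _), sub2_X1 (evalZero_X _), sub_self]; exact zero_mem _) f
      -- Each summand is a factor without constant term times a difference already controlled at
      -- order `k + 1`; the last one comes from `u ^ 2 - v ^ 2 = (u + v) * (u - v)`.
      have e : Φ (k + 1 + 1) - Φ (k + 1) =
          X 1 * (sub2 (Φ (k + 1)) (X 1) p - sub2 (Φ k) (X 1) p) +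
          Φ (k + 1) ^ 2 * (sub2 (Φ (k + 1)) (X 1) q - sub2 (Φ k) (X 1) q) +
          (Φ (k + 1) + Φ k) * (Φ (k + 1) - Φ k) * sub2 (Φ k) (X 1) q := by
        have e1 : ∀ j, Φ (j + 1) = X 1 * sub2 (Φ j) (X 1) p + Φ j ^ 2 * sub2 (Φ j) (X 1) q := by
          intro j
          rw [hΦ]
          conv_lhs => rw [hh]
          rw [map_add, map_mul, map_mul, map_pow, sub2_X0 (h0 _), sub2_X1 (evalZero_X _)]
        have e2 := e1 k
        rw [e1 (k + 1)]
        generalize Φ (k + 1) = y at *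
        linear_combination -e2
      have h1 : ∀ j, Φ j ∈ orderIdeal 1 := fun j => mem_orderIdeal_one.mpr (h0 j)
      rw [e, add_comm (k + 1) 1]
      refine add_mem (add_mem ?_ ?_) ?_
      · exact mul_mem_orderIdeal (mem_orderIdeal_one.mpr (evalZero_X _)) (hd p)
      · rw [sq, mul_assoc]
        exact mul_mem_orderIdeal (h1 _) (Ideal.mul_mem_left _ _ (hd q))
      · exact Ideal.mul_mem_right _ _ (mul_mem_orderIdeal (add_mem (h1 _) (h1 _)) ih)
  have hcoef : ∀ m : Fin 2 →₀ ℕ, ∀ k, m.degree ≤ k → coeff m (Φ k) = coeff m (Φ m.degree) := by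
    intro m k hk
    induction k, hk using Nat.le_induction with
    | base => rfl
    | succ k hk ih =>
      rw [← ih, ← sub_eq_zero, ← map_sub]
      exact hstep k m (by omega)
  -- The coefficient at `m` is constant from the iterate of index `m.degree` on.
  let φ : ConvSeries := ofCoeff (fun m => coeff m (Φ m.degree)) ⟨1, 1, fun m => by
    have := (nnnorm_coeff_le_majorant m (Φ m.degree)).trans (hmaj _)
    simpa using this⟩
  have hφ : ∀ k, φ - Φ k ∈ orderIdeal (k + 1) := fun k m hmk => by
    rw [map_sub, hcoef m k (by omega), sub_eq_zero]
    rfl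
  have hφ0 : evalZero φ = 0 := by
    have := mem_orderIdeal_one.mp (hφ 0)
    rwa [map_sub, h0, sub_zero] at this
  refine ⟨φ, hφ0, ?_, ?_⟩
  · refine axis_eq_self (b := 0) (by decide) fun m hm => ?_
    have := coeff_axis (show (1 : Fin 2) ≠ 0 by decide) m (Φ m.degree)
    rw [hax, if_neg hm] at this
    exact this
  · refine sub_eq_zero.mp (eq_zero_of_forall_mem_orderIdeal fun k => ?_)
    have e : sub2 φ (X 1) h - φ =
        (sub2 φ (X 1) h - sub2 (Φ k) (X 1) h) - (φ - Φ (k + 1)) := by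
      rw [hΦ]; ring
    rw [e]
    refine sub_mem (algHom_sub_mem (fun i => ?_) h)
      (orderIdeal_antitone (by omega) (hφ (k + 1)))
    fin_cases i
    · change sub2 _ _ (X 0) - sub2 _ _ (X 0) ∈ _
      rw [sub2_X0 hφ0, sub2_X0 (h0 _)]; exact orderIdeal_antitone (by omega) (hφ k)
    · change sub2 _ _ (X 1) - sub2 _ _ (X 1) ∈ _
      rw [sub2_X1 (evalZero_X _), sub2_X1 (evalZero_X _), sub_self]; exact zero_mem _

/-- The implicit function theorem. -/
theorem exists_implicit {f : ConvSeries} (hf : HasAxisOrder 0 f 1) :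
    ∃ φ, evalZero φ = 0 ∧ axis 1 φ = φ ∧ sub2 φ (X 1) f = 0 := by
  have hf0 : evalZero f = 0 := hf.pos_iff.mp one_pos
  obtain ⟨-, hc⟩ := hasAxisOrder_iff.mp hf
  set c := coeff (Finsupp.single 0 1) f
  -- Zeros of `f` in the variable `X 0` are fixed points of `h₀`, whose linear term in `X 0` has
  -- been cancelled.
  set h₀ : ConvSeries := X 0 - c⁻¹ • f with hh₀
  have h₀0 : evalZero h₀ = 0 := by simp [hh₀, hf0]
  obtain ⟨A, B, e, hA⟩ := exists_eq_C_add (show (0 : Fin 2) ≠ 1 by decide) h₀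
  have hA0 : evalZero A = 0 := by
    rw [evalZero_eq_coeff, hA, if_pos (by simp), zero_add, hh₀, map_sub, map_smul, coeff_X,
      if_pos rfl, smul_eq_mul, inv_mul_cancel₀ hc, sub_self]
  obtain ⟨q, B', e', -⟩ := exists_eq_C_add (show (0 : Fin 2) ≠ 1 by decide) A
  rw [h₀0, map_zero, zero_add] at e
  rw [hA0, map_zero, zero_add] at e'
  obtain ⟨p, hp⟩ : ∃ p, p = B + X 0 * B' := ⟨_, rfl⟩
  have e2 : h₀ = X 1 * p + X 0 ^ 2 * q := by rw [e, e', hp]; ring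
  obtain ⟨r, hr, hpr⟩ := (isConvergent_iff _).mp p.2
  obtain ⟨s, hs, hqs⟩ := (isConvergent_iff _).mp q.2
  set t := min r s with ht
  have ht0 : 0 < t := lt_min hr hs
  have hpt : majorant t p.1 ≠ ⊤ := ne_top_of_le_ne_top hpr (majorant_mono (min_le_left _ _) _)
  have hqt : majorant t q.1 ≠ ⊤ := ne_top_of_le_ne_top hqs (majorant_mono (min_le_right _ _) _)
  obtain ⟨M, hM⟩ : ∃ M : NNReal, majorant t p.1 + majorant t q.1 = M :=
    ⟨_, (ENNReal.coe_toNNReal (ENNReal.add_ne_top.mpr ⟨hpt, hqt⟩)).symm⟩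
  -- The scaling `u ↦ l * u`, `t ↦ l ^ 2 * t`, followed by division by `l`, turns `t * p + u ^ 2 *
  -- q` into `l` times an expression of the same shape. A small `l` therefore makes the majorant at
  -- most `1`.
  obtain ⟨l, hl0, hl1, hlt, hlM⟩ : ∃ l : NNReal, 0 < l ∧ l ≤ 1 ∧ l ≤ t ∧ l * M ≤ 1 := by
    refine ⟨min (min 1 t) (M + 1)⁻¹, by positivity, (min_le_left _ _).trans (min_le_left _ _),
      (min_le_left _ _).trans (min_le_right _ _), ?_⟩
    calc _ ≤ (M + 1)⁻¹ * (M + 1) := by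
            gcongr
            · exact min_le_right _ _
            · exact le_self_add
      _ = 1 := inv_mul_cancel₀ (by positivity)
  have hlc : (((l : ℝ) : ℂ)) ≠ 0 := by exact_mod_cast hl0.ne'
  set L : ℂ := ((l : ℝ) : ℂ) with hL
  have hLn : ‖L‖₊ = l := by
    rw [hL]; ext; simp
  have hz : ∀ i, evalZero (![L • X 0, L ^ 2 • X 1] i) = 0 := fun i => by fin_cases i <;> simp
  have hz0 : evalZero (L • X 0) = 0 := hz 0
  have hz1 : evalZero (L ^ 2 • X 1) = 0 := hz 1
  have hmajD : ∀ f : ConvSeries, majorant 1 (sub2 (L • X 0) (L ^ 2 • X 1) f).1 ≤ majorant t f.1 := by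
    intro f
    rw [sub2, sub_val hz]
    refine majorant_subst_le hz (fun i => ?_) _
    fin_cases i
    · change majorant 1 (L • X 0).1 ≤ _
      rw [majorant_smul, hLn]
      calc (l : ENNReal) * majorant 1 (X 0).1 ≤ l * 1 := by gcongr; exact majorant_X_le 1 0
        _ ≤ t := by rw [mul_one]; exact_mod_cast hlt
    · change majorant 1 (L ^ 2 • X 1).1 ≤ _
      rw [majorant_smul, nnnorm_pow, hLn]
      calc ((l ^ 2 : NNReal) : ENNReal) * majorant 1 (X 1).1 ≤ ((l ^ 2 : NNReal) : ENNReal) * 1 := by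
            gcongr; exact majorant_X_le 1 1
        _ ≤ l := by rw [mul_one]; exact_mod_cast pow_le_of_le_one hl0.le hl1 two_ne_zero
        _ ≤ t := by exact_mod_cast hlt
  have hP := hmajD p
  have hQ := hmajD q
  generalize hPd : sub2 (L • X 0) (L ^ 2 • X 1) p = P at hP
  generalize hQd : sub2 (L • X 0) (L ^ 2 • X 1) q = Q at hQ
  set h' := L⁻¹ • sub2 (L • X 0) (L ^ 2 • X 1) h₀ with hh'
  have eh' : h' = X 1 * (L • P) + X 0 ^ 2 * (L • Q) := by
    rw [hh', e2, map_add, map_mul, map_mul, map_pow, sub2_X0 hz0, sub2_X1 hz1]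
    rw [hPd, hQd]
    simp only [Algebra.smul_def, mul_add, mul_pow, ← mul_assoc, ← map_mul, ← map_pow]
    have e3 : L⁻¹ * L ^ 2 = L := by field_simp
    rw [e3]
    ring
  have hmaj : majorant 1 h'.1 ≤ 1 := by
    rw [eh']
    calc majorant 1 (X 1 * (L • P) + X 0 ^ 2 * (L • Q)).1
        ≤ majorant 1 (X 1).1 * majorant 1 (L • P).1 +
          majorant 1 (X 0).1 ^ 2 * majorant 1 (L • Q).1 := by
          refine (majorant_add _ _ _).trans (add_le_add (majorant_mul _ _ _) ?_)
          exact (majorant_mul _ _ _).trans (mul_le_mul' (majorant_pow _ _ _) le_rfl)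
      _ ≤ 1 * (l * majorant t p.1) + 1 ^ 2 * (l * majorant t q.1) := by
          rw [majorant_smul, majorant_smul, hLn]
          gcongr
          · exact majorant_X_le 1 1
          · exact majorant_X_le 1 0
      _ = l * M := by rw [← hM]; ring
      _ ≤ 1 := by exact_mod_cast hlM
  obtain ⟨φ', h0, hax, hfix⟩ := exists_fixed_point eh' hmaj
  set E := sub2 (L⁻¹ • X 0) ((L ^ 2)⁻¹ • X 1)
  have hE1 : E (X 1) = (L ^ 2)⁻¹ • X 1 := sub2_X1 (by simp)
  have hE0 : E (X 0) = L⁻¹ • X 0 := sub2_X0 (by simp)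
  have hφ0 : evalZero (L • E φ') = 0 := by rw [map_smul, evalZero_algHom, h0, smul_zero]
  refine ⟨L • E φ', hφ0, ?_, ?_⟩
  · have : (axis 1).comp E = E.comp (axis 1) := by
      have h10 : axis 1 (X 0) = 0 := axis_X_of_ne (by decide)
      refine algHom_ext2 ?_ ?_
      · rw [AlgHom.comp_apply, AlgHom.comp_apply, hE0, map_smul, h10, map_zero, smul_zero]
      · rw [AlgHom.comp_apply, AlgHom.comp_apply, hE1, map_smul, axis_X_self, hE1]
    rw [map_smul, ← AlgHom.comp_apply, this, AlgHom.comp_apply, hax]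
  · have e4 : sub2 (L • E φ') (X 1) h₀ = L • E φ' := by
      have e5 : sub2 (L • E φ') (X 1) =
          E.comp ((sub2 φ' (X 1)).comp (sub2 (L • X 0) (L ^ 2 • X 1))) := by
        refine algHom_ext2 ?_ ?_
        · rw [sub2_X0 hφ0, AlgHom.comp_apply, AlgHom.comp_apply, sub2_X0 hz0, map_smul,
            sub2_X0 h0, map_smul]
        · rw [sub2_X1 (evalZero_X 1), AlgHom.comp_apply, AlgHom.comp_apply, sub2_X1 hz1, map_smul,
            sub2_X1 (evalZero_X 1), map_smul, hE1, smul_smul, mul_inv_cancel₀ (pow_ne_zero 2 hlc),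
            one_smul]
      have e6 : sub2 (L • X 0) (L ^ 2 • X 1) h₀ = L • h' := by
        rw [hh', smul_smul, mul_inv_cancel₀ hlc, one_smul]
      rw [e5, AlgHom.comp_apply, AlgHom.comp_apply, e6, map_smul, hfix, map_smul]
    rw [hh₀, map_sub, sub2_X0 hφ0, map_smul, sub_eq_self] at e4
    exact (smul_eq_zero.mp e4).resolve_left (inv_ne_zero hc)

/-! ### The Newton–Puiseux theorem -/

theorem algHom_axis_axis {a b : Fin 2} (hab : a ≠ b) (f : ConvSeries) :
    axis a (axis b f) = algebraMap ℂ ConvSeries (evalZero f) := by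
  refine ext_coeff fun m => ?_
  rw [coeff_axis hab, coeff_axis hab.symm, coeff_C, evalZero_eq_coeff]
  by_cases hm : m = 0
  · simp [hm]
  · rw [if_neg hm]
    split_ifs with h1 h2
    · exfalso
      apply hm
      ext i
      have : i = a ∨ i = b := by omega
      rcases this with rfl | rfl <;> assumption
    · rfl
    · rfl

theorem axis_of_axis_eq {a b : Fin 2} (hab : a ≠ b) {f : ConvSeries} (hf : axis b f = f) :
    axis a f = algebraMap ℂ ConvSeries (evalZero f) := by
  conv_lhs => rw [← hf]
  exact algHom_axis_axis hab f

theorem partialDeriv_eq_zero_of_axis_eq {a b : Fin 2} (hab : a ≠ b) {f : ConvSeries}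
    (hf : axis b f = f) : partialDeriv a f = 0 := by
  refine ext_coeff fun m => ?_
  rw [coeff_partialDeriv, ← hf, coeff_axis hab.symm, if_neg (by simp), zero_mul, map_zero]

theorem axis_zero_eq : axis 0 = sub2 (X 0) 0 :=
  algHom_ext2 (by rw [axis_X_self, sub2_X0 (evalZero_X 0)])
    (by rw [axis_X_of_ne (by decide), sub2_X1 (map_zero _)])

theorem axis_one_eq : axis 1 = sub2 0 (X 1) :=
  algHom_ext2 (by rw [axis_X_of_ne (by decide), sub2_X0 (map_zero _)])
    (by rw [axis_X_self, sub2_X1 (evalZero_X 1)])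

theorem eq_C_of_X_eq_zero (φ : ConvSeries →ₐ[ℂ] ConvSeries) (h0 : φ (X 0) = 0)
    (h1 : φ (X 1) = 0) (f : ConvSeries) : φ f = algebraMap ℂ ConvSeries (evalZero f) := by
  have : φ = (Algebra.ofId ℂ ConvSeries).comp evalZero :=
    algHom_ext2 (by simp [h0]) (by simp [h1])
  rw [this]; rfl

/-- The beginning of the expansion of a power series in powers of `X 0`. -/
theorem exists_expansion (m : ℕ) (f : ConvSeries) : ∃ (a : ℕ → ConvSeries) (W : ConvSeries),
    (∀ i, axis 1 (a i) = a i) ∧ f = ∑ i ∈ Finset.range m, a i * X 0 ^ i + X 0 ^ m * W ∧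
    ∀ i < m, ∀ j, coeff (Finsupp.single 1 j) (a i) =
      coeff (Finsupp.single 1 j + Finsupp.single 0 i) f := by
  induction m generalizing f with
  | zero => exact ⟨fun _ => 0, f, fun _ => map_zero _, by simp, fun i hi => absurd hi (by simp)⟩
  | succ m ih =>
    obtain ⟨g, h, e, hg, hh⟩ := exists_eq_add_X_mul 0 f
    obtain ⟨a, W, ha, e', hc⟩ := ih h
    refine ⟨fun i => Nat.casesOn i g a, W, fun i => ?_, ?_, fun i hi j => ?_⟩
    · cases i with
      | zero =>
        exact axis_eq_self (b := 0) (by decide) fun d hd => by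
          change coeff d g = 0
          rw [hg, if_neg hd]
      | succ i => exact ha i
    · rw [Finset.sum_range_succ', e, e', mul_add, Finset.mul_sum]
      change _ = ∑ i ∈ Finset.range m, a i * X 0 ^ (i + 1) + g * X 0 ^ 0 + _
      have : ∀ i, a i * X 0 ^ (i + 1) = X 0 * (a i * X 0 ^ i) := fun i => by ring
      simp only [this]
      ring
    · cases i with
      | zero => simp [hg]
      | succ i =>
        change coeff _ (a i) = _
        rw [hc i (by omega), hh, add_assoc, ← Finsupp.single_add]

/-! ### The Tschirnhaus transformation and the Newton polygon. -/

theorem exists_coeff_iterate_partialDeriv (k : ℕ) (d : Fin 2 →₀ ℕ) : ∃ c : ℂ, c ≠ 0 ∧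
    ∀ f, coeff d ((partialDeriv 0)^[k] f) = c * coeff (d + Finsupp.single 0 k) f := by
  induction k generalizing d with
  | zero => exact ⟨1, one_ne_zero, fun f => by simp⟩
  | succ k ih =>
    obtain ⟨c, hc, h⟩ := ih (d + Finsupp.single 0 1)
    refine ⟨c * (d 0 + 1), mul_ne_zero hc (by exact_mod_cast (d 0).succ_ne_zero), fun f => ?_⟩
    rw [Function.iterate_succ_apply', coeff_partialDeriv, h, add_assoc, ← Finsupp.single_add,
      add_comm 1 k]
    ring

/-- The Tschirnhaus transformation. -/
theorem exists_tschirnhaus {m : ℕ} {f : ConvSeries} (hf : HasAxisOrder 0 f (m + 1)) :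
    ∃ φ, evalZero φ = 0 ∧ axis 1 φ = φ ∧ HasAxisOrder 0 (sub2 (X 0 + φ) (X 1) f) (m + 1) ∧
      ∀ j, coeff (Finsupp.single 1 j + Finsupp.single 0 m) (sub2 (X 0 + φ) (X 1) f) = 0 := by
  -- The derivative of order `m` has a simple zero on the axis. Moving its root, given by the
  -- implicit function theorem, to `X 0 = 0` kills the coefficient of `X 0 ^ m`.
  have hD : HasAxisOrder 0 ((partialDeriv 0)^[m] f) 1 := by
    rw [hasAxisOrder_iff] at hf ⊢
    constructor
    · intro i hi
      obtain ⟨c, hc, h⟩ := exists_coeff_iterate_partialDeriv m (Finsupp.single 0 i)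
      rw [h, ← Finsupp.single_add, hf.1 _ (by omega), mul_zero]
    · obtain ⟨c, hc, h⟩ := exists_coeff_iterate_partialDeriv m (Finsupp.single 0 1)
      rw [h, ← Finsupp.single_add, add_comm 1 m]
      exact mul_ne_zero hc hf.2
  obtain ⟨φ, h0, hax, hφ⟩ := exists_implicit hD
  have hz : evalZero (X 0 + φ) = 0 := by rw [map_add, h0, evalZero_X, add_zero]
  refine ⟨φ, h0, hax, ?_, fun j => ?_⟩
  · obtain ⟨w, hw, e⟩ := hf
    refine ⟨w, hw, ?_⟩
    rw [algHom_sub2 _ hz (evalZero_X 1), map_add, axis_of_axis_eq (by decide) hax, h0, map_zero,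
      axis_X_self, axis_X_of_ne (by decide), add_zero, ← axis_zero_eq, e]
  · have hder : ∀ k f, (partialDeriv 0)^[k] (sub2 (X 0 + φ) (X 1) f) =
        sub2 (X 0 + φ) (X 1) ((partialDeriv 0)^[k] f) := by
      intro k
      induction k with
      | zero => exact fun f => rfl
      | succ k ih =>
        intro f
        rw [Function.iterate_succ_apply, Function.iterate_succ_apply, ← ih, partialDeriv_algHom,
          sub2_X0 hz, sub2_X1 (evalZero_X 1), partialDeriv_add, partialDeriv_X, partialDeriv_X,
          if_pos rfl, if_neg (by decide), partialDeriv_eq_zero_of_axis_eq (by decide) hax]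
        simp
    have h1 : axis 1 ((partialDeriv 0)^[m] (sub2 (X 0 + φ) (X 1) f)) = 0 := by
      rw [hder, algHom_sub2 _ hz (evalZero_X 1), map_add, hax, axis_X_self,
        axis_X_of_ne (by decide), zero_add, hφ]
    obtain ⟨c, hc, h⟩ := exists_coeff_iterate_partialDeriv m (Finsupp.single 1 j)
    have h2 := coeff_single_axis 1 j ((partialDeriv 0)^[m] (sub2 (X 0 + φ) (X 1) f))
    rw [h1, map_zero, h, eq_comm] at h2
    exact (mul_eq_zero.mp h2).resolve_left hc

/-- A root of full multiplicity would give `p = c * (X - w) ^ m`; the missing coefficient of degree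
`m - 1` forces `w = 0` in characteristic zero, and then no lower coefficient survives. This is what
makes the Newton algorithm terminate. -/
theorem exists_root_rootMultiplicity_lt {p : Polynomial ℂ} {m i : ℕ} (hm : p.natDegree = m)
    (h0 : 0 < m) (h1 : p.coeff (m - 1) = 0) (hi : i < m) (hpi : p.coeff i ≠ 0) :
    ∃ (w : ℂ) (k : ℕ) (q : Polynomial ℂ), 0 < k ∧ k < m ∧
      p = (Polynomial.X - Polynomial.C w) ^ k * q ∧ q.eval w ≠ 0 := by
  have hp : p ≠ 0 := fun h => hpi (by simp [h])
  obtain ⟨w, hw⟩ := IsAlgClosed.exists_root p (by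
    rw [Polynomial.degree_eq_natDegree hp, hm]; exact_mod_cast h0.ne')
  obtain ⟨q, hq, hnd⟩ := Polynomial.exists_eq_pow_rootMultiplicity_mul_and_not_dvd p hp w
  have hk : 0 < p.rootMultiplicity w := (Polynomial.rootMultiplicity_pos hp).mpr hw
  refine ⟨w, p.rootMultiplicity w, q, hk, ?_, hq, fun h => hnd (Polynomial.dvd_iff_isRoot.mpr h)⟩
  generalize p.rootMultiplicity w = k at *
  have hq0 : q ≠ 0 := by rintro rfl; simp at hnd
  have hdeg : m = k + q.natDegree := by
    rw [← hm, hq, Polynomial.natDegree_mul (pow_ne_zero _ (Polynomial.X_sub_C_ne_zero w)) hq0]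
    simp
  by_contra hkm
  have hkm' : k = m := by omega
  have hqd : q.natDegree = 0 := by omega
  obtain ⟨c, rfl⟩ := Polynomial.natDegree_eq_zero.mp hqd
  subst hkm'
  have hc : c ≠ 0 := by rintro rfl; simp at hq0
  rw [hq, Polynomial.coeff_mul_C, sub_eq_add_neg, ← Polynomial.C_neg,
    Polynomial.coeff_X_add_C_pow] at h1 hpi
  have hw0 : w = 0 := by
    rw [show k - (k - 1) = 1 by omega, pow_one] at h1
    have : (k.choose (k - 1) : ℂ) ≠ 0 := by
      exact_mod_cast (Nat.choose_pos (Nat.sub_le k 1)).ne'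
    simpa [hc, this] using h1
  apply hpi
  rw [hw0, neg_zero, zero_pow (by omega)]
  simp

theorem axis_sub2 {p q f : ConvSeries} (hp : evalZero p = 0) (hq : evalZero q = 0)
    (hp' : axis 1 p = p) (hq' : axis 1 q = q) : axis 1 (sub2 p q f) = sub2 p q f := by
  rw [algHom_sub2 _ hp hq, hp', hq']

theorem sub2_axis_one {p q : ConvSeries} (hq : evalZero q = 0) (f : ConvSeries) :
    sub2 p q (axis 1 f) = sub2 0 q f := by
  rw [sub2_algHom, axis_X_of_ne (by decide), axis_X_self, map_zero, sub2_X1 hq]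

/-- One step of the Newton polygon algorithm. -/
theorem exists_newton_step {m : ℕ} {g : ConvSeries} (hg : HasAxisOrder 0 g (m + 1))
    (hcoef : ∀ j, coeff (Finsupp.single 1 j + Finsupp.single 0 m) g = 0)
    (hX : ¬ X 0 ^ (m + 1) ∣ g) :
    ∃ (A B : ℕ) (w : ℂ) (g₁ : ConvSeries) (k : ℕ), 0 < A ∧ 0 < B ∧ 0 < k ∧ k < m + 1 ∧
      HasAxisOrder 0 g₁ k ∧
      sub2 (X 1 ^ A * (algebraMap ℂ ConvSeries w + X 0)) (X 1 ^ B) g =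
        X 1 ^ (A * (m + 1)) * g₁ := by
  classical
  obtain ⟨a, W, ha, e, hc⟩ := exists_expansion (m + 1) g
  have ha0 : ∀ i < m + 1, evalZero (a i) = 0 := fun i hi => by
    have := hc i hi 0
    rw [Finsupp.single_zero, zero_add, (hasAxisOrder_iff.mp hg).1 i hi] at this
    rw [evalZero_eq_coeff, this]
  have ham : a m = 0 := by
    by_contra hne
    obtain ⟨ν, hν⟩ := exists_hasAxisOrder (a := 1) (f := a m) (by rwa [ha])
    exact (hasAxisOrder_iff.mp hν).2 (by rw [hc m (by omega), hcoef])
  have hW : evalZero W ≠ 0 := by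
    obtain ⟨w, hw, e'⟩ := hg
    rw [e, map_add, map_mul, map_pow, axis_X_self, map_sum, Finset.sum_eq_zero, zero_add] at e'
    · have := mul_left_cancel₀ (pow_ne_zero _ (X_ne_zero 0)) e'
      rwa [← evalZero_algHom (axis 0), this, ← isUnit_iff]
    · intro i hi
      rw [map_mul, axis_of_axis_eq (by decide) (ha i), ha0 i (by simpa using hi), map_zero,
        zero_mul]
  have hord : ∀ i, ∃ ν, a i ≠ 0 → HasAxisOrder 1 (a i) ν := fun i => by
    by_cases h : a i = 0
    · exact ⟨0, fun h' => absurd h h'⟩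
    · obtain ⟨ν, hν⟩ := exists_hasAxisOrder (a := 1) (f := a i) (by rwa [ha])
      exact ⟨ν, fun _ => hν⟩
  choose ν hν using hord
  let S := (Finset.range (m + 1)).filter fun i => a i ≠ 0
  have hS : S.Nonempty := by
    by_contra hS
    rw [Finset.not_nonempty_iff_eq_empty] at hS
    apply hX
    rw [e, Finset.sum_eq_zero]
    · simp
    · intro i hi
      have : i ∉ S := by rw [hS]; simp
      have : a i = 0 := by simpa [S, Finset.mem_range.mp hi] using this
      rw [this, zero_mul]
  -- Minimality of the slope selects an edge of the Newton polygon, ending at the vertex `X 0 ^ (m +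
  -- 1)`. With weights `A` for `X 0` and `B` for `X 1`, no monomial lies below it (`hle`).
  obtain ⟨i₀, hi₀, hmin⟩ := S.exists_min_image (fun i => (ν i : ℚ) / ((m + 1 - i : ℕ) : ℚ)) hS
  simp only [S, Finset.mem_filter, Finset.mem_range] at hi₀ hmin
  set A := ν i₀ with hA
  set B := m + 1 - i₀ with hB
  have hA0 : 0 < A := (hν i₀ hi₀.2).pos_iff.mpr (ha0 i₀ hi₀.1)
  have hB0 : 0 < B := by omega
  have hle : ∀ i < m + 1, a i ≠ 0 → A * (m + 1 - i) ≤ B * ν i := by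
    intro i hi hai
    have := hmin i ⟨hi, hai⟩
    rw [div_le_div_iff₀ (by exact_mod_cast hB0) (by exact_mod_cast (by omega))] at this
    rw [mul_comm B]
    exact_mod_cast this
  have hzB : evalZero (X 1 ^ B) = 0 := by rw [map_pow, evalZero_X, zero_pow hB0.ne']
  -- `b i` is what remains of `a i` after `X 1 ↦ X 1 ^ B` and division of the whole equation by `X 1
  -- ^ (A * (m + 1))`. The exponent left over is nonnegative by `hle` and zero for `i = i₀`.
  have hb : ∀ i, ∃ b : ConvSeries, i < m + 1 → axis 1 b = b ∧
      sub2 0 (X 1 ^ B) (a i) * X 1 ^ (A * i) = X 1 ^ (A * (m + 1)) * b ∧ (i = m → b = 0) ∧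
      (i = i₀ → evalZero b ≠ 0) := by
    intro i
    by_cases hi : i < m + 1
    swap
    · exact ⟨0, fun h => absurd h hi⟩
    by_cases hai : a i = 0
    · refine ⟨0, fun _ => ⟨map_zero _, by rw [hai]; simp, fun _ => rfl, ?_⟩⟩
      rintro rfl
      exact absurd hai hi₀.2
    · obtain ⟨w, hw, e'⟩ := hν i hai
      rw [ha i] at e'
      have hw1 : axis 1 w = w := by
        have := ha i
        rw [e', map_mul, map_pow, axis_X_self] at this
        exact mul_left_cancel₀ (pow_ne_zero _ (X_ne_zero 1)) this
      refine ⟨X 1 ^ (B * ν i - A * (m + 1 - i)) * sub2 0 (X 1 ^ B) w, fun _ => ⟨?_, ?_, ?_, ?_⟩⟩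
      · rw [map_mul, map_pow, axis_X_self, axis_sub2 (map_zero _) hzB (map_zero _)]
        rw [map_pow, axis_X_self]
      · have h1 : sub2 0 (X 1 ^ B) (a i) = X 1 ^ (B * ν i) * sub2 0 (X 1 ^ B) w := by
          conv_lhs => rw [e']
          rw [map_mul, map_pow, sub2_X1 hzB, ← pow_mul]
        have h2 : B * ν i + A * i = A * (m + 1) + (B * ν i - A * (m + 1 - i)) := by
          have := hle i hi hai
          have h3 : A * (m + 1) = A * (m + 1 - i) + A * i := by
            rw [← mul_add]; congr 1; omega
          omega
        rw [h1]
        calc _ = X 1 ^ (B * ν i + A * i) * sub2 0 (X 1 ^ B) w := by rw [pow_add]; ring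
          _ = _ := by rw [h2, pow_add]; ring
      · rintro rfl
        exact absurd ham hai
      · rintro rfl
        rw [← hA, ← hB, mul_comm B, Nat.sub_self, pow_zero, one_mul, evalZero_algHom]
        exact isUnit_iff.mp hw
  choose b hb using hb
  -- The polynomial of the edge: the transformed equation restricted to `X 1 = 0` is `p` evaluated
  -- at `w + X 0`, so its order there is the multiplicity of `w` as a root of `p`.
  let p : Polynomial ℂ := ∑ i ∈ Finset.range (m + 1), Polynomial.monomial i (evalZero (b i)) +
    Polynomial.monomial (m + 1) (evalZero W)
  have hpc : ∀ i < m + 1, p.coeff i = evalZero (b i) := by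
    intro i hi
    simp only [p, Polynomial.coeff_add, Polynomial.finsetSum_coeff, Polynomial.coeff_monomial]
    rw [if_neg (by omega), add_zero, Finset.sum_ite_eq', if_pos (by simpa using hi)]
  have hdeg : p.natDegree = m + 1 := by
    refine Polynomial.natDegree_eq_of_le_of_coeff_ne_zero ?_ ?_
    · refine Polynomial.natDegree_add_le_of_degree_le ?_ (Polynomial.natDegree_monomial_le _)
      refine Polynomial.natDegree_sum_le_of_forall_le _ _ fun i hi => ?_
      exact (Polynomial.natDegree_monomial_le _).trans (Finset.mem_range.mp hi).le
    · simp only [p, Polynomial.coeff_add, Polynomial.finsetSum_coeff, Polynomial.coeff_monomial]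
      rw [Finset.sum_eq_zero, zero_add, if_pos trivial]
      · exact hW
      · intro i hi
        rw [if_neg (by have := Finset.mem_range.mp hi; omega)]
  obtain ⟨w, k, q, hk0, hkm, hpq, hqw⟩ := exists_root_rootMultiplicity_lt hdeg (by omega)
    (by rw [Nat.add_sub_cancel, hpc m (by omega), (hb m (by omega)).2.2.1 rfl, map_zero])
    hi₀.1 (by rw [hpc i₀ hi₀.1]; exact (hb i₀ hi₀.1).2.2.2 rfl)
  set u : ConvSeries := algebraMap ℂ ConvSeries w + X 0
  have hzA : evalZero (X 1 ^ A * u) = 0 := by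
    rw [map_mul, map_pow, evalZero_X, zero_pow hA0.ne', zero_mul]
  set s := sub2 (X 1 ^ A * u) (X 1 ^ B)
  have hs0 : s (X 0) = X 1 ^ A * u := sub2_X0 hzA
  have hs1 : s (X 1) = X 1 ^ B := sub2_X1 hzB
  have h01 : axis 0 (X 1) = 0 := axis_X_of_ne (by decide)
  refine ⟨A, B, w, ∑ i ∈ Finset.range (m + 1), b i * u ^ i + u ^ (m + 1) * s W, k, hA0, hB0, hk0,
    hkm, ⟨Polynomial.aeval u q, ?_, ?_⟩, ?_⟩
  · rw [isUnit_iff, ← Polynomial.aeval_algHom_apply]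
    have : evalZero u = w := by simp [u]
    rw [this]
    simpa using hqw
  · have h1 : Polynomial.aeval u p = X 0 ^ k * Polynomial.aeval u q := by
      conv_lhs => rw [hpq]
      rw [map_mul, map_pow, map_sub, Polynomial.aeval_X, Polynomial.aeval_C]
      congr 2
      simp [u]
    have hu : axis 0 u = u := by simp [u]
    have hsW : axis 0 (s W) = algebraMap ℂ ConvSeries (evalZero W) := by
      refine eq_C_of_X_eq_zero ((axis 0).comp s) ?_ ?_ W
      · rw [AlgHom.comp_apply, hs0, map_mul, map_pow, h01, zero_pow hA0.ne', zero_mul]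
      · rw [AlgHom.comp_apply, hs1, map_pow, h01, zero_pow hB0.ne']
    rw [← h1, map_add, map_mul, map_pow, hu, hsW, map_sum]
    simp only [p, map_add, map_sum, Polynomial.aeval_monomial]
    rw [mul_comm (u ^ (m + 1))]
    congr 1
    refine Finset.sum_congr rfl fun i hi => ?_
    rw [map_mul, map_pow, hu, axis_of_axis_eq (by decide) (hb i (Finset.mem_range.mp hi)).1]
  · conv_lhs => rw [e]
    rw [map_add, map_mul, map_pow, hs0, map_sum, mul_add (X 1 ^ (A * (m + 1))), Finset.mul_sum]
    congr 1
    · refine Finset.sum_congr rfl fun i hi => ?_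
      have hsa : s (a i) = sub2 0 (X 1 ^ B) (a i) := by
        conv_lhs => rw [← ha i]
        exact sub2_axis_one hzB _
      rw [map_mul, map_pow, hs0, hsa, mul_pow, ← pow_mul, ← mul_assoc,
        (hb i (Finset.mem_range.mp hi)).2.1]
      ring
    · rw [mul_pow, ← pow_mul]; ring

/-- The Newton–Puiseux theorem: a power series `f` that is regular in `X 0` vanishes on a curve
`t ↦ (φ(t), t ^ N)`. -/
theorem exists_puiseux {m : ℕ} {f : ConvSeries} (hf : HasAxisOrder 0 f m) (hm : 0 < m) :
    ∃ N, 0 < N ∧ ∃ φ, evalZero φ = 0 ∧ axis 1 φ = φ ∧ sub2 φ (X 1 ^ N) f = 0 := by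
  induction m using Nat.strong_induction_on generalizing f with
  | _ m ih =>
  obtain ⟨m, rfl⟩ : ∃ k, m = k + 1 := ⟨m - 1, by omega⟩
  obtain ⟨φ, h0, hax, hg, hcoef⟩ := exists_tschirnhaus hf
  have hz : evalZero (X 0 + φ) = 0 := by rw [map_add, h0, evalZero_X, add_zero]
  suffices h : ∃ N, 0 < N ∧ ∃ ψ, evalZero ψ = 0 ∧ axis 1 ψ = ψ ∧
      sub2 ψ (X 1 ^ N) (sub2 (X 0 + φ) (X 1) f) = 0 by
    obtain ⟨N, hN, ψ, hψ0, hψ1, hψ⟩ := h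
    have hzN : evalZero (X 1 ^ N) = 0 := by rw [map_pow, evalZero_X, zero_pow hN.ne']
    have hzN' : axis 1 (X 1 ^ N) = X 1 ^ N := by rw [map_pow, axis_X_self]
    refine ⟨N, hN, ψ + sub2 ψ (X 1 ^ N) φ, ?_, ?_, ?_⟩
    · rw [map_add, hψ0, evalZero_algHom, h0, add_zero]
    · rw [map_add, hψ1, axis_sub2 hψ0 hzN hψ1 hzN']
    · rwa [algHom_sub2 _ hz (evalZero_X 1), map_add, sub2_X0 hψ0, sub2_X1 hzN] at hψ
  generalize sub2 (X 0 + φ) (X 1) f = g at *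
  -- In the divisible case the arc `X 0 = 0` is a solution; otherwise a Newton step strictly lowers
  -- the order.
  by_cases hX : X 0 ^ (m + 1) ∣ g
  · obtain ⟨W, rfl⟩ := hX
    refine ⟨1, one_pos, 0, map_zero _, map_zero _, ?_⟩
    rw [map_mul, map_pow, sub2_X0 (map_zero _), zero_pow (by omega), zero_mul]
  · obtain ⟨A, B, w, g₁, k, hA, hB, hk0, hkm, hg₁, e⟩ := exists_newton_step hg hcoef hX
    obtain ⟨N, hN, ψ, hψ0, hψ1, hψ⟩ := ih k hkm hg₁ hk0
    have hzN : evalZero (X 1 ^ N) = 0 := by rw [map_pow, evalZero_X, zero_pow hN.ne']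
    have hzA : evalZero (X 1 ^ A * (algebraMap ℂ ConvSeries w + X 0)) = 0 := by
      rw [map_mul, map_pow, evalZero_X, zero_pow hA.ne', zero_mul]
    have hzB : evalZero (X 1 ^ B) = 0 := by rw [map_pow, evalZero_X, zero_pow hB.ne']
    refine ⟨N * B, Nat.mul_pos hN hB,
      sub2 ψ (X 1 ^ N) (X 1 ^ A * (algebraMap ℂ ConvSeries w + X 0)), ?_, ?_, ?_⟩
    · rw [evalZero_algHom, hzA]
    · exact axis_sub2 hψ0 hzN hψ1 (by rw [map_pow, axis_X_self])
    · have := congrArg (sub2 ψ (X 1 ^ N)) e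
      rwa [map_mul, hψ, mul_zero, algHom_sub2 _ hzA hzB, map_pow _ (X 1) B, sub2_X1 hzN,
        ← pow_mul] at this

/-! ### The substitution `X b ↦ X b ^ n` -/

/-- The substitution `X b ↦ X b ^ n`, which fixes the other coordinate. -/
def powMap (b : Fin 2) (n : ℕ) : ConvSeries →ₐ[ℂ] ConvSeries :=
  sub fun i => if i = b then X b ^ n else X i

theorem powMap_X_self (b : Fin 2) {n : ℕ} (hn : 0 < n) : powMap b n (X b) = X b ^ n := by
  rw [powMap, sub_X] <;> simp [hn.ne']

theorem powMap_X_of_ne {a b : Fin 2} (hab : a ≠ b) (n : ℕ) : powMap b n (X a) = X a := by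
  rw [powMap, sub_X] <;> simp [hab]

/-- The exponents of the monomials in the range of `powMap b n`. -/
def powExp (b : Fin 2) (n : ℕ) (d : Fin 2 →₀ ℕ) : Fin 2 →₀ ℕ :=
  d + Finsupp.single b ((n - 1) * d b)

theorem powExp_self (b : Fin 2) {n : ℕ} (hn : 0 < n) (d : Fin 2 →₀ ℕ) :
    powExp b n d b = n * d b := by
  obtain ⟨n, rfl⟩ : ∃ k, n = k + 1 := ⟨n - 1, by omega⟩
  simp [powExp]; ring

theorem powExp_of_ne {a b : Fin 2} (hab : a ≠ b) (n : ℕ) (d : Fin 2 →₀ ℕ) :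
    powExp b n d a = d a := by
  simp [powExp, hab]

theorem exists_powExp_add (b : Fin 2) {n : ℕ} (hn : 0 < n) (m : Fin 2 →₀ ℕ) :
    ∃ d, ∃ r : Fin n, m = powExp b n d + Finsupp.single b (r : ℕ) := by
  refine ⟨m.update b (m b / n), ⟨m b % n, Nat.mod_lt _ hn⟩, ?_⟩
  ext i
  by_cases h : i = b
  · subst h
    rw [Finsupp.add_apply, powExp_self i hn]
    simp [Nat.div_add_mod]
  · rw [Finsupp.add_apply, powExp_of_ne h]
    simp [h]

theorem powExp_injective (b : Fin 2) {n : ℕ} (hn : 0 < n) : Function.Injective (powExp b n) := by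
  intro d e h
  ext i
  have := DFunLike.congr_fun h i
  by_cases hi : i = b
  · subst hi
    rw [powExp_self i hn, powExp_self i hn] at this
    exact Nat.eq_of_mul_eq_mul_left hn this
  · rwa [powExp_of_ne hi, powExp_of_ne hi] at this

theorem coeff_powMap (b : Fin 2) {n : ℕ} (hn : 0 < n) (m : Fin 2 →₀ ℕ) (f : ConvSeries) :
    coeff m (powMap b n f) = ∑ᶠ d, if m = powExp b n d then coeff d f else 0 := by
  have hz : ∀ i : Fin 2, evalZero (if i = b then X b ^ n else X i) = 0 := fun i => by
    split_ifs <;> simp [hn.ne']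
  rw [coeff_eq, powMap, sub_val hz, MvPowerSeries.coeff_subst
    (MvPowerSeries.hasSubst_of_constantCoeff_zero hz)]
  refine finsum_congr fun d => ?_
  have : (d.prod fun i e => (if i = b then X b ^ n else X i).1 ^ e) =
      MvPowerSeries.monomial (powExp b n d) (1 : ℂ) := by
    rw [MvPowerSeries.monomial_eq', Finsupp.prod_fintype _ _ (by simp),
      Finsupp.prod_fintype _ _ (by simp), map_one, one_mul]
    refine Finset.prod_congr rfl fun i _ => ?_
    by_cases h : i = b
    · subst h
      rw [if_pos rfl, powExp_self i hn, pow_mul]; rfl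
    · rw [if_neg h, powExp_of_ne h]; rfl
  rw [this, MvPowerSeries.coeff_monomial]
  simp [coeff_eq]

theorem coeff_powExp_powMap (b : Fin 2) {n : ℕ} (hn : 0 < n) (d : Fin 2 →₀ ℕ) (f : ConvSeries) :
    coeff (powExp b n d) (powMap b n f) = coeff d f := by
  rw [coeff_powMap b hn, finsum_eq_single _ d, if_pos rfl]
  intro e he
  rw [if_neg fun h => he (powExp_injective b hn h).symm]

theorem coeff_powMap_of_not_dvd (b : Fin 2) {n : ℕ} (hn : 0 < n) {m : Fin 2 →₀ ℕ} (h : ¬ n ∣ m b)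
    (f : ConvSeries) : coeff m (powMap b n f) = 0 := by
  rw [coeff_powMap b hn]
  refine finsum_eq_zero_of_forall_eq_zero fun d => if_neg ?_
  rintro rfl
  exact h ⟨d b, powExp_self b hn d⟩

theorem coeff_X_pow_mul_powMap (b : Fin 2) {n : ℕ} (hn : 0 < n) (i r : Fin n) (d : Fin 2 →₀ ℕ)
    (g : ConvSeries) : coeff (powExp b n d + Finsupp.single b (r : ℕ)) (X b ^ (i : ℕ) *
      powMap b n g) = if i = r then coeff d g else 0 := by
  rw [coeff_X_pow_mul]
  by_cases h : i = r
  · subst h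
    rw [if_pos (by simp), if_pos rfl, add_tsub_cancel_right, coeff_powExp_powMap b hn]
  · rw [if_neg h]
    split_ifs with hi
    · apply coeff_powMap_of_not_dvd b hn
      simp only [Finsupp.coe_add, Pi.add_apply, Finsupp.single_eq_same, Finsupp.coe_tsub,
        Pi.sub_apply, powExp_self b hn] at hi ⊢
      rintro ⟨c, hc⟩
      have h1 : n * d b + r = n * c + i := by omega
      have h2 := congrArg (· % n) h1
      simp only [Nat.mul_add_mod, Nat.mod_eq_of_lt i.2, Nat.mod_eq_of_lt r.2] at h2
      exact h (Fin.ext h2.symm)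
    · rfl

/-- The decomposition of a power series along the basis `1, X b, …, X b ^ (n - 1)` of
`ConvSeries` over the range of `powMap b n`. -/
theorem exists_powMap_components (b : Fin 2) {n : ℕ} (hn : 0 < n) :
    ∃ T : Fin n → ConvSeries →ₗ[ℂ] ConvSeries,
      (∀ f, f = ∑ i : Fin n, X b ^ (i : ℕ) * powMap b n (T i f)) ∧
      ∀ (g : Fin n → ConvSeries) (j : Fin n), T j (∑ i : Fin n, X b ^ (i : ℕ) * powMap b n (g i)) = g j := by
  have hex : ∀ (i : Fin n) (f : ConvSeries), ∃ g : ConvSeries,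
      ∀ m, coeff m g = coeff (powExp b n m + Finsupp.single b (i : ℕ)) f := by
    intro i f
    obtain ⟨g, hg⟩ := exists_remap f (fun _ => True)
      (fun m => powExp b n m + Finsupp.single b (i : ℕ)) n i (fun m => by
        simp only [powExp, map_add, Finsupp.degree_single]
        have h1 := Finsupp.le_degree b m
        have h2 : (n - 1) * m b ≤ (n - 1) * m.degree := by gcongr
        have h3 : n * m.degree = (n - 1) * m.degree + m.degree := by
          conv_lhs => rw [show n = n - 1 + 1 by omega, add_mul, one_mul]
        omega)
    exact ⟨g, fun m => by rw [hg, if_pos trivial]⟩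
  choose T hT using hex
  refine ⟨fun i => ⟨⟨T i, fun f g => ext_coeff fun m => ?_⟩, fun c f => ext_coeff fun m => ?_⟩,
    fun f => ext_coeff fun m => ?_, fun g j => ext_coeff fun m => ?_⟩
  · rw [map_add, hT, hT, hT, map_add]
  · simp [hT]
  · obtain ⟨d, r, rfl⟩ := exists_powExp_add b hn m
    rw [map_sum]
    simp only [coeff_X_pow_mul_powMap b hn]
    rw [Finset.sum_ite_eq', if_pos (Finset.mem_univ r)]
    exact (hT r f d).symm
  · change coeff m (T j _) = _
    rw [hT, map_sum]
    simp only [coeff_X_pow_mul_powMap b hn]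
    rw [Finset.sum_ite_eq', if_pos (Finset.mem_univ j)]

theorem powMap_injective (b : Fin 2) {n : ℕ} (hn : 0 < n) : Function.Injective (powMap b n) :=
  fun f g h => ext_coeff fun d => by
    rw [← coeff_powExp_powMap b hn, h, coeff_powExp_powMap b hn]

/-- A series lies in the extended ideal exactly when its `n` components lie in `I`, so the quotient
is `n` copies of `ConvSeries ⧸ I`. -/
theorem dimQuot_map_powMap (b : Fin 2) {n : ℕ} (hn : 0 < n) (I : Ideal ConvSeries) :
    dimQuot (I.map (powMap b n)) = n * dimQuot I := by
  obtain ⟨T, hT, hT'⟩ := exists_powMap_components b hn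
  -- The components are linear over the image of `powMap b n`.
  have hTm : ∀ i a x, T i (a * powMap b n x) = T i a * x := by
    intro i a x
    have : a * powMap b n x = ∑ i : Fin n, X b ^ (i : ℕ) * powMap b n (T i a * x) := by
      conv_lhs => rw [hT a, Finset.sum_mul]
      exact Finset.sum_congr rfl fun i _ => by rw [map_mul]; ring
    rw [this, hT']
  have hmem : ∀ f, f ∈ I.map (powMap b n) ↔ ∀ i, T i f ∈ I := by
    intro f
    constructor
    · intro hf
      suffices h : ∀ a i, T i (a * f) ∈ I by simpa using h 1
      refine Submodule.span_induction (p := fun f _ => ∀ a i, T i (a * f) ∈ I)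
        ?_ ?_ ?_ ?_ hf
      · rintro _ ⟨x, hx, rfl⟩ a i
        have := hTm i a x
        exact this ▸ I.mul_mem_left _ hx
      · intro a i; simp
      · intro x y _ _ hx hy a i
        rw [mul_add, map_add]; exact add_mem (hx a i) (hy a i)
      · intro c x _ hx a i
        rw [smul_eq_mul, ← mul_assoc]; exact hx _ i
    · intro h
      rw [hT f]
      exact sum_mem fun i _ => Ideal.mul_mem_left _ _ (Ideal.mem_map_of_mem _ (h i))
  let Θ : ConvSeries →ₗ[ℂ] (Fin n → ConvSeries ⧸ I) :=
    LinearMap.pi fun i => (Ideal.Quotient.mkₐ ℂ I).toLinearMap.comp (T i)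
  have hsurj : Function.Surjective Θ := by
    intro y
    choose g hg using fun i => Ideal.Quotient.mk_surjective (y i)
    refine ⟨∑ i : Fin n, X b ^ (i : ℕ) * powMap b n (g i), funext fun i => ?_⟩
    change Ideal.Quotient.mk I (T i _) = _
    rw [hT', hg]
  have hker : LinearMap.ker Θ = (I.map (powMap b n)).restrictScalars ℂ := by
    ext f
    rw [LinearMap.mem_ker, Submodule.restrictScalars_mem, hmem, funext_iff]
    exact forall_congr' fun i => Ideal.Quotient.eq_zero_iff_mem
  have e : (ConvSeries ⧸ I.map (powMap b n)) ≃ₗ[ℂ] (Fin n → ConvSeries ⧸ I) :=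
    (Submodule.Quotient.restrictScalarsEquiv ℂ (I.map (powMap b n))).symm.trans
      ((Submodule.quotEquivOfEq _ _ hker.symm).trans (Θ.quotKerEquivOfSurjective hsurj))
  have : Module.Free ℂ (ConvSeries ⧸ I) := Module.Free.of_divisionRing ℂ _
  rw [dimQuot, dimQuot, e.rank_eq, rank_fun, Fintype.card_fin, map_mul, map_natCast]

/-! ### Rotations -/

/-- The automorphism `X b ↦ ζ X b`. -/
def rot (b : Fin 2) (ζ : ℂ) : ConvSeries →ₐ[ℂ] ConvSeries :=
  sub fun i => if i = b then ζ • X b else X i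

theorem rot_X_self (b : Fin 2) (ζ : ℂ) : rot b ζ (X b) = ζ • X b := by
  rw [rot, sub_X] <;> simp

theorem rot_X_of_ne {a b : Fin 2} (hab : a ≠ b) (ζ : ℂ) : rot b ζ (X a) = X a := by
  rw [rot, sub_X] <;> simp [hab]

theorem rot_rot (b : Fin 2) (ζ ξ : ℂ) (f : ConvSeries) :
    rot b ζ (rot b ξ f) = rot b (ζ * ξ) f := by
  have : (rot b ζ).comp (rot b ξ) = rot b (ζ * ξ) := algHom_ext fun i => by
    rw [AlgHom.comp_apply]
    by_cases h : i = b
    · subst h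
      rw [rot_X_self, map_smul, rot_X_self, rot_X_self, smul_smul, mul_comm]
    · rw [rot_X_of_ne h, rot_X_of_ne h, rot_X_of_ne h]
  exact DFunLike.congr_fun this f

@[simp] theorem rot_one (b : Fin 2) (f : ConvSeries) : rot b 1 f = f := by
  have : rot b 1 = AlgHom.id ℂ _ := algHom_ext fun i => by
    by_cases h : i = b
    · subst h
      rw [rot_X_self, one_smul]; rfl
    · rw [rot_X_of_ne h]; rfl
  rw [this]; rfl

theorem rot_powMap (b : Fin 2) {n : ℕ} (hn : 0 < n) (ζ : ℂ) (f : ConvSeries) :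
    rot b ζ (powMap b n f) = powMap b n (rot b (ζ ^ n) f) := by
  have : (rot b ζ).comp (powMap b n) = (powMap b n).comp (rot b (ζ ^ n)) :=
    algHom_ext fun i => by
      rw [AlgHom.comp_apply, AlgHom.comp_apply]
      by_cases h : i = b
      · subst h
        rw [powMap_X_self i hn, map_pow, rot_X_self, rot_X_self, map_smul, powMap_X_self i hn,
          smul_pow]
      · rw [powMap_X_of_ne h, rot_X_of_ne h, rot_X_of_ne h, powMap_X_of_ne h]
  exact DFunLike.congr_fun this f

/-- The rotation by a nonzero number as an automorphism. -/
def rotEquiv (b : Fin 2) (ζ : ℂˣ) : ConvSeries ≃ₐ[ℂ] ConvSeries :=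
  AlgEquiv.ofAlgHom (rot b ζ) (rot b (ζ⁻¹ : ℂˣ))
    (AlgHom.ext fun f => by rw [AlgHom.comp_apply, rot_rot, Units.mul_inv, rot_one]; rfl)
    (AlgHom.ext fun f => by rw [AlgHom.comp_apply, rot_rot, Units.inv_mul, rot_one]; rfl)

@[simp] theorem rotEquiv_apply (b : Fin 2) (ζ : ℂˣ) (f : ConvSeries) :
    rotEquiv b ζ f = rot b ζ f := rfl

/-- The rotation multiplies the component of index `i` by `ζ ^ i`, so an invariant series has only
the component of index `0`. Invariants descend. -/
theorem exists_powMap_eq_of_rot_eq (b : Fin 2) {n : ℕ} (hn : 0 < n) {ζ : ℂ}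
    (hζ : IsPrimitiveRoot ζ n) {f : ConvSeries} (h : rot b ζ f = f) :
    ∃ g, powMap b n g = f := by
  obtain ⟨T, hT, hT'⟩ := exists_powMap_components b hn
  have h1 : f = ∑ i : Fin n, X b ^ (i : ℕ) * powMap b n (ζ ^ (i : ℕ) • T i f) := by
    conv_lhs => rw [← h, hT f, map_sum]
    refine Finset.sum_congr rfl fun i _ => ?_
    rw [map_mul, map_pow, rot_X_self, rot_powMap b hn, hζ.pow_eq_one, rot_one, map_smul, smul_pow,
      smul_mul_assoc, mul_smul_comm]
  have h2 : ∀ i : Fin n, (i : ℕ) ≠ 0 → T i f = 0 := by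
    intro i hi
    have h3 : T i f = ζ ^ (i : ℕ) • T i f := by
      conv_lhs => rw [h1, hT']
    have h4 : (1 - ζ ^ (i : ℕ)) • T i f = 0 := by rw [sub_smul, one_smul, ← h3, sub_self]
    refine (smul_eq_zero.mp h4).resolve_left (sub_ne_zero.mpr fun h5 => ?_)
    exact hζ.pow_ne_one_of_pos_of_lt hi i.2 h5.symm
  refine ⟨T ⟨0, hn⟩ f, ?_⟩
  conv_rhs => rw [hT f]
  rw [Finset.sum_eq_single ⟨0, hn⟩]
  · simp
  · intro i _ hi
    rw [h2 i (fun h => hi (Fin.ext h)), map_zero, mul_zero]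
  · simp

/-! ### Unique factorization -/

theorem not_isUnit_X (b : Fin 2) : ¬ IsUnit (X b) := by simp [isUnit_iff]

/-- The multiples of `X b` are the kernel of the restriction to the other axis, whose values lie in
a domain. -/
theorem prime_X (b : Fin 2) : Prime (X b) := by
  obtain ⟨a, ha⟩ := exists_ne b
  refine ⟨X_ne_zero b, not_isUnit_X b, fun f g h => ?_⟩
  rw [← axis_eq_zero_iff ha, map_mul, mul_eq_zero] at h
  rwa [← axis_eq_zero_iff ha, ← axis_eq_zero_iff ha]

/-- The smooth germ `X 0 = φ`. -/
abbrev graph (φ : ConvSeries) : ConvSeries := X 0 - φ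

/-- The germs `φ(t)` in the variable `t = X 1` that vanish at the origin. -/
def IsArc (φ : ConvSeries) : Prop := evalZero φ = 0 ∧ axis 1 φ = φ

theorem IsArc.zero_add {φ : ConvSeries} (h : IsArc φ) : evalZero (X 0 + φ) = 0 := by
  rw [map_add, h.1, evalZero_X, add_zero]

theorem IsArc.neg {φ : ConvSeries} (h : IsArc φ) : IsArc (-φ) :=
  ⟨by rw [map_neg, h.1, neg_zero], by rw [map_neg, h.2]⟩

theorem IsArc.sub2_X1 {φ : ConvSeries} (h : IsArc φ) (p : ConvSeries) : sub2 p (X 1) φ = φ := by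
  conv_lhs => rw [← h.2]
  rw [sub2_axis_one (evalZero_X 1), ← axis_one_eq, h.2]

/-- The automorphism `X 0 ↦ X 0 + φ`. -/
def shift {φ : ConvSeries} (h : IsArc φ) : ConvSeries ≃ₐ[ℂ] ConvSeries :=
  have key : ∀ {φ : ConvSeries}, IsArc φ →
      (sub2 (X 0 + φ) (X 1)).comp (sub2 (X 0 + -φ) (X 1)) = AlgHom.id ℂ _ := fun h =>
    algHom_ext2 (by rw [AlgHom.comp_apply, sub2_X0 h.neg.zero_add, map_add, map_neg,
      sub2_X0 h.zero_add, h.sub2_X1, add_neg_cancel_right]; rfl)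
      (by rw [AlgHom.comp_apply, ConvSeries.sub2_X1 (evalZero_X 1),
        ConvSeries.sub2_X1 (evalZero_X 1)]; rfl)
  AlgEquiv.ofAlgHom (sub2 (X 0 + φ) (X 1)) (sub2 (X 0 + -φ) (X 1)) (key h)
    (by have := key h.neg; rwa [neg_neg] at this)

theorem shift_apply {φ : ConvSeries} (h : IsArc φ) (f : ConvSeries) :
    shift h f = sub2 (X 0 + φ) (X 1) f := rfl

theorem shift_graph {φ : ConvSeries} (h : IsArc φ) : shift h (graph φ) = X 0 := by
  rw [shift_apply, map_sub, sub2_X0 h.zero_add, h.sub2_X1, add_sub_cancel_right]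

theorem axis_shift {φ : ConvSeries} (h : IsArc φ) (f : ConvSeries) :
    axis 1 (shift h f) = sub2 φ (X 1) f := by
  rw [shift_apply, algHom_sub2 _ h.zero_add (evalZero_X 1), map_add, axis_X_of_ne (by decide),
    zero_add, h.2, axis_X_self]

theorem graph_dvd_iff {φ : ConvSeries} (h : IsArc φ) {f : ConvSeries} :
    graph φ ∣ f ↔ sub2 φ (X 1) f = 0 := by
  rw [← axis_shift h, axis_eq_zero_iff (show (1 : Fin 2) ≠ 0 by decide), ← shift_graph h,
    map_dvd_iff]

theorem prime_graph {φ : ConvSeries} (h : IsArc φ) : Prime (graph φ) := by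
  rw [← MulEquiv.prime_iff (shift h).toMulEquiv]
  change Prime (shift h (graph φ))
  rw [shift_graph]
  exact prime_X 0

theorem eq_of_graph_dvd_graph {φ ψ : ConvSeries} (hφ : IsArc φ) (hψ : IsArc ψ)
    (h : graph φ ∣ graph ψ) : φ = ψ := by
  rw [graph_dvd_iff hφ, map_sub, sub2_X0 hφ.1, hψ.sub2_X1] at h
  exact sub_eq_zero.mp h

theorem IsArc.rot {φ : ConvSeries} (h : IsArc φ) (ζ : ℂ) : IsArc (rot 1 ζ φ) := by
  refine ⟨by rw [evalZero_algHom, h.1], ?_⟩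
  have : (axis 1).comp (ConvSeries.rot 1 ζ) = (ConvSeries.rot 1 ζ).comp (axis 1) := by
    refine algHom_ext2 ?_ ?_ <;> simp only [AlgHom.comp_apply]
    · rw [rot_X_of_ne (by decide), axis_X_of_ne (by decide), map_zero]
    · rw [rot_X_self, axis_X_self, map_smul, axis_X_self, rot_X_self]
  rw [← AlgHom.comp_apply, this, AlgHom.comp_apply, h.2]

theorem rot_graph (ζ : ℂ) (φ : ConvSeries) : rot 1 ζ (graph φ) = graph (rot 1 ζ φ) := by
  rw [map_sub, rot_X_of_ne (by decide)]

/-! ### Power maps and primitive parametrizations. -/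

theorem axis_powMap (b : Fin 2) {n : ℕ} (hn : 0 < n) (f : ConvSeries) :
    axis b (powMap b n f) = powMap b n (axis b f) := by
  have : (axis b).comp (powMap b n) = (powMap b n).comp (axis b) := algHom_ext fun i => by
    rw [AlgHom.comp_apply, AlgHom.comp_apply]
    by_cases h : i = b
    · subst h
      rw [powMap_X_self i hn, axis_X_self, map_pow, axis_X_self, powMap_X_self i hn]
    · rw [powMap_X_of_ne h, axis_X_of_ne (Ne.symm h), map_zero]
  exact DFunLike.congr_fun this f

theorem axis_powMap_of_ne {a b : Fin 2} (hab : a ≠ b) {n : ℕ} (hn : 0 < n) (f : ConvSeries) :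
    axis a (powMap b n f) = axis a f := by
  have : (axis a).comp (powMap b n) = axis a := algHom_ext fun i => by
    rw [AlgHom.comp_apply]
    by_cases h : i = b
    · subst h
      rw [powMap_X_self i hn, map_pow, axis_X_of_ne hab, zero_pow hn.ne']
    · rw [powMap_X_of_ne h]
  exact DFunLike.congr_fun this f

theorem HasAxisOrder.powMap_of_ne {a b : Fin 2} (hab : a ≠ b) {n : ℕ} (hn : 0 < n)
    {f : ConvSeries} {m : ℕ} :
    HasAxisOrder a (powMap b n f) m ↔ HasAxisOrder a f m := by
  rw [HasAxisOrder, HasAxisOrder, axis_powMap_of_ne hab hn]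

/-- A quotient of two pull-backs is invariant under rotation by a primitive `n`-th root of unity,
hence is a pull-back. -/
theorem powMap_dvd_iff (b : Fin 2) {n : ℕ} (hn : 0 < n) {f g : ConvSeries} :
    powMap b n f ∣ powMap b n g ↔ f ∣ g := by
  refine ⟨?_, map_dvd _⟩
  rintro ⟨q, hq⟩
  by_cases hf : f = 0
  · rw [hf, map_zero, zero_mul, ← map_zero (powMap b n)] at hq
    rw [powMap_injective b hn hq]
    exact dvd_zero _
  have hζ := Complex.isPrimitiveRoot_exp n hn.ne'
  generalize Complex.exp _ = ζ at hζ
  have hf' : powMap b n f ≠ 0 := by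
    rwa [← map_zero (powMap b n), (powMap_injective b hn).ne_iff]
  have h1 : rot b ζ q = q := by
    have := congrArg (rot b ζ) hq
    rw [map_mul, rot_powMap b hn, rot_powMap b hn, hζ.pow_eq_one, rot_one, rot_one, hq] at this
    exact (mul_left_cancel₀ hf' this).symm
  obtain ⟨q', rfl⟩ := exists_powMap_eq_of_rot_eq b hn hζ h1
  exact ⟨q', powMap_injective b hn (by rw [hq, map_mul])⟩

/-- The arc `t ↦ (φ(t), t ^ N)` is a primitive parametrization: `N > 0`, and `t ↦ ζ t` does not
preserve it if `ζ ≠ 1`. -/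
def IsParam (N : ℕ) (φ : ConvSeries) : Prop :=
  0 < N ∧ IsArc φ ∧ ∀ ζ : ℂ, ζ ^ N = 1 → rot 1 ζ φ = φ → ζ = 1

/-- The least possible `N` works. If a rotation of order `k > 1` with `k ∣ N` fixed `φ`, then `φ`
would be a series in `t ^ k`, and `t ^ k` could serve as the parameter. -/
theorem exists_isParam {m : ℕ} {f : ConvSeries} (hf : HasAxisOrder 0 f m) (hm : 0 < m) :
    ∃ N φ, IsParam N φ ∧ sub2 φ (X 1 ^ N) f = 0 := by
  classical
  have hex : ∃ N, 0 < N ∧ ∃ φ, IsArc φ ∧ sub2 φ (X 1 ^ N) f = 0 := by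
    obtain ⟨N, hN, φ, h0, h1, h⟩ := exists_puiseux hf hm
    exact ⟨N, hN, φ, ⟨h0, h1⟩, h⟩
  obtain ⟨hN, φ, hφ, h⟩ := Nat.find_spec hex
  have hmin := fun k => Nat.find_min (m := k) hex
  generalize Nat.find hex = N at *
  refine ⟨N, φ, ⟨hN, hφ, fun ζ hζ hr => ?_⟩, h⟩
  have hk := orderOf_dvd_of_pow_eq_one hζ
  have hk0 : 0 < orderOf ζ := Nat.pos_of_dvd_of_pos hk hN
  have hprim := IsPrimitiveRoot.orderOf ζ
  by_contra hne
  have hk1 : orderOf ζ ≠ 1 := by rwa [Ne, orderOf_eq_one_iff]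
  generalize orderOf ζ = k at *
  obtain ⟨N', rfl⟩ := hk
  have hN' : 0 < N' := Nat.pos_of_mul_pos_left hN
  obtain ⟨ψ, rfl⟩ := exists_powMap_eq_of_rot_eq 1 hk0 hprim hr
  refine hmin N' ?_ ⟨hN', ψ, ⟨?_, ?_⟩, ?_⟩
  · nlinarith [show 2 ≤ k by omega]
  · rw [← evalZero_algHom (powMap 1 k), hφ.1]
  · apply powMap_injective 1 hk0
    rw [← axis_powMap 1 hk0, hφ.2]
  · apply powMap_injective 1 hk0
    have hz : evalZero ψ = 0 := by rw [← evalZero_algHom (powMap 1 k), hφ.1]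
    rw [algHom_sub2 _ hz (by simp [hN'.ne']), map_pow, powMap_X_self 1 hk0, ← pow_mul, h, map_zero]

theorem prod_dvd_of_prime {ι : Type*} (s : Finset ι) {p : ι → ConvSeries} {f : ConvSeries}
    (hp : ∀ i ∈ s, Prime (p i)) (hne : ∀ i ∈ s, ∀ j ∈ s, p i ∣ p j → i = j)
    (hd : ∀ i ∈ s, p i ∣ f) : ∏ i ∈ s, p i ∣ f := by
  classical
  induction s using Finset.induction_on with
  | empty => simp
  | insert i s his ih =>
    obtain ⟨g, rfl⟩ := ih (fun j hj => hp j (Finset.mem_insert_of_mem hj))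
      (fun j hj k hk => hne j (Finset.mem_insert_of_mem hj) k (Finset.mem_insert_of_mem hk))
      (fun j hj => hd j (Finset.mem_insert_of_mem hj))
    have hi := hp i (Finset.mem_insert_self i s)
    rw [Finset.prod_insert his, mul_comm]
    refine mul_dvd_mul_left _ ((hi.dvd_or_dvd (hd i (Finset.mem_insert_self i s))).resolve_left ?_)
    rw [hi.dvd_finsetProd_iff]
    rintro ⟨j, hj, hij⟩
    exact his ((hne i (Finset.mem_insert_self i s) j (Finset.mem_insert_of_mem hj) hij).symm ▸ hj)

theorem IsParam.eq_of_rot_eq {N : ℕ} {φ : ConvSeries} (h : IsParam N φ) {ζ : ℂ}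
    (hζ : IsPrimitiveRoot ζ N) {i j : ℕ} (hi : i < N) (hj : j < N)
    (hij : rot 1 (ζ ^ i) φ = rot 1 (ζ ^ j) φ) : i = j := by
  have hζ0 : ζ ≠ 0 := hζ.ne_zero h.1.ne'
  have h1 : rot 1 ((ζ ^ i)⁻¹ * ζ ^ j) φ = φ := by
    rw [← rot_rot, ← hij, rot_rot, inv_mul_cancel₀ (pow_ne_zero _ hζ0), rot_one]
  have h2 := h.2.2 _ (by rw [mul_pow, inv_pow, ← pow_mul, ← pow_mul, mul_comm i, mul_comm j,
    pow_mul, pow_mul, hζ.pow_eq_one, one_pow, one_pow, inv_one, one_mul]) h1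
  rw [inv_mul_eq_one₀ (pow_ne_zero _ hζ0)] at h2
  exact hζ.pow_inj hi hj h2

/-- The irreducible germ parametrized by `t ↦ (φ(t), t ^ N)`. -/
theorem IsParam.exists_norm {N : ℕ} {φ : ConvSeries} (h : IsParam N φ) {ζ : ℂ}
    (hζ : IsPrimitiveRoot ζ N) :
    ∃ g, powMap 1 N g = ∏ j ∈ Finset.range N, graph (rot 1 (ζ ^ j) φ) ∧
      (∀ f, g ∣ f ↔ sub2 φ (X 1 ^ N) f = 0) ∧ Prime g ∧ HasAxisOrder 0 g N := by
  have hN := h.1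
  -- The rotation by `ζ` permutes the conjugate graphs, so their product descends.
  obtain ⟨g, hg⟩ := exists_powMap_eq_of_rot_eq 1 hN hζ
    (f := ∏ j ∈ Finset.range N, graph (rot 1 (ζ ^ j) φ)) (by
      simp only [map_prod, rot_graph, rot_rot, ← pow_succ']
      obtain ⟨N, rfl⟩ : ∃ k, N = k + 1 := ⟨N - 1, by omega⟩
      rw [Finset.prod_range_succ, hζ.pow_eq_one, Finset.prod_range_succ', pow_zero])
  -- If `f` vanishes on the arc, the graph of `φ` divides `powMap 1 N f`. That series is invariant
  -- under rotation, so all conjugates divide it; they are distinct primes because the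
  -- parametrization is primitive. The multiples of `g` are therefore the kernel of a map to a
  -- domain.
  have hdvd : ∀ f, g ∣ f ↔ sub2 φ (X 1 ^ N) f = 0 := by
    intro f
    have e : sub2 φ (X 1 ^ N) f = sub2 φ (X 1) (powMap 1 N f) := by
      rw [sub2_algHom, powMap_X_self 1 hN, powMap_X_of_ne (by decide), map_pow,
        sub2_X0 h.2.1.1, sub2_X1 (evalZero_X 1)]
    rw [e, ← graph_dvd_iff h.2.1, ← powMap_dvd_iff 1 hN, hg]
    constructor
    · refine (Dvd.dvd.trans ?_)
      convert Finset.dvd_prod_of_mem (fun j => graph (rot 1 (ζ ^ j) φ)) (Finset.mem_range.mpr hN)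
      simp
    · intro hd
      refine prod_dvd_of_prime _ (fun i _ => prime_graph (h.2.1.rot _)) (fun i hi j hj hij => ?_)
        (fun i _ => ?_)
      · exact h.eq_of_rot_eq hζ (Finset.mem_range.mp hi) (Finset.mem_range.mp hj)
          (eq_of_graph_dvd_graph (h.2.1.rot _) (h.2.1.rot _) hij)
      · have := map_dvd (rot 1 (ζ ^ i)) hd
        rwa [rot_graph, rot_powMap 1 hN, ← pow_mul, mul_comm, pow_mul, hζ.pow_eq_one, one_pow,
          rot_one] at this
  have hord : HasAxisOrder 0 g N := by
    refine ⟨1, isUnit_one, ?_⟩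
    rw [← axis_powMap_of_ne (show (0 : Fin 2) ≠ 1 by decide) hN, hg, map_prod, mul_one]
    have : ∀ j, axis 0 (graph (rot 1 (ζ ^ j) φ)) = X 0 := fun j => by
      rw [map_sub, axis_X_self, axis_of_axis_eq (by decide) (h.2.1.rot _).2, (h.2.1.rot _).1,
        map_zero, sub_zero]
    simp [this]
  refine ⟨g, hg, hdvd, ⟨?_, ?_, fun a b hab => ?_⟩, hord⟩
  · rintro rfl
    exact hord.axis_ne_zero (map_zero _)
  · rw [isUnit_iff, not_not]
    exact hord.pos_iff.mp hN
  · rw [hdvd, map_mul, mul_eq_zero] at hab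
    rwa [hdvd, hdvd]

/-- The prime germ built from a primitive arc on `δ` divides `δ`, hence is associated to it. This
gives at once primality, the order on the axis and the factorization after `t ↦ t ^ N`. -/
theorem exists_param_of_irreducible {δ : ConvSeries} (hδ : Irreducible δ) (hX : ¬ X 1 ∣ δ) :
    ∃ N φ, IsParam N φ ∧ (∀ f, δ ∣ f ↔ sub2 φ (X 1 ^ N) f = 0) ∧ Prime δ ∧ HasAxisOrder 0 δ N ∧
      ∀ ζ, IsPrimitiveRoot ζ N →
        Associated (powMap 1 N δ) (∏ j ∈ Finset.range N, graph (rot 1 (ζ ^ j) φ)) := by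
  obtain ⟨m, hm⟩ := exists_hasAxisOrder_of_not_dvd (show (0 : Fin 2) ≠ 1 by decide) hX
  have hm0 : 0 < m := hm.pos_iff.mpr (not_not.mp (isUnit_iff.not.mp hδ.not_isUnit))
  obtain ⟨N, φ, hφ, h⟩ := exists_isParam hm hm0
  have key : ∀ ζ, IsPrimitiveRoot ζ N → ∃ g, powMap 1 N g =
      ∏ j ∈ Finset.range N, graph (rot 1 (ζ ^ j) φ) ∧
      (∀ f, g ∣ f ↔ sub2 φ (X 1 ^ N) f = 0) ∧ Prime g ∧ HasAxisOrder 0 g N ∧ Associated g δ := by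
    intro ζ hζ
    obtain ⟨g, h1, h2, h3, h4⟩ := hφ.exists_norm hζ
    exact ⟨g, h1, h2, h3, h4, h3.irreducible.associated_of_dvd hδ ((h2 δ).mpr h)⟩
  obtain ⟨g, -, h2, h3, h4, h5⟩ := key _ (Complex.isPrimitiveRoot_exp N hφ.1.ne')
  refine ⟨N, φ, hφ, fun f => by rw [← h5.dvd_iff_dvd_left, h2], h5.prime h3, ?_, fun ζ hζ => ?_⟩
  · obtain ⟨u, rfl⟩ := h5
    have h6 : HasAxisOrder 0 (u : ConvSeries) 0 := ⟨axis 0 u, u.isUnit.map _, by simp⟩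
    exact h4.mul h6
  · obtain ⟨g, h1, -, -, -, h5⟩ := key ζ hζ
    rw [← h1]
    exact h5.symm.map (powMap 1 N)

theorem prime_of_irreducible {δ : ConvSeries} (hδ : Irreducible δ) : Prime δ := by
  by_cases hX : X 1 ∣ δ
  · exact ((prime_X 1).irreducible.associated_of_dvd hδ hX).prime (prime_X 1)
  · obtain ⟨N, φ, -, -, h, -⟩ := exists_param_of_irreducible hδ hX
    exact h

/-- A non-unit factor raises the order by at least one. -/
instance : WfDvdMonoid ConvSeries where
  wf := by
    refine Subrelation.wf (r := InvImage (· < ·) fun f : ConvSeries => f.1.order) ?_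
      (InvImage.wf _ wellFounded_lt)
    rintro f g ⟨hf, x, hx, rfl⟩
    have h1 : f.1.order ≠ ⊤ := by
      rw [Ne, MvPowerSeries.order_eq_top_iff]
      exact fun h => hf (Subtype.ext h)
    have h2 : (1 : ℕ∞) ≤ x.1.order := by
      have : x ∈ orderIdeal 1 := mem_orderIdeal_one.mpr (by rwa [isUnit_iff, not_not] at hx)
      exact_mod_cast mem_orderIdeal_iff_order.mp this
    calc f.1.order < f.1.order + 1 := ENat.lt_add_one_iff h1 |>.mpr le_rfl
      _ ≤ f.1.order + x.1.order := by gcongr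
      _ ≤ _ := MvPowerSeries.le_order_mul

instance : UniqueFactorizationMonoid ConvSeries where
  irreducible_iff_prime := ⟨prime_of_irreducible, Prime.irreducible⟩

/-! ### Intersection numbers -/

instance : IsDomain ConvSeries := NoZeroDivisors.to_isDomain _

theorem dimQuot_map_algEquiv (e : ConvSeries ≃ₐ[ℂ] ConvSeries) (I : Ideal ConvSeries) :
    dimQuot (I.map (e : ConvSeries →ₐ[ℂ] ConvSeries)) = dimQuot I := by
  rw [dimQuot, dimQuot,
    (Ideal.quotientEquivAlg I (I.map (e : ConvSeries →ₐ[ℂ] ConvSeries)) e rfl).toLinearEquiv.rank_eq]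

theorem map_span_pair (φ : ConvSeries →ₐ[ℂ] ConvSeries) (f g : ConvSeries) :
    (Ideal.span {f, g}).map φ = Ideal.span {φ f, φ g} := by
  rw [Ideal.map_span, Set.image_pair]

theorem intersectionNumber_algEquiv (e : ConvSeries ≃ₐ[ℂ] ConvSeries) (f g : ConvSeries) :
    intersectionNumber (e f) (e g) = intersectionNumber f g := by
  have := dimQuot_map_algEquiv e (Ideal.span {f, g})
  rw [map_span_pair] at this
  exact this

theorem intersectionNumber_powMap (b : Fin 2) {n : ℕ} (hn : 0 < n) (f g : ConvSeries) :
    intersectionNumber (powMap b n f) (powMap b n g) = n * intersectionNumber f g := by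
  rw [intersectionNumber, ← map_span_pair, dimQuot_map_powMap b hn]; rfl

theorem intersectionNumber_comm (f g : ConvSeries) :
    intersectionNumber f g = intersectionNumber g f := by
  rw [intersectionNumber, intersectionNumber, Set.pair_comm]

theorem intersectionNumber_congr_of_associated {f f' : ConvSeries} (h : Associated f f')
    (g : ConvSeries) : intersectionNumber f g = intersectionNumber f' g := by
  rw [intersectionNumber, intersectionNumber, Ideal.span_insert, Ideal.span_insert f',
    Ideal.span_singleton_eq_span_singleton.mpr h]

theorem intersectionNumber_congr_right {g g' : ConvSeries} (h : Associated g g')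
    (f : ConvSeries) : intersectionNumber f g = intersectionNumber f g' := by
  rw [intersectionNumber_comm f, intersectionNumber_comm f,
    intersectionNumber_congr_of_associated h]

theorem intersectionNumber_of_isUnit_right {g : ConvSeries} (hg : IsUnit g) (f : ConvSeries) :
    intersectionNumber f g = 0 := by
  have : Ideal.span {f, g} = ⊤ := Ideal.eq_top_of_isUnit_mem _ (Ideal.subset_span (by simp)) hg
  have h : Subsingleton (ConvSeries ⧸ Ideal.span {f, g}) := Ideal.Quotient.subsingleton_iff.mpr this
  rw [intersectionNumber, dimQuot, rank_subsingleton', map_zero]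

theorem intersectionNumber_of_isUnit_left {f : ConvSeries} (hf : IsUnit f) (g : ConvSeries) :
    intersectionNumber f g = 0 := by
  rw [intersectionNumber_comm, intersectionNumber_of_isUnit_right hf]

theorem dimQuot_antitone : Antitone dimQuot := by
  intro I J h
  refine OrderHomClass.mono Cardinal.toENat ?_
  let π : (ConvSeries ⧸ I) →ₗ[ℂ] (ConvSeries ⧸ J) := (Ideal.Quotient.factorₐ ℂ h).toLinearMap
  exact LinearMap.rank_le_of_surjective π (Ideal.Quotient.factor_surjective h)

/-- In a finite-dimensional quotient `X b` is a root of some `T ^ k * q(T)` with `q(0) ≠ 0`, and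
`q(X b)` is a unit. -/
theorem exists_X_pow_mem {I : Ideal ConvSeries} (h : dimQuot I ≠ ⊤) (b : Fin 2) :
    ∃ k, X b ^ k ∈ I := by
  have hfree : Module.Free ℂ (ConvSeries ⧸ I) := Module.Free.of_divisionRing ℂ _
  rw [dimQuot, Cardinal.toENat_ne_top, Module.rank_lt_aleph0_iff] at h
  have hint : IsIntegral ℂ (Ideal.Quotient.mk I (X b)) := IsIntegral.of_finite ℂ _
  obtain ⟨p, hp, hpe⟩ := hint
  obtain ⟨q, hq, hnd⟩ := Polynomial.exists_eq_pow_rootMultiplicity_mul_and_not_dvd p hp.ne_zero 0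
  refine ⟨p.rootMultiplicity 0, ?_⟩
  generalize p.rootMultiplicity 0 = k at hq
  have h1 : Polynomial.aeval (X b) p ∈ I := by
    rw [← Ideal.Quotient.eq_zero_iff_mem, ← Ideal.Quotient.mkₐ_eq_mk ℂ,
      ← Polynomial.aeval_algHom_apply]
    exact hpe
  rw [hq, map_mul, map_pow, map_sub, Polynomial.aeval_X, Polynomial.aeval_C, map_zero,
    sub_zero] at h1
  refine (Ideal.mul_unit_mem_iff_mem I ?_).mp h1
  rw [isUnit_iff, ← Polynomial.aeval_algHom_apply, evalZero_X]
  intro h0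
  apply hnd
  rw [Polynomial.dvd_iff_isRoot]
  simpa using h0

/-- If the number were finite, the non-unit `d` would divide powers of both coordinates, so `X 0`
would divide `X 1`. -/
theorem intersectionNumber_eq_top {f g d : ConvSeries} (hd : ¬ IsUnit d) (hf : d ∣ f)
    (hg : d ∣ g) : intersectionNumber f g = ⊤ := by
  by_contra h
  have key : ∀ b, ∃ k, Associated d (X b ^ k) := by
    intro b
    obtain ⟨k, hk⟩ := exists_X_pow_mem h b
    obtain ⟨x, y, e⟩ := Ideal.mem_span_pair.mp hk
    have : d ∣ X b ^ k := e ▸ dvd_add (hf.mul_left x) (hg.mul_left y)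
    obtain ⟨i, -, hi⟩ := (dvd_prime_pow (prime_X b) k).mp this
    exact ⟨i, hi⟩
  obtain ⟨k, hk⟩ := key 0
  obtain ⟨l, hl⟩ := key 1
  have hk0 : k ≠ 0 := by
    rintro rfl
    rw [pow_zero] at hk
    exact hd (hk.symm.isUnit isUnit_one)
  have h1 : X 0 ∣ X 1 := (prime_X 0).dvd_of_dvd_pow
    ((dvd_pow_self _ hk0).trans ((hk.symm.trans hl).dvd))
  rw [X_dvd_iff] at h1
  have := h1 (Finsupp.single 1 1) (by simp)
  rw [coeff_X, if_pos rfl] at this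
  exact one_ne_zero this

theorem isRelPrime_of_intersectionNumber_ne_top {f g : ConvSeries}
    (h : intersectionNumber f g ≠ ⊤) : IsRelPrime f g := by
  intro d hf hg
  by_contra hd
  exact h (intersectionNumber_eq_top hd hf hg)

/-- Multiplication by `g` and projection give an exact sequence from the quotient by `(f, h)`
through that by `(f, g * h)` to that by `(f, g)`. Injectivity needs `f` and `g` relatively prime;
otherwise both sides are infinite. -/
theorem intersectionNumber_mul_right (f g h : ConvSeries) :
    intersectionNumber f (g * h) = intersectionNumber f g + intersectionNumber f h := by
  have hle : Ideal.span {f, g * h} ≤ Ideal.span {f, g} := by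
    rw [Ideal.span_le]
    rintro x (rfl | rfl)
    · exact Ideal.subset_span (by simp)
    · exact Ideal.mul_mem_right _ _ (Ideal.subset_span (by simp))
  by_cases hrel : IsRelPrime f g
  swap
  · have h1 : intersectionNumber f g = ⊤ := by
      by_contra h
      exact hrel (isRelPrime_of_intersectionNumber_ne_top h)
    have h2 : intersectionNumber f g ≤ intersectionNumber f (g * h) := dimQuot_antitone hle
    rw [h1] at h2 ⊢
    rw [top_add, top_le_iff.mp h2]
  set I := Ideal.span {f, h}
  set J := Ideal.span {f, g * h}
  set K := Ideal.span {f, g}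
  have hI : I ≤ Submodule.comap (LinearMap.lsmul ConvSeries ConvSeries g) J := by
    rw [Ideal.span_le]
    rintro x (rfl | rfl)
    · exact Ideal.mul_mem_left _ _ (Ideal.subset_span (by simp))
    · exact Ideal.subset_span (by simp)
  let μ : (ConvSeries ⧸ I) →ₗ[ℂ] (ConvSeries ⧸ J) :=
    (Submodule.mapQ I J (LinearMap.lsmul ConvSeries ConvSeries g) hI).restrictScalars ℂ
  let π : (ConvSeries ⧸ J) →ₗ[ℂ] (ConvSeries ⧸ K) := (Ideal.Quotient.factorₐ ℂ hle).toLinearMap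
  have hμ : ∀ x, μ (Ideal.Quotient.mk I x) = Ideal.Quotient.mk J (g * x) := fun x => rfl
  have hπ : ∀ x, π (Ideal.Quotient.mk J x) = Ideal.Quotient.mk K x := fun x => rfl
  have hπs : Function.Surjective π := Ideal.Quotient.factor_surjective hle
  have hμi : Function.Injective μ := by
    rw [← LinearMap.ker_eq_bot, LinearMap.ker_eq_bot']
    intro y
    obtain ⟨x, rfl⟩ := Ideal.Quotient.mk_surjective y
    rw [hμ, Ideal.Quotient.eq_zero_iff_mem, Ideal.Quotient.eq_zero_iff_mem, Ideal.mem_span_pair,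
      Ideal.mem_span_pair]
    rintro ⟨a, b, e⟩
    by_cases hg : g = 0
    · subst hg
      have : IsUnit f := hrel dvd_rfl (dvd_zero f)
      obtain ⟨u, hu⟩ := this.exists_left_inv
      exact ⟨x * u, 0, by rw [mul_assoc, hu]; ring⟩
    have h1 : g ∣ a * f := ⟨x - b * h, by rw [mul_sub, ← e]; ring⟩
    obtain ⟨c, rfl⟩ := hrel.symm.dvd_of_dvd_mul_right h1
    refine ⟨c, b, mul_left_cancel₀ hg ?_⟩
    rw [← e]; ring
  have hex : LinearMap.ker π = LinearMap.range μ := by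
    ext y
    obtain ⟨x, rfl⟩ := Ideal.Quotient.mk_surjective y
    rw [LinearMap.mem_ker, LinearMap.mem_range, hπ, Ideal.Quotient.eq_zero_iff_mem,
      Ideal.mem_span_pair]
    constructor
    · rintro ⟨a, b, rfl⟩
      refine ⟨Ideal.Quotient.mk I b, ?_⟩
      rw [hμ, Ideal.Quotient.mk_eq_mk_iff_sub_mem]
      refine Ideal.mem_span_pair.mpr ⟨-a, 0, by ring⟩
    · rintro ⟨z, hz⟩
      obtain ⟨b, rfl⟩ := Ideal.Quotient.mk_surjective z
      rw [hμ, Ideal.Quotient.mk_eq_mk_iff_sub_mem] at hz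
      obtain ⟨a, c, e⟩ := Ideal.mem_span_pair.mp hz
      exact ⟨-a, b - c * h, by linear_combination -e⟩
  have h1 := LinearMap.rank_range_add_rank_ker π
  rw [hex, rank_range_of_injective μ hμi, LinearMap.range_eq_top.mpr hπs, rank_top] at h1
  change Cardinal.toENat (Module.rank ℂ (ConvSeries ⧸ J)) =
    Cardinal.toENat (Module.rank ℂ (ConvSeries ⧸ K)) +
      Cardinal.toENat (Module.rank ℂ (ConvSeries ⧸ I))
  rw [← h1, map_add]

theorem intersectionNumber_mul_left (f g h : ConvSeries) :
    intersectionNumber (f * g) h = intersectionNumber f h + intersectionNumber g h := by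
  rw [intersectionNumber_comm, intersectionNumber_mul_right, intersectionNumber_comm h,
    intersectionNumber_comm h]

theorem intersectionNumber_pow_right (f g : ConvSeries) (k : ℕ) :
    intersectionNumber f (g ^ k) = k * intersectionNumber f g := by
  induction k with
  | zero => rw [pow_zero, intersectionNumber_of_isUnit_right isUnit_one, Nat.cast_zero, zero_mul]
  | succ k ih => rw [pow_succ, intersectionNumber_mul_right, ih]; push_cast; ring

theorem intersectionNumber_pow_left (f g : ConvSeries) (k : ℕ) :
    intersectionNumber (f ^ k) g = k * intersectionNumber f g := by
  rw [intersectionNumber_comm, intersectionNumber_pow_right, intersectionNumber_comm]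

theorem intersectionNumber_X_X {a b : Fin 2} (hab : a ≠ b) :
    intersectionNumber (X a) (X b) = 1 := by
  have hker : Ideal.span {X a, X b} = RingHom.ker evalZero := by
    apply le_antisymm
    · rw [Ideal.span_le]
      rintro x (rfl | rfl) <;> exact evalZero_X _
    · intro f hf
      obtain ⟨g, h, e, -⟩ := exists_eq_C_add hab f
      rw [RingHom.mem_ker] at hf
      rw [hf, map_zero, zero_add] at e
      exact Ideal.mem_span_pair.mpr ⟨g, h, by rw [e]; ring⟩
  have hs : Function.Surjective evalZero := fun c => ⟨algebraMap ℂ ConvSeries c, by simp⟩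
  rw [intersectionNumber, dimQuot, hker,
    (Ideal.quotientKerAlgEquivOfSurjective hs).toLinearEquiv.rank_eq, Module.rank_self, map_one]

/-- Modulo `X b` the series may be replaced by its restriction, which is `X a ^ m` times a unit. -/
theorem intersectionNumber_X {a b : Fin 2} (hab : a ≠ b) {f : ConvSeries} {m : ℕ}
    (h : HasAxisOrder a f m) : intersectionNumber f (X b) = m := by
  obtain ⟨w, hw, e⟩ := h
  obtain ⟨g, hg⟩ := sub_axis_dvd hab f
  have h1 : Ideal.span {f, X b} = Ideal.span {axis a f, X b} := by
    rw [show f = axis a f + X b * g by rw [← hg]; ring, mul_comm, map_add, map_mul,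
      axis_X_of_ne hab, mul_zero, add_zero, axis_axis, Ideal.span_pair_add_mul_right]
  rw [intersectionNumber, h1, e]
  change intersectionNumber _ _ = _
  rw [intersectionNumber_mul_left, intersectionNumber_of_isUnit_left hw,
    intersectionNumber_pow_left, intersectionNumber_X_X hab, mul_one, add_zero]

/-! ### Finiteness of intersection numbers. -/

theorem intersectionNumber_prod_left {ι : Type*} (s : Finset ι) (p : ι → ConvSeries)
    (g : ConvSeries) :
    intersectionNumber (∏ i ∈ s, p i) g = ∑ i ∈ s, intersectionNumber (p i) g := by
  classical
  induction s using Finset.induction_on with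
  | empty => rw [Finset.prod_empty, intersectionNumber_of_isUnit_left isUnit_one]; simp
  | insert i s hi ih => rw [Finset.prod_insert hi, Finset.sum_insert hi,
      intersectionNumber_mul_left, ih]

theorem intersectionNumber_graph_ne_top {φ : ConvSeries} (h : IsArc φ) {f : ConvSeries}
    (hf : ¬ graph φ ∣ f) : intersectionNumber (graph φ) f ≠ ⊤ := by
  rw [← intersectionNumber_algEquiv (shift h), shift_graph, intersectionNumber_comm]
  rw [← map_dvd_iff (shift h), shift_graph] at hf
  obtain ⟨m, hm⟩ := exists_hasAxisOrder_of_not_dvd (show (1 : Fin 2) ≠ 0 by decide) hf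
  rw [intersectionNumber_X (by decide) hm]
  exact ENat.natCast_ne_top m

/-- The pull-back by `t ↦ t ^ N` multiplies the number by `N` and breaks `p` into graphs, each of
which can be straightened to an axis. If one of them divided the pull-back of `f`, all its rotates
would, and `p` would divide `f`. -/
theorem intersectionNumber_ne_top_of_prime {p f : ConvSeries} (hp : Prime p) (hf : ¬ p ∣ f) :
    intersectionNumber p f ≠ ⊤ := by
  by_cases hX : X 1 ∣ p
  · have h := (prime_X 1).associated_of_dvd hp hX
    rw [← intersectionNumber_congr_of_associated h, intersectionNumber_comm]
    rw [← h.dvd_iff_dvd_left] at hf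
    obtain ⟨m, hm⟩ := exists_hasAxisOrder_of_not_dvd (show (0 : Fin 2) ≠ 1 by decide) hf
    rw [intersectionNumber_X (by decide) hm]
    exact ENat.natCast_ne_top m
  · obtain ⟨N, φ, hφ, hdvd, -, -, hassoc⟩ := exists_param_of_irreducible hp.irreducible hX
    have hζ := Complex.isPrimitiveRoot_exp N hφ.1.ne'
    have h1 := intersectionNumber_powMap 1 hφ.1 p f
    rw [intersectionNumber_congr_of_associated (hassoc _ hζ), intersectionNumber_prod_left] at h1
    have h2 : (N : ℕ∞) * intersectionNumber p f ≠ ⊤ := by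
      rw [← h1, ← lt_top_iff_ne_top, ENat.sum_lt_top]
      intro j hj
      rw [lt_top_iff_ne_top]
      refine intersectionNumber_graph_ne_top (hφ.2.1.rot _) fun h => hf ?_
      rw [← powMap_dvd_iff 1 hφ.1]
      refine (hassoc _ hζ).dvd.trans ?_
      have hz := hζ.ne_zero hφ.1.ne'
      have hr : ∀ i, graph (rot 1 (Complex.exp (2 * Real.pi * Complex.I / N) ^ i) φ) ∣
          powMap 1 N f := by
        intro i
        generalize Complex.exp _ = ζ at *
        have h3 := map_dvd (rot 1 (ζ ^ i * (ζ ^ j)⁻¹)) h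
        rw [rot_graph, rot_rot, mul_assoc, inv_mul_cancel₀ (pow_ne_zero _ hz), mul_one,
          rot_powMap 1 hφ.1] at h3
        rwa [mul_pow, inv_pow, ← pow_mul, ← pow_mul, mul_comm i, mul_comm j, pow_mul, pow_mul,
          hζ.pow_eq_one, one_pow, one_pow, inv_one, one_mul, rot_one] at h3
      refine prod_dvd_of_prime _ (fun i _ => prime_graph (hφ.2.1.rot _))
        (fun i hi k hk hik => ?_) (fun i _ => hr i)
      exact hφ.eq_of_rot_eq hζ (Finset.mem_range.mp hi) (Finset.mem_range.mp hk)
        (eq_of_graph_dvd_graph (hφ.2.1.rot _) (hφ.2.1.rot _) hik)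
    intro h
    rw [h, ENat.mul_top (by exact_mod_cast hφ.1.ne')] at h2
    exact h2 rfl

theorem intersectionNumber_ne_top_iff {f g : ConvSeries} :
    intersectionNumber f g ≠ ⊤ ↔ IsRelPrime f g := by
  refine ⟨isRelPrime_of_intersectionNumber_ne_top, ?_⟩
  induction f using UniqueFactorizationMonoid.induction_on_prime with
  | h₁ =>
    intro h
    rw [isRelPrime_zero_left] at h
    rw [intersectionNumber_of_isUnit_right h]
    exact ENat.zero_ne_top
  | h₂ x hx =>
    intro _
    rw [intersectionNumber_of_isUnit_left hx]
    exact ENat.zero_ne_top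
  | h₃ a p ha hp ih =>
    intro h
    rw [intersectionNumber_mul_left]
    refine WithTop.add_ne_top.mpr ⟨?_, ih h.of_mul_left_right⟩
    exact intersectionNumber_ne_top_of_prime hp fun hpg =>
      hp.not_isUnit (h (dvd_mul_right p a) hpg)

/-! ### Finiteness of Milnor numbers -/

theorem exists_algHom_of_prime {p : ConvSeries} (hp : Prime p) :
    ∃ s : ConvSeries →ₐ[ℂ] ConvSeries, ∀ f, p ∣ f ↔ s f = 0 := by
  by_cases hX : X 1 ∣ p
  · refine ⟨axis 0, fun f => ?_⟩
    rw [← ((prime_X 1).associated_of_dvd hp hX).dvd_iff_dvd_left,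
      axis_eq_zero_iff (show (0 : Fin 2) ≠ 1 by decide)]
  · obtain ⟨N, φ, -, hdvd, -⟩ := exists_param_of_irreducible hp.irreducible hX
    exact ⟨sub2 φ (X 1 ^ N), hdvd⟩

theorem eq_C_of_partialDeriv_eq_zero {f : ConvSeries} (h : ∀ i, partialDeriv i f = 0) :
    f = algebraMap ℂ ConvSeries (evalZero f) := by
  refine ext_coeff fun m => ?_
  rw [coeff_C, evalZero_eq_coeff]
  split_ifs with hm
  · rw [hm]
  · obtain ⟨i, hi⟩ := Finsupp.ne_iff.mp hm
    have h1 := congrArg (coeff (m - Finsupp.single i 1)) (h i)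
    rw [Finsupp.coe_zero, Pi.zero_apply] at hi
    rw [coeff_partialDeriv, tsub_add_cancel_of_le (by simp; omega), map_zero] at h1
    refine (mul_eq_zero.mp h1).resolve_right ?_
    exact Nat.cast_add_one_ne_zero _

/-- Along a parametrization of `p = 0` the chain rule makes `f` constant, equal to its value at the
origin. -/
theorem dvd_of_dvd_partialDeriv {p f : ConvSeries} (hp : Prime p) (hf : evalZero f = 0)
    (h : ∀ i, p ∣ partialDeriv i f) : p ∣ f := by
  obtain ⟨s, hs⟩ := exists_algHom_of_prime hp
  rw [hs]
  have h1 : ∀ i, partialDeriv i (s f) = 0 := fun i => by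
    rw [partialDeriv_algHom, (hs _).mp (h 0), (hs _).mp (h 1), zero_mul, zero_mul, add_zero]
  rw [eq_C_of_partialDeriv_eq_zero h1, evalZero_algHom, hf, map_zero]

/-- Differentiating a monomial of lowest degree produces a series of smaller order than `f`, whereas
multiples of `f` have at least the order of `f`. -/
theorem exists_not_dvd_partialDeriv {f : ConvSeries} (hf : f ≠ 0) (hf0 : evalZero f = 0) :
    ∃ i, ¬ f ∣ partialDeriv i f := by
  have h1 : f.1 ≠ 0 := fun h => hf (Subtype.ext h)
  obtain ⟨m, hm, hord⟩ := MvPowerSeries.exists_coeff_ne_zero_and_order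
    (MvPowerSeries.ne_zero_iff_order_finite.mp h1)
  have hmem : f ∈ orderIdeal m.degree := mem_orderIdeal_iff_order.mpr hord.le
  have hm0 : m ≠ 0 := by
    rintro rfl
    rw [evalZero_eq_coeff] at hf0
    exact hm hf0
  obtain ⟨i, hi⟩ := Finsupp.ne_iff.mp hm0
  rw [Finsupp.coe_zero, Pi.zero_apply] at hi
  refine ⟨i, fun hd => ?_⟩
  have hle : Finsupp.single i 1 ≤ m := by simp; omega
  have h2 := Ideal.mem_of_dvd _ hd hmem (m - Finsupp.single i 1) (by
    have := congrArg Finsupp.degree (tsub_add_cancel_of_le hle)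
    rw [map_add, Finsupp.degree_single] at this
    omega)
  rw [coeff_partialDeriv, tsub_add_cancel_of_le hle] at h2
  refine (mul_ne_zero hm ?_) h2
  exact Nat.cast_add_one_ne_zero _

/-- A prime `p` dividing both derivatives divides `f = p * g`, with `p` not dividing `g`. It then
divides both derivatives of `p` itself, which is impossible. -/
theorem milnorNumber_ne_top {f : ConvSeries} (hsq : Squarefree f) (hf : evalZero f = 0) :
    milnorNumber f ≠ ⊤ := by
  have key : ∀ p, Prime p → ¬ ∀ i, p ∣ partialDeriv i f := by
    intro p hp h
    obtain ⟨g, rfl⟩ := dvd_of_dvd_partialDeriv hp hf h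
    have hg : ¬ p ∣ g := by
      rintro ⟨q, rfl⟩
      exact hp.not_isUnit (hsq p ⟨q, by ring⟩)
    obtain ⟨i, hi⟩ := exists_not_dvd_partialDeriv hp.ne_zero (not_not.mp
      (isUnit_iff.not.mp hp.not_isUnit))
    have h1 := h i
    rw [partialDeriv_mul, dvd_add_right (dvd_mul_right p _)] at h1
    exact (hp.dvd_or_dvd h1).elim hg hi
  change intersectionNumber _ _ ≠ ⊤
  rw [intersectionNumber_ne_top_iff]
  refine WfDvdMonoid.isRelPrime_of_no_irreducible_factors ?_ ?_
  · rintro ⟨h0, h1⟩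
    refine key (X 0) (prime_X 0) fun i => ?_
    fin_cases i
    · change _ ∣ partialDeriv 0 f
      rw [h0]; exact dvd_zero _
    · change _ ∣ partialDeriv 1 f
      rw [h1]; exact dvd_zero _
  · intro p hp h0 h1
    refine key p (prime_of_irreducible hp) fun i => ?_
    fin_cases i
    exacts [h0, h1]

/-! ### Coordinate changes -/

/-- The automorphism that exchanges the coordinates. -/
def swap : ConvSeries ≃ₐ[ℂ] ConvSeries :=
  have h : (sub2 (X 1) (X 0)).comp (sub2 (X 1) (X 0)) = AlgHom.id ℂ _ :=
    algHom_ext2 (by rw [AlgHom.comp_apply, sub2_X0 (evalZero_X 1), sub2_X1 (evalZero_X 0)]; rfl)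
      (by rw [AlgHom.comp_apply, sub2_X1 (evalZero_X 0), sub2_X0 (evalZero_X 1)]; rfl)
  AlgEquiv.ofAlgHom (sub2 (X 1) (X 0)) (sub2 (X 1) (X 0)) h h

@[simp] theorem swap_X0 : swap (X 0) = X 1 := sub2_X0 (evalZero_X 1)

@[simp] theorem swap_X1 : swap (X 1) = X 0 := sub2_X1 (evalZero_X 0)

@[simp] theorem swap_swap (f : ConvSeries) : swap (swap f) = f := swap.apply_symm_apply f

theorem swap_X (b : Fin 2) : swap (X b) = X b.rev := by
  fin_cases b
  exacts [swap_X0, swap_X1]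

theorem swap_axis (b : Fin 2) (f : ConvSeries) : swap (axis b f) = axis b.rev (swap f) := by
  have : (swap : ConvSeries →ₐ[ℂ] ConvSeries).comp (axis b) =
      (axis b.rev).comp (swap : ConvSeries →ₐ[ℂ] ConvSeries) := by
    refine algHom_ext fun i => ?_
    change swap (axis b (X i)) = axis b.rev (swap (X i))
    rw [swap_X]
    by_cases h : b = i
    · subst h
      rw [axis_X_self, axis_X_self, swap_X]
    · rw [axis_X_of_ne h, axis_X_of_ne (fun h' => h (Fin.rev_injective h')), map_zero]
  exact DFunLike.congr_fun this f

theorem swap_powMap (b : Fin 2) {n : ℕ} (hn : 0 < n) (f : ConvSeries) :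
    swap (powMap b n f) = powMap b.rev n (swap f) := by
  have : (swap : ConvSeries →ₐ[ℂ] ConvSeries).comp (powMap b n) =
      (powMap b.rev n).comp (swap : ConvSeries →ₐ[ℂ] ConvSeries) := algHom_ext fun i => by
    change swap (powMap b n (X i)) = powMap b.rev n (swap (X i))
    by_cases h : i = b
    · subst h
      rw [powMap_X_self i hn, map_pow, swap_X, powMap_X_self _ hn]
    · rw [powMap_X_of_ne h, swap_X, powMap_X_of_ne (fun h' => h (Fin.rev_injective h'))]
  exact DFunLike.congr_fun this f

theorem HasAxisOrder.swap {b : Fin 2} {f : ConvSeries} {m : ℕ} (h : HasAxisOrder b f m) :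
    HasAxisOrder b.rev (swap f) m := by
  obtain ⟨w, hw, e⟩ := h
  exact ⟨ConvSeries.swap w, hw.map _, by rw [← swap_axis, e, map_mul, map_pow, swap_X]⟩

theorem HasAxisOrder.pow_mul_of_axis_eq {a : Fin 2} {s : ConvSeries} (hs : axis a s = s) {m : ℕ}
    (h : HasAxisOrder a s m) : ∃ w, IsUnit w ∧ s = X a ^ m * w := by
  obtain ⟨w, hw, e⟩ := h
  exact ⟨w, hw, hs ▸ e⟩

/-- The inverse solves `s(φ(t)) = t`, and the implicit function theorem applies to `s - X 1`.
Exchanging the coordinates makes the solution a series in `X 0`. -/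
theorem exists_compositional_inverse {s : ConvSeries} (hs : axis 0 s = s)
    (h1 : HasAxisOrder 0 s 1) :
    ∃ s', axis 0 s' = s' ∧ HasAxisOrder 0 s' 1 ∧ sub2 s' (X 1) s = X 0 := by
  obtain ⟨φ, h0, hax, h⟩ := exists_implicit (f := s - X 1) (by
    obtain ⟨w, hw, e⟩ := h1
    exact ⟨w, hw, by rw [map_sub, axis_X_of_ne (by decide), sub_zero, e]⟩)
  rw [map_sub, sub2_X1 (evalZero_X 1), sub_eq_zero] at h
  have hax' : axis 0 (swap φ) = swap φ := by
    have := swap_axis 1 φ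
    rw [hax] at this
    exact this.symm
  have h0' : evalZero (swap φ) = 0 := by
    rw [← h0]; exact evalZero_algHom (swap : ConvSeries →ₐ[ℂ] ConvSeries) φ
  have hsub : sub2 (swap φ) (X 1) s = X 0 := by
    have e1 : ∀ q, evalZero q = 0 → sub2 (swap φ) q s = sub2 (swap φ) 0 s := by
      intro q hq
      conv_lhs => rw [← hs]
      rw [sub2_algHom, axis_X_self, axis_X_of_ne (by decide), map_zero, sub2_X0 h0']
    rw [e1 _ (evalZero_X 1), ← e1 (X 0) (evalZero_X 0)]
    have := congrArg (swap : ConvSeries →ₐ[ℂ] ConvSeries) h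
    rw [algHom_sub2 _ h0 (evalZero_X 1)] at this
    simpa using this
  refine ⟨swap φ, hax', ?_, hsub⟩
  obtain ⟨w, hw, e⟩ := h1.pow_mul_of_axis_eq hs
  rw [e, map_mul, pow_one, sub2_X0 h0'] at hsub
  obtain ⟨u, hu⟩ := hw.map (sub2 (swap φ) (X 1))
  rw [← hu] at hsub
  have e2 : swap φ = X 0 * (u⁻¹ : ConvSeriesˣ) := by rw [← hsub, mul_assoc, Units.mul_inv, mul_one]
  refine ⟨axis 0 (u⁻¹ : ConvSeriesˣ), (u⁻¹).isUnit.map _, ?_⟩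
  rw [e2, map_mul, axis_X_self, pow_one]

theorem exists_coordinate_change_zero {s : ConvSeries} (hs : axis 0 s = s)
    (h1 : HasAxisOrder 0 s 1) :
    ∃ ψ : ConvSeries ≃ₐ[ℂ] ConvSeries, ψ (X 0) = s ∧ ψ (X 1) = X 1 := by
  have hz : ∀ {s}, HasAxisOrder 0 s 1 → evalZero s = 0 := fun h => h.pos_iff.mp one_pos
  have key : ∀ {s s' : ConvSeries}, HasAxisOrder 0 s 1 → HasAxisOrder 0 s' 1 →
      sub2 s' (X 1) s = X 0 → (sub2 s' (X 1)).comp (sub2 s (X 1)) = AlgHom.id ℂ _ :=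
    fun h h' e => algHom_ext2 (by rw [AlgHom.comp_apply, sub2_X0 (hz h), e]; rfl)
      (by rw [AlgHom.comp_apply, sub2_X1 (evalZero_X 1), sub2_X1 (evalZero_X 1)]; rfl)
  obtain ⟨s', hs', h1', e'⟩ := exists_compositional_inverse hs h1
  -- Inverting twice: the substitution by `s'` has a right inverse from `s` and a left inverse from
  -- `s''`, which must coincide.
  obtain ⟨s'', hs'', h1'', e''⟩ := exists_compositional_inverse hs' h1'
  have k1 := key h1 h1' e'
  have k2 := key h1' h1'' e''
  have k3 : sub2 s (X 1) = sub2 s'' (X 1) := by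
    calc sub2 s (X 1) = ((sub2 s'' (X 1)).comp (sub2 s' (X 1))).comp (sub2 s (X 1)) := by
          rw [k2]; rfl
      _ = sub2 s'' (X 1) := by rw [AlgHom.comp_assoc, k1]; rfl
  exact ⟨AlgEquiv.ofAlgHom (sub2 s (X 1)) (sub2 s' (X 1)) (by rw [k3, k2]) k1,
    sub2_X0 (hz h1), sub2_X1 (evalZero_X 1)⟩

theorem exists_coordinate_change {a b : Fin 2} (hab : a ≠ b) {s : ConvSeries} (hs : axis a s = s)
    (h1 : HasAxisOrder a s 1) :
    ∃ ψ : ConvSeries ≃ₐ[ℂ] ConvSeries, ψ (X a) = s ∧ ψ (X b) = X b := by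
  have h : a = 0 ∧ b = 1 ∨ a = 1 ∧ b = 0 := by omega
  rcases h with ⟨rfl, rfl⟩ | ⟨rfl, rfl⟩
  · exact exists_coordinate_change_zero hs h1
  · obtain ⟨ψ, h0, h1⟩ := exists_coordinate_change_zero (s := swap s)
      (by have := swap_axis 1 s; rw [hs] at this; exact this.symm) h1.swap
    refine ⟨(swap.trans ψ).trans swap, ?_, ?_⟩
    · rw [AlgEquiv.trans_apply, AlgEquiv.trans_apply, swap_X1, h0, swap_swap]
    · rw [AlgEquiv.trans_apply, AlgEquiv.trans_apply, swap_X0, h1, swap_X1]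

/-! ### Milnor numbers of pull-backs -/

theorem partialDeriv_algHom_of_ne {a b : Fin 2} (hab : a ≠ b) (φ : ConvSeries →ₐ[ℂ] ConvSeries)
    (i : Fin 2) (f : ConvSeries) :
    partialDeriv i (φ f) = φ (partialDeriv a f) * partialDeriv i (φ (X a)) +
      φ (partialDeriv b f) * partialDeriv i (φ (X b)) := by
  have h : a = 0 ∧ b = 1 ∨ a = 1 ∧ b = 0 := by omega
  rcases h with ⟨rfl, rfl⟩ | ⟨rfl, rfl⟩
  · exact partialDeriv_algHom φ i f
  · rw [partialDeriv_algHom, add_comm]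

theorem milnorNumber_eq {a b : Fin 2} (hab : a ≠ b) (f : ConvSeries) :
    milnorNumber f = intersectionNumber (partialDeriv a f) (partialDeriv b f) := by
  have h : a = 0 ∧ b = 1 ∨ a = 1 ∧ b = 0 := by omega
  rcases h with ⟨rfl, rfl⟩ | ⟨rfl, rfl⟩
  · rfl
  · rw [intersectionNumber_comm]; rfl

theorem HasAxisOrder.partialDeriv {a : Fin 2} {f : ConvSeries} {m : ℕ}
    (h : HasAxisOrder a f (m + 1)) : HasAxisOrder a (partialDeriv a f) m := by
  rw [hasAxisOrder_iff] at h ⊢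
  constructor
  · intro i hi
    rw [coeff_partialDeriv, ← Finsupp.single_add, h.1 _ (by omega), zero_mul]
  · rw [coeff_partialDeriv, ← Finsupp.single_add]
    refine mul_ne_zero h.2 (Nat.cast_add_one_ne_zero _)

theorem associated_natCast_mul {n : ℕ} (hn : 0 < n) (f : ConvSeries) :
    Associated ((n : ConvSeries) * f) f := by
  have : IsUnit (n : ConvSeries) := by
    rw [isUnit_iff, map_natCast]; exact_mod_cast hn.ne'
  exact associated_unit_mul_left f _ this

theorem enat_mul_left_cancel {n : ℕ} (hn : 0 < n) {x y : ℕ∞} (h : (n : ℕ∞) * x = n * y) :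
    x = y := by
  have h0 : (n : ℕ∞) ≠ 0 := by exact_mod_cast hn.ne'
  induction x using ENat.recTopCoe with
  | top =>
    induction y using ENat.recTopCoe with
    | top => rfl
    | coe y =>
      rw [ENat.mul_top h0] at h
      exact absurd h.symm (by exact_mod_cast ENat.natCast_ne_top (n * y))
  | coe x =>
    induction y using ENat.recTopCoe with
    | top =>
      rw [ENat.mul_top h0] at h
      exact absurd h (by exact_mod_cast ENat.natCast_ne_top (n * x))
    | coe y =>
      have h' : n * x = n * y := by exact_mod_cast h
      rw [Nat.eq_of_mul_eq_mul_left hn h']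

/-- The pull-back of `X b` is `X b ^ n`, so a factor `n` cancels. -/
theorem intersectionNumber_powMap_X {b : Fin 2} {n : ℕ} (hn : 0 < n) (f : ConvSeries) :
    intersectionNumber (powMap b n f) (X b) = intersectionNumber f (X b) := by
  have := intersectionNumber_powMap b hn f (X b)
  rw [powMap_X_self b hn, intersectionNumber_pow_right] at this
  exact enat_mul_left_cancel hn this

/-- The Milnor number of a pull-back under a cover ramified along `X b = 0`. -/
theorem milnorNumber_pullback_one {a b : Fin 2} (hab : a ≠ b) {n : ℕ} (hn : 0 < n)
    (ψ : ConvSeries ≃ₐ[ℂ] ConvSeries) (hb : ψ (X b) = X b) (ha : axis a (ψ (X a)) = ψ (X a))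
    (ha' : IsUnit (partialDeriv a (ψ (X a)))) (f : ConvSeries) :
    milnorNumber (ψ (powMap b n f)) =
      n * milnorNumber f + (n - 1 : ℕ) * intersectionNumber (partialDeriv a f) (X b) := by
  set φ : ConvSeries →ₐ[ℂ] ConvSeries := (ψ : ConvSeries →ₐ[ℂ] ConvSeries).comp (powMap b n)
  have hφ : ∀ f, ψ (powMap b n f) = φ f := fun _ => rfl
  have hXb : φ (X b) = X b ^ n := by rw [← hφ, powMap_X_self b hn, map_pow, hb]
  have hXa : φ (X a) = ψ (X a) := by rw [← hφ, powMap_X_of_ne hab]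
  -- The derivative in the unramified direction is a pull-back up to a unit; the other one acquires
  -- `X b ^ (n - 1)`. This factor meets the first derivative in the correction term.
  have hda : partialDeriv a (φ f) = φ (partialDeriv a f) * partialDeriv a (ψ (X a)) := by
    rw [partialDeriv_algHom_of_ne hab, hXb, hXa, partialDeriv_pow, partialDeriv_X, if_neg hab]
    ring
  have hdb : partialDeriv b (φ f) = n * (φ (partialDeriv b f) * X b ^ (n - 1)) := by
    rw [partialDeriv_algHom_of_ne hab, hXb, hXa, partialDeriv_pow, partialDeriv_X, if_pos rfl,
      partialDeriv_eq_zero_of_axis_eq hab.symm ha]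
    ring
  have hi : ∀ f g, intersectionNumber (φ f) (φ g) = n * intersectionNumber f g := fun f g => by
    rw [← hφ, ← hφ, intersectionNumber_algEquiv, intersectionNumber_powMap b hn]
  have hX : intersectionNumber (φ (partialDeriv a f)) (X b) =
      intersectionNumber (partialDeriv a f) (X b) := by
    conv_lhs => rw [← hb]
    rw [← hφ, intersectionNumber_algEquiv, intersectionNumber_powMap_X hn]
  rw [hφ, milnorNumber_eq hab, hda, hdb,
    intersectionNumber_congr_of_associated (associated_mul_unit_left _ _ ha'),
    intersectionNumber_congr_right (associated_natCast_mul hn _), intersectionNumber_mul_right,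
    intersectionNumber_pow_right, hi, hX, ← milnorNumber_eq hab]

/-- The Milnor number of a pull-back under the cover ramified along both axes. -/
theorem milnorNumber_pullback_two {n : ℕ} (hn : 0 < n) (f : ConvSeries) :
    milnorNumber (powMap 0 n (powMap 1 n f)) = n * (n * milnorNumber f) +
      (n - 1 : ℕ) * (n * intersectionNumber (partialDeriv 0 f) (X 1)) +
      (n - 1 : ℕ) * (n * intersectionNumber (partialDeriv 1 f) (X 0)) +
      (n - 1 : ℕ) * (n - 1 : ℕ) := by
  set φ : ConvSeries →ₐ[ℂ] ConvSeries := (powMap 0 n).comp (powMap 1 n)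
  have hφ : ∀ f, powMap 0 n (powMap 1 n f) = φ f := fun _ => rfl
  have h01 : (0 : Fin 2) ≠ 1 := by decide
  have hX1 : φ (X 1) = X 1 ^ n := by
    rw [← hφ, powMap_X_self 1 hn, map_pow, powMap_X_of_ne h01.symm]
  have hX0 : φ (X 0) = X 0 ^ n := by rw [← hφ, powMap_X_of_ne h01, powMap_X_self 0 hn]
  -- Both derivatives acquire a ramification factor; the two factors meet each other in the term `(n
  -- - 1) * (n - 1)`.
  have hd0 : partialDeriv 0 (φ f) = n * (φ (partialDeriv 0 f) * X 0 ^ (n - 1)) := by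
    rw [partialDeriv_algHom, hX1, hX0, partialDeriv_pow, partialDeriv_pow, partialDeriv_X,
      partialDeriv_X, if_pos rfl, if_neg h01]
    ring
  have hd1 : partialDeriv 1 (φ f) = n * (φ (partialDeriv 1 f) * X 1 ^ (n - 1)) := by
    rw [partialDeriv_algHom, hX1, hX0, partialDeriv_pow, partialDeriv_pow, partialDeriv_X,
      partialDeriv_X, if_pos rfl, if_neg h01.symm]
    ring
  have hi : ∀ f g, intersectionNumber (φ f) (φ g) = n * (n * intersectionNumber f g) :=
    fun f g => by
      rw [← hφ, ← hφ, intersectionNumber_powMap 0 hn, intersectionNumber_powMap 1 hn]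
  have hiX1 : ∀ f, intersectionNumber (φ f) (X 1) = n * intersectionNumber f (X 1) := fun f => by
    have := hi f (X 1)
    rw [hX1, intersectionNumber_pow_right] at this
    exact enat_mul_left_cancel hn this
  have hiX0 : ∀ f, intersectionNumber (φ f) (X 0) = n * intersectionNumber f (X 0) := fun f => by
    have := hi f (X 0)
    rw [hX0, intersectionNumber_pow_right] at this
    exact enat_mul_left_cancel hn this
  rw [hφ, milnorNumber_eq h01, hd0, hd1,
    intersectionNumber_congr_of_associated (associated_natCast_mul hn _),
    intersectionNumber_congr_right (associated_natCast_mul hn _), intersectionNumber_mul_right,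
    intersectionNumber_mul_left, intersectionNumber_mul_left, intersectionNumber_pow_right,
    intersectionNumber_pow_right, intersectionNumber_pow_left, intersectionNumber_pow_left,
    intersectionNumber_X_X h01, hi, hiX1, intersectionNumber_comm (X 0), hiX0,
    ← milnorNumber_eq h01]
  ring

/-! ### Components -/

/-- The germ `f = 0` is reduced, with `r` irreducible components. -/
def SplitsInto (f : ConvSeries) (r : ℕ) : Prop :=
  ∃ (ι : Type) (_ : Fintype ι) (h : ι → ConvSeries), Fintype.card ι = r ∧
    Associated f (∏ i, h i) ∧ (∀ i, Prime (h i)) ∧ ∀ i j, h i ∣ h j → i = j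

theorem SplitsInto.encard_components {f : ConvSeries} {r : ℕ} (hf : SplitsInto f r) :
    (components f).encard = r := by
  obtain ⟨ι, _, h, rfl, hass, hp, hne⟩ := hf
  have : components f = Set.range fun i => Associates.mk (h i) := by
    ext c
    constructor
    · rintro ⟨g, ⟨hg, hgf⟩, rfl⟩
      have h1 := hgf.trans hass.dvd
      rw [(prime_of_irreducible hg).dvd_finsetProd_iff] at h1
      obtain ⟨i, -, hi⟩ := h1
      exact ⟨i, (Associates.mk_eq_mk_iff_associated.mpr
        (hg.associated_of_dvd (hp i).irreducible hi)).symm⟩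
    · rintro ⟨i, rfl⟩
      exact ⟨h i, ⟨(hp i).irreducible,
        (Finset.dvd_prod_of_mem h (Finset.mem_univ i)).trans hass.symm.dvd⟩, rfl⟩
  rw [this, ← Set.image_univ, Function.Injective.encard_image, Set.encard_univ,
    ENat.card_eq_coe_fintype_card]
  intro i j hij
  exact hne i j (Associates.mk_eq_mk_iff_associated.mp hij).dvd

theorem SplitsInto.map {f : ConvSeries} {r : ℕ} (hf : SplitsInto f r)
    (e : ConvSeries ≃ₐ[ℂ] ConvSeries) : SplitsInto (e f) r := by
  obtain ⟨ι, _, h, hr, hass, hp, hne⟩ := hf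
  refine ⟨ι, _, fun i => e (h i), hr, ?_, fun i => ?_, fun i j hij => ?_⟩
  · rw [← map_prod]; exact hass.map e
  · exact (MulEquiv.prime_iff e.toMulEquiv).mpr (hp i)
  · exact hne i j ((map_dvd_iff e).mp hij)

theorem SplitsInto.congr {f g : ConvSeries} {r : ℕ} (hf : SplitsInto f r)
    (h : Associated g f) : SplitsInto g r := by
  obtain ⟨ι, _, p, hr, hass, hp⟩ := hf
  exact ⟨ι, _, p, hr, h.trans hass, hp⟩

theorem SplitsInto.prod {ι : Type} [Fintype ι] {f : ι → ConvSeries} {r : ℕ}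
    (hf : ∀ i, SplitsInto (f i) r) (hrel : ∀ i j, i ≠ j → IsRelPrime (f i) (f j)) :
    SplitsInto (∏ i, f i) (Fintype.card ι * r) := by
  choose κ hκ h hr hass hp hne using hf
  have hd : ∀ i k, h i k ∣ f i := fun i k =>
    (Finset.dvd_prod_of_mem (h i) (Finset.mem_univ k)).trans (hass i).symm.dvd
  refine ⟨Σ i, κ i, inferInstance, fun x => h x.1 x.2, ?_, ?_, fun x => hp _ _, ?_⟩
  · rw [Fintype.card_sigma]
    simp [hr]
  · rw [Fintype.prod_sigma]
    exact Associated.prod _ _ _ fun i _ => hass i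
  · rintro ⟨i, k⟩ ⟨j, l⟩ hd'
    by_cases hij : i = j
    · subst hij
      rw [hne i k l hd']
    · exact absurd (hrel i j hij (hd i k) (hd'.trans (hd j l))) (hp i k).not_isUnit

/-! ### Orders on the axes and the splitting of pull-backs. -/

theorem HasAxisOrder.powMap_self {b : Fin 2} {n : ℕ} (hn : 0 < n) {f : ConvSeries} {m : ℕ}
    (h : HasAxisOrder b f m) : HasAxisOrder b (powMap b n f) (n * m) := by
  obtain ⟨w, hw, e⟩ := h
  refine ⟨powMap b n w, hw.map _, ?_⟩
  rw [axis_powMap b hn, e, map_mul, map_pow, powMap_X_self b hn, pow_mul]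

theorem HasAxisOrder.of_powMap_self {b : Fin 2} {n : ℕ} (hn : 0 < n) {f : ConvSeries} {m : ℕ}
    (h : HasAxisOrder b (powMap b n f) (n * m)) : HasAxisOrder b f m := by
  obtain ⟨k, hk⟩ := exists_hasAxisOrder (a := b) (f := f) fun h0 => by
    apply h.axis_ne_zero
    rw [axis_powMap b hn, h0, map_zero]
  rwa [← Nat.eq_of_mul_eq_mul_left hn ((hk.powMap_self hn).unique h)]

theorem HasAxisOrder.of_associated {a : Fin 2} {f g : ConvSeries} {m : ℕ}
    (h : HasAxisOrder a f m) (hfg : Associated f g) : HasAxisOrder a g m := by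
  obtain ⟨u, rfl⟩ := hfg
  have h6 : HasAxisOrder a (u : ConvSeries) 0 := ⟨axis a u, u.isUnit.map _, by simp⟩
  exact h.mul h6

theorem HasAxisOrder.prod {ι : Type*} (s : Finset ι) {a : Fin 2} {f : ι → ConvSeries} {m : ℕ}
    (h : ∀ i ∈ s, HasAxisOrder a (f i) m) : HasAxisOrder a (∏ i ∈ s, f i) (s.card * m) := by
  classical
  induction s using Finset.induction_on with
  | empty => exact ⟨1, isUnit_one, by simp⟩
  | insert i s hi ih =>
    rw [Finset.prod_insert hi, Finset.card_insert_of_notMem hi, add_mul, one_mul, add_comm]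
    exact (h i (Finset.mem_insert_self i s)).mul
      (ih fun j hj => h j (Finset.mem_insert_of_mem hj))

theorem isUnit_of_hasAxisOrder_mul {a : Fin 2} {f g : ConvSeries} {m : ℕ}
    (hf : HasAxisOrder a f m) (hfg : HasAxisOrder a (f * g) m) : IsUnit g := by
  obtain ⟨k, hk⟩ := exists_hasAxisOrder (a := a) (f := g) fun h0 => by
    apply hfg.axis_ne_zero
    rw [map_mul, h0, mul_zero]
  have := (hf.mul hk).unique hfg
  rw [isUnit_iff]
  intro h0
  have := hk.pos_iff.mpr h0
  omega

theorem IsParam.eq_of_rot_eq_rot {N : ℕ} {φ : ConvSeries} (h : IsParam N φ) {ζ ξ : ℂ}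
    (hζ : ζ ^ N = 1) (hξ : ξ ^ N = 1) (he : rot 1 ζ φ = rot 1 ξ φ) : ζ = ξ := by
  have hζ0 : ζ ≠ 0 := by
    rintro rfl
    rw [zero_pow h.1.ne'] at hζ
    exact zero_ne_one hζ
  have h1 : rot 1 (ζ⁻¹ * ξ) φ = φ := by
    rw [← rot_rot, ← he, rot_rot, inv_mul_cancel₀ hζ0, rot_one]
  have h2 := h.2.2 _ (by rw [mul_pow, inv_pow, hζ, hξ, inv_one, one_mul]) h1
  rwa [inv_mul_eq_one₀ hζ0] at h2

theorem IsArc.powMap {φ : ConvSeries} (h : IsArc φ) {n : ℕ} (hn : 0 < n) :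
    IsArc (powMap 1 n φ) :=
  ⟨by rw [evalZero_algHom, h.1], by rw [axis_powMap 1 hn, h.2]⟩

theorem hasAxisOrder_graph {φ : ConvSeries} {q : ℕ}
    (hq : HasAxisOrder 1 φ q) : HasAxisOrder 1 (graph φ) q := by
  obtain ⟨w, hw, e⟩ := hq
  refine ⟨-w, hw.neg, ?_⟩
  rw [map_sub, axis_X_of_ne (by decide), e]
  ring

theorem HasAxisOrder.rot {b : Fin 2} {f : ConvSeries} {m : ℕ} (h : HasAxisOrder b f m) {ζ : ℂ}
    (hζ : ζ ≠ 0) : HasAxisOrder b (rot b ζ f) m := by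
  have hc : (axis b).comp (ConvSeries.rot b ζ) = (ConvSeries.rot b ζ).comp (axis b) := by
    refine algHom_ext fun i => ?_
    simp only [AlgHom.comp_apply]
    by_cases hi : i = b
    · subst hi
      rw [rot_X_self, axis_X_self, map_smul, axis_X_self, rot_X_self]
    · rw [rot_X_of_ne hi, axis_X_of_ne (Ne.symm hi), map_zero]
  obtain ⟨w, hw, e⟩ := h
  refine ⟨algebraMap ℂ ConvSeries (ζ ^ m) * ConvSeries.rot b ζ w, ?_, ?_⟩
  · rw [isUnit_iff, map_mul, evalZero_algHom]
    simpa [hζ] using isUnit_iff.mp hw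
  · rw [← AlgHom.comp_apply, hc, AlgHom.comp_apply, e, map_mul, map_pow, rot_X_self, smul_pow,
      Algebra.smul_def]
    ring

/-- The factorization of the pull-back of an irreducible germ under `X 1 ↦ X 1 ^ n`. -/
theorem exists_factorization_powMap {δ : ConvSeries} (hδ : Irreducible δ) {m : ℕ}
    (hm : HasAxisOrder 0 δ m) {n : ℕ} (hn : 0 < n) :
    ∃ h : Fin (n.gcd m) → ConvSeries, Associated (powMap 1 n δ) (∏ i, h i) ∧
      (∀ i, Prime (h i)) ∧ (∀ i j, h i ∣ h j → i = j) ∧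
      ∀ q, HasAxisOrder 1 δ q → ∀ i, HasAxisOrder 1 (h i) (n / n.gcd m * q) := by
  have h01 : (0 : Fin 2) ≠ 1 := by decide
  have hX : ¬ X 1 ∣ δ := fun h => hm.axis_ne_zero ((axis_eq_zero_iff h01).mpr h)
  obtain ⟨N, ψ, hψ, hdvd, hprime, hN, hass⟩ := exists_param_of_irreducible hδ hX
  obtain rfl := hm.unique hN
  have hm0 := hψ.1
  have hζ := Complex.isPrimitiveRoot_exp m hm0.ne'
  generalize Complex.exp _ = ζ at hζ
  have hζ0 : ζ ≠ 0 := hζ.ne_zero hm0.ne'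
  set e := n.gcd m with he
  have he0 : 0 < e := Nat.gcd_pos_of_pos_left m hn
  obtain ⟨n', hn'⟩ : e ∣ n := Nat.gcd_dvd_left n m
  obtain ⟨m', hm'⟩ : e ∣ m := Nat.gcd_dvd_right n m
  have hn'0 : 0 < n' := Nat.pos_of_mul_pos_left (hn' ▸ hn)
  have hm'0 : 0 < m' := Nat.pos_of_mul_pos_left (hm' ▸ hm0)
  have hcop : n'.Coprime m' := by
    have h1 := Nat.coprime_div_gcd_div_gcd (m := n) (n := m) (he ▸ he0)
    rw [← he] at h1
    rwa [hn', hm', Nat.mul_div_cancel_left _ he0, Nat.mul_div_cancel_left _ he0] at h1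
  have hω : IsPrimitiveRoot (ζ ^ e) m' := hζ.pow hm0 hm'
  have hpow1 : ∀ i, (ζ ^ i) ^ m = 1 := fun i => by
    rw [← pow_mul, mul_comm, pow_mul, hζ.pow_eq_one, one_pow]
  -- With `n = e * n'` and `m = e * m'`, the arc `(ψ(ζ ^ a * t ^ n'), t ^ m')` lies on the
  -- pull-back, because `(t ^ m') ^ n = (ζ ^ a * t ^ n') ^ m`. It is primitive because `n'` and `m'`
  -- are coprime.
  let θ : ℕ → ConvSeries := fun a => powMap 1 n' (rot 1 (ζ ^ a) ψ)
  have hθ : ∀ a, IsParam m' (θ a) := by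
    intro a
    refine ⟨hm'0, (hψ.2.1.rot _).powMap hn'0, fun ξ hξ hr => ?_⟩
    simp only [θ] at hr
    rw [rot_powMap 1 hn'0] at hr
    have h1 := powMap_injective 1 hn'0 hr
    rw [rot_rot] at h1
    have hξm : (ξ ^ n') ^ m = 1 := by
      rw [hm', ← pow_mul, show n' * (e * m') = m' * (n' * e) by ring, pow_mul, hξ, one_pow]
    have h2 := hψ.eq_of_rot_eq_rot (by rw [mul_pow, hξm, hpow1, one_mul]) (hpow1 a) h1
    have h3 : ξ ^ n' = 1 := by
      rwa [mul_eq_right₀ (pow_ne_zero _ hζ0)] at h2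
    exact orderOf_eq_one_iff.mp (Nat.eq_one_of_dvd_coprimes hcop
      (orderOf_dvd_of_pow_eq_one h3) (orderOf_dvd_of_pow_eq_one hξ))
  choose h hh hhd hhp hho using fun a => (hθ a).exists_norm hω
  have hdist : ∀ a < e, ∀ a' < e, h a ∣ h a' → a = a' := by
    intro a ha a' ha' hd
    have h1 : graph (θ a) ∣ powMap 1 m' (h a) := by
      rw [hh]
      have := Finset.dvd_prod_of_mem (fun j => graph (rot 1 ((ζ ^ e) ^ j) (θ a)))
        (Finset.mem_range.mpr hm'0)
      simpa only [pow_zero, rot_one] using this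
    have h2 := h1.trans (map_dvd (powMap 1 m') hd)
    rw [hh, (prime_graph (hθ a).2.1).dvd_finsetProd_iff] at h2
    obtain ⟨b, -, hb⟩ := h2
    have h3 := eq_of_graph_dvd_graph (hθ a).2.1 ((hθ a').2.1.rot _) hb
    simp only [θ] at h3
    rw [rot_powMap 1 hn'0] at h3
    have h4 := powMap_injective 1 hn'0 h3
    rw [rot_rot] at h4
    have h5 : (ζ ^ e) ^ b = ζ ^ (e * b) := (pow_mul _ _ _).symm
    rw [h5, ← pow_mul, ← pow_add] at h4
    have h6 := hψ.eq_of_rot_eq_rot (hpow1 _) (hpow1 _) h4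
    -- Raising to the power `m'` removes the factor coming from a rotation of the parameter, since
    -- `e * m' = m`. The exponents left are below `m`, so they agree.
    have h7 : ζ ^ (a * m') = ζ ^ (a' * m') := by
      rw [pow_mul, h6, ← pow_mul, add_mul, show e * b * n' * m' = m * (b * n') by rw [hm']; ring,
        pow_add, pow_mul, hζ.pow_eq_one, one_pow, one_mul]
    have h8 := hζ.pow_inj (by rw [hm']; exact Nat.mul_lt_mul_of_pos_right ha hm'0)
      (by rw [hm']; exact Nat.mul_lt_mul_of_pos_right ha' hm'0) h7
    exact Nat.eq_of_mul_eq_mul_right hm'0 h8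
  have hdiv : ∀ a, h a ∣ powMap 1 n δ := by
    intro a
    rw [hhd, sub2_algHom, powMap_X_of_ne h01, powMap_X_self 1 hn, sub2_X0 (hθ a).2.1.1, map_pow,
      sub2_X1 (by simp [hm'0.ne']), ← pow_mul]
    have h1 := congrArg ((powMap 1 n').comp (rot 1 (ζ ^ a))) ((hdvd δ).mp dvd_rfl)
    rw [algHom_sub2 _ hψ.2.1.1 (by simp [hm0.ne']), map_zero, AlgHom.comp_apply,
      AlgHom.comp_apply, map_pow, rot_X_self, smul_pow, hpow1, one_smul, map_pow,
      powMap_X_self 1 hn'0, ← pow_mul] at h1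
    rwa [show m' * n = n' * m by rw [hn', hm']; ring]
  refine ⟨fun a => h a, ?_, fun a => hhp a, fun a a' hd => Fin.ext (hdist a a.2 a' a'.2 hd),
    fun q hq a => ?_⟩
  -- The `e` factors have order `m'` each on the axis `X 1 = 0`, which exhausts `m = e * m'`; the
  -- cofactor is a unit.
  · obtain ⟨u, hu⟩ : ∏ a : Fin e, h a ∣ powMap 1 n δ :=
      prod_dvd_of_prime _ (fun a _ => hhp a)
        (fun a _ a' _ hd => Fin.ext (hdist a a.2 a' a'.2 hd)) (fun a _ => hdiv a)
    have h1 : HasAxisOrder 0 (∏ a : Fin e, h a) m := by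
      have := HasAxisOrder.prod Finset.univ (a := 0) (f := fun a : Fin e => h a) (m := m')
        (fun a _ => hho a)
      rwa [Finset.card_univ, Fintype.card_fin, ← hm'] at this
    have h2 : IsUnit u := isUnit_of_hasAxisOrder_mul h1
      (by rw [← hu]; exact (HasAxisOrder.powMap_of_ne h01 hn).mpr hm)
    rw [hu]
    exact associated_mul_unit_left _ _ h2
  · have hψ0 : axis 1 ψ ≠ 0 := by
      rw [hψ.2.1.2]
      rintro rfl
      apply hq.axis_ne_zero
      rw [axis_eq_zero_iff h01.symm]
      refine (hδ.dvd_symm (prime_X 0).irreducible ?_)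
      rw [hdvd, sub2_X0 (map_zero _)]
    obtain ⟨q', hq'⟩ := exists_hasAxisOrder hψ0
    -- Compared after `t ↦ t ^ m`, which multiplies orders on the axis `X 0 = 0` by `m` and turns
    -- `δ` into `m` graphs of order `q'`.
    have hqq : q = q' := by
      refine hq.unique (HasAxisOrder.of_powMap_self hm0 ?_)
      refine HasAxisOrder.of_associated ?_ (hass ζ hζ).symm
      have := HasAxisOrder.prod (Finset.range m) (a := 1) (m := q')
        (f := fun j => graph (rot 1 (ζ ^ j) ψ))
        (fun j _ => hasAxisOrder_graph (hq'.rot (pow_ne_zero _ hζ0)))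
      rwa [Finset.card_range] at this
    subst hqq
    have hnq : n / e * q = n' * q := by rw [hn', Nat.mul_div_cancel_left _ he0]
    rw [hnq]
    refine HasAxisOrder.of_powMap_self hm'0 ?_
    rw [hh]
    have := HasAxisOrder.prod (Finset.range m') (a := 1) (m := n' * q)
      (f := fun j => graph (rot 1 ((ζ ^ e) ^ j) (θ a)))
      (fun j _ => hasAxisOrder_graph
        (((hq'.rot (pow_ne_zero _ hζ0)).powMap_self hn'0).rot
          (pow_ne_zero _ (pow_ne_zero _ hζ0))))
    rwa [Finset.card_range] at this

theorem splitsInto_powMap {a b : Fin 2} (hab : a ≠ b) {δ : ConvSeries} (hδ : Irreducible δ) {m : ℕ}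
    (hm : HasAxisOrder a δ m) {n : ℕ} (hn : 0 < n) : SplitsInto (powMap b n δ) (n.gcd m) := by
  have key : ∀ {δ : ConvSeries}, Irreducible δ → HasAxisOrder 0 δ m →
      SplitsInto (powMap 1 n δ) (n.gcd m) := fun hδ hm => by
    obtain ⟨h, h1, h2, h3, -⟩ := exists_factorization_powMap hδ hm hn
    exact ⟨_, _, h, Fintype.card_fin _, h1, h2, h3⟩
  have h : a = 0 ∧ b = 1 ∨ a = 1 ∧ b = 0 := by omega
  rcases h with ⟨rfl, rfl⟩ | ⟨rfl, rfl⟩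
  · exact key hδ hm
  · have h1 : Irreducible (swap δ) := (MulEquiv.irreducible_iff swap.toMulEquiv).mpr hδ
    have h2 := (key h1 hm.swap).map swap
    rw [swap_powMap 1 hn, swap_swap] at h2
    exact h2

/-- With `e = gcd(n, m)`, the first power map yields `e` components of order `n / e * q` on the
other axis. The second splits each into `gcd(n, n / e * q)`, and `e * gcd(n, n / e * q) = gcd(e * n,
n * q) = n * gcd(n, m, q)`. Distinct components keep relatively prime pull-backs because their
intersection numbers stay finite. -/
theorem splitsInto_powMap_powMap {δ : ConvSeries} (hδ : Irreducible δ) {m q : ℕ}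
    (hm : HasAxisOrder 0 δ m) (hq : HasAxisOrder 1 δ q) {n : ℕ} (hn : 0 < n) :
    SplitsInto (powMap 0 n (powMap 1 n δ)) (n * n.gcd (m.gcd q)) := by
  obtain ⟨h, h1, h2, h3, h4⟩ := exists_factorization_powMap hδ hm hn
  have h5 := SplitsInto.prod (f := fun i => powMap 0 n (h i))
    (fun i => splitsInto_powMap (show (1 : Fin 2) ≠ 0 by decide) (h2 i).irreducible (h4 q hq i) hn)
    (fun i j hij => by
      rw [← intersectionNumber_ne_top_iff, intersectionNumber_powMap 0 hn]
      refine WithTop.mul_ne_top (ENat.natCast_ne_top n)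
        (intersectionNumber_ne_top_of_prime (h2 i) fun hd => hij (h3 i j hd)))
  have h6 : n.gcd m * n.gcd (n / n.gcd m * q) = n * n.gcd (m.gcd q) := by
    rw [← Nat.gcd_mul_left, ← mul_assoc, Nat.mul_div_cancel' (Nat.gcd_dvd_left n m), mul_comm _ n,
      Nat.gcd_mul_left, Nat.gcd_assoc]
  rw [Fintype.card_fin, h6, ← map_prod] at h5
  exact h5.congr (h1.map (powMap 0 n))

/-! ### Rotations permuting the components. -/

theorem rot_comm (ζ ξ : ℂ) (f : ConvSeries) : rot 0 ζ (rot 1 ξ f) = rot 1 ξ (rot 0 ζ f) := by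
  have h01 : (0 : Fin 2) ≠ 1 := by decide
  have : (rot 0 ζ).comp (rot 1 ξ) = (rot 1 ξ).comp (rot 0 ζ) := by
    refine algHom_ext2 ?_ ?_ <;> simp only [AlgHom.comp_apply]
    · rw [rot_X_of_ne h01, rot_X_self, map_smul, rot_X_of_ne h01]
    · rw [rot_X_of_ne h01.symm, rot_X_self, map_smul, rot_X_of_ne h01.symm]
  exact DFunLike.congr_fun this f

theorem rot_one_powMap_zero (ξ : ℂ) {n : ℕ} (hn : 0 < n) (f : ConvSeries) :
    rot 1 ξ (powMap 0 n f) = powMap 0 n (rot 1 ξ f) := by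
  have h01 : (0 : Fin 2) ≠ 1 := by decide
  have : (rot 1 ξ).comp (powMap 0 n) = (powMap 0 n).comp (rot 1 ξ) := by
    refine algHom_ext2 ?_ ?_ <;> simp only [AlgHom.comp_apply]
    · rw [rot_X_of_ne h01, powMap_X_self 0 hn, map_pow, rot_X_of_ne h01]
    · rw [powMap_X_of_ne h01.symm, rot_X_self, map_smul, powMap_X_of_ne h01.symm]
  exact DFunLike.congr_fun this f

theorem prod_range_rot {b : Fin 2} {n : ℕ} {ζ : ℂ} (hζ : ζ ^ n = 1) (f : ConvSeries) :
    rot b ζ (∏ i ∈ Finset.range n, rot b (ζ ^ i) f) = ∏ i ∈ Finset.range n, rot b (ζ ^ i) f := by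
  simp only [map_prod, rot_rot, ← pow_succ']
  obtain rfl | ⟨m, rfl⟩ : n = 0 ∨ ∃ m, n = m + 1 := by
    rcases n with _ | m
    exacts [Or.inl rfl, Or.inr ⟨m, rfl⟩]
  · simp only [Finset.range_zero, Finset.prod_empty]
  · rw [Finset.prod_range_succ, hζ, Finset.prod_range_succ' (fun i => rot b (ζ ^ i) f), pow_zero]

/-- The components of the pull-back of an irreducible germ under the cover ramified along both
axes are analytically isomorphic. -/
theorem analyticallyIsomorphic_of_isBranch {δ g g' : ConvSeries} (hδ : Irreducible δ) {n : ℕ}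
    (hn : 0 < n) (hg : IsBranch g (powMap 0 n (powMap 1 n δ)))
    (hg' : IsBranch g' (powMap 0 n (powMap 1 n δ))) : AnalyticallyIsomorphic g g' := by
  have hζ := Complex.isPrimitiveRoot_exp n hn.ne'
  generalize Complex.exp _ = ζ at hζ
  have hζ0 : ζ ≠ 0 := hζ.ne_zero hn.ne'
  -- `B` is the product of all rotates of `g` in both coordinates; being invariant, it descends to a
  -- germ `h`.
  set A := ∏ j ∈ Finset.range n, rot 1 (ζ ^ j) g with hA
  set B := ∏ i ∈ Finset.range n, rot 0 (ζ ^ i) A with hB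
  obtain ⟨B', hB'⟩ := exists_powMap_eq_of_rot_eq 0 hn hζ (prod_range_rot hζ.pow_eq_one A)
  have hinv : rot 1 ζ B = B := by
    rw [hB, map_prod]
    refine Finset.prod_congr rfl fun i _ => ?_
    rw [← rot_comm, hA, prod_range_rot hζ.pow_eq_one]
  obtain ⟨h, hh⟩ := exists_powMap_eq_of_rot_eq 1 hn hζ (f := B') (by
    apply powMap_injective 0 hn
    rw [← rot_one_powMap_zero _ hn, hB', hinv])
  have hBh : powMap 0 n (powMap 1 n h) = B := by rw [hh, hB']
  have hgB : g ∣ B := by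
    have h1 : g ∣ A := by
      have := Finset.dvd_prod_of_mem (fun j => rot 1 (ζ ^ j) g) (Finset.mem_range.mpr hn)
      simpa using this
    have := Finset.dvd_prod_of_mem (fun j => rot 0 (ζ ^ j) A) (Finset.mem_range.mpr hn)
    exact h1.trans (by simpa using this)
  -- Otherwise `δ` and `h` would meet with finite multiplicity, although their pull-backs share the
  -- factor `g`. Hence `g'` divides `B` and is one of the rotates of `g`.
  have hdvd : δ ∣ h := by
    by_contra hd
    have h1 := intersectionNumber_ne_top_of_prime (prime_of_irreducible hδ) hd
    have h2 := intersectionNumber_eq_top hg.1.not_isUnit hg.2 hgB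
    rw [← hBh, intersectionNumber_powMap 0 hn, intersectionNumber_powMap 1 hn] at h2
    exact WithTop.mul_ne_top (ENat.natCast_ne_top n)
      (WithTop.mul_ne_top (ENat.natCast_ne_top n) h1) h2
  have h1 : g' ∣ B := hg'.2.trans (hBh ▸ map_dvd (powMap 0 n) (map_dvd (powMap 1 n) hdvd))
  have hp' := prime_of_irreducible hg'.1
  rw [hB, hp'.dvd_finsetProd_iff] at h1
  obtain ⟨i, -, hi⟩ := h1
  rw [hA, map_prod, hp'.dvd_finsetProd_iff] at hi
  obtain ⟨j, -, hj⟩ := hi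
  let ξ := Units.mk0 ζ hζ0
  let e := (rotEquiv 1 (ξ ^ j)).trans (rotEquiv 0 (ξ ^ i))
  have he : e g = rot 0 (ζ ^ i) (rot 1 (ζ ^ j) g) := by
    simp [e, ξ]
  refine ⟨e, ?_⟩
  have hirr : Irreducible (e g) := (MulEquiv.irreducible_iff e.toMulEquiv).mpr hg.1
  rw [← he] at hj
  exact (hg'.1.associated_of_dvd hirr hj).symm

/-! ### Local invariants under the ramified covers -/

theorem evalZero_of_irreducible {δ : ConvSeries} (h : Irreducible δ) : evalZero δ = 0 := by
  by_contra h0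
  exact h.not_isUnit (isUnit_iff.mpr h0)

/-- Differentiation along the axis lowers the order by exactly one; `m` is positive because the germ
passes through the origin, so the truncated subtraction is exact. -/
theorem intersectionNumber_partialDeriv_X {a b : Fin 2} (hab : a ≠ b) {f : ConvSeries} {m : ℕ}
    (hf : evalZero f = 0) (hm : HasAxisOrder a f m) :
    1 ≤ m ∧ intersectionNumber (partialDeriv a f) (X b) = (m - 1 : ℕ) := by
  have h0 := hm.pos_iff.mpr hf
  obtain ⟨k, rfl⟩ : ∃ k, m = k + 1 := ⟨m - 1, by omega⟩
  exact ⟨h0, intersectionNumber_X hab hm.partialDeriv⟩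

theorem exists_milnorNumber_pullback_one {a b : Fin 2} (hab : a ≠ b) {n : ℕ} (hn : 0 < n)
    (ψ : ConvSeries ≃ₐ[ℂ] ConvSeries) (hb : ψ (X b) = X b) (ha : axis a (ψ (X a)) = ψ (X a))
    (ha' : IsUnit (partialDeriv a (ψ (X a)))) {f : ConvSeries} (hf : Squarefree f)
    (hf0 : evalZero f = 0) {m : ℕ} (hm : HasAxisOrder a f m) :
    ∃ μP μQ : ℕ, milnorNumber f = μP ∧ milnorNumber (ψ (powMap b n f)) = μQ ∧
      (μQ : ℤ) = n * μP + (m - 1) * (n - 1) := by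
  obtain ⟨h1, h2⟩ := intersectionNumber_partialDeriv_X hab hf0 hm
  obtain ⟨μ, hμ⟩ := ENat.ne_top_iff_exists.mp (milnorNumber_ne_top hf hf0)
  refine ⟨μ, n * μ + (n - 1) * (m - 1), hμ.symm, ?_, ?_⟩
  · rw [milnorNumber_pullback_one hab hn ψ hb ha ha', h2, ← hμ]
    push_cast
    rfl
  · push_cast [Nat.cast_sub h1, Nat.cast_sub (show 1 ≤ n from hn)]
    ring

theorem exists_milnorNumber_pullback_two {n : ℕ} (hn : 0 < n) {f : ConvSeries} (hf : Squarefree f)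
    (hf0 : evalZero f = 0) {m q : ℕ} (hm : HasAxisOrder 0 f m) (hq : HasAxisOrder 1 f q) :
    ∃ μP μQ : ℕ, milnorNumber f = μP ∧ milnorNumber (powMap 0 n (powMap 1 n f)) = μQ ∧
      (μQ : ℤ) = n ^ 2 * μP + (n - 1) * (n * (m + q - 1) - 1) := by
  obtain ⟨h1, h2⟩ := intersectionNumber_partialDeriv_X (by decide : (0 : Fin 2) ≠ 1) hf0 hm
  obtain ⟨h3, h4⟩ := intersectionNumber_partialDeriv_X (by decide : (1 : Fin 2) ≠ 0) hf0 hq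
  obtain ⟨μ, hμ⟩ := ENat.ne_top_iff_exists.mp (milnorNumber_ne_top hf hf0)
  refine ⟨μ, n * (n * μ) + (n - 1) * (n * (m - 1)) + (n - 1) * (n * (q - 1)) +
    (n - 1) * (n - 1), hμ.symm, ?_, ?_⟩
  · rw [milnorNumber_pullback_two hn, h2, h4, ← hμ]
    push_cast
    rfl
  · push_cast [Nat.cast_sub h1, Nat.cast_sub h3, Nat.cast_sub (show 1 ≤ n from hn)]
    ring

theorem intersectionNumber_ne_top_of_irreducible {δ δ' : ConvSeries} (hδ : Irreducible δ)
    (hδ' : Irreducible δ') (h : ¬ Associated δ δ') : intersectionNumber δ δ' ≠ ⊤ :=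
  intersectionNumber_ne_top_of_prime (prime_of_irreducible hδ) fun hd =>
    h (hδ.associated_of_dvd hδ' hd)

/-- The behaviour of the local invariants of `f`, a reduced germ without the component
`X b = 0`, under a pull-back ramified along `X b = 0`. -/
theorem pullback_one {a b : Fin 2} (hab : a ≠ b) {n : ℕ} (hn : 0 < n)
    (ψ : ConvSeries ≃ₐ[ℂ] ConvSeries) (hb : ψ (X b) = X b) (ha : axis a (ψ (X a)) = ψ (X a))
    (ha' : IsUnit (partialDeriv a (ψ (X a)))) (φ : ConvSeries →ₐ[ℂ] ConvSeries)
    (hφ : ∀ f, φ f = ψ (powMap b n f)) {f : ConvSeries} (hf : Squarefree f)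
    (hf0 : evalZero f = 0) (hX : ¬ X b ∣ f) :
    (∃ μP μQ m : ℕ, milnorNumber f = μP ∧ milnorNumber (φ f) = μQ ∧
      intersectionNumber f (X b) = m ∧ (μQ : ℤ) = n * μP + (m - 1) * (n - 1)) ∧
    (∀ δ : ConvSeries, IsBranch δ f → ∃ μP μQ m : ℕ, milnorNumber δ = μP ∧
      milnorNumber (φ δ) = μQ ∧ intersectionNumber δ (X b) = m ∧
      (μQ : ℤ) = n * μP + (m - 1) * (n - 1) ∧
      (components (φ δ)).encard = (Nat.gcd n m : ℕ∞)) ∧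
    (∀ δ δ' : ConvSeries, IsBranch δ f → IsBranch δ' f → ¬ Associated δ δ' →
      ∃ iP iQ : ℕ, intersectionNumber δ δ' = iP ∧ intersectionNumber (φ δ) (φ δ') = iQ ∧
        iQ = n * iP) := by
  simp only [hφ]
  refine ⟨?_, fun δ hδ => ?_, fun δ δ' hδ hδ' h => ?_⟩
  · obtain ⟨m, hm⟩ := exists_hasAxisOrder_of_not_dvd hab hX
    obtain ⟨μP, μQ, h1, h2, h3⟩ := exists_milnorNumber_pullback_one hab hn ψ hb ha ha' hf hf0 hm
    exact ⟨μP, μQ, m, h1, h2, intersectionNumber_X hab hm, h3⟩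
  · obtain ⟨m, hm⟩ := exists_hasAxisOrder_of_not_dvd hab fun h => hX (h.trans hδ.2)
    obtain ⟨μP, μQ, h1, h2, h3⟩ := exists_milnorNumber_pullback_one hab hn ψ hb ha ha'
      hδ.1.squarefree (evalZero_of_irreducible hδ.1) hm
    exact ⟨μP, μQ, m, h1, h2, intersectionNumber_X hab hm, h3,
      ((splitsInto_powMap hab hδ.1 hm hn).map ψ).encard_components⟩
  · obtain ⟨i, hi⟩ := ENat.ne_top_iff_exists.mp
      (intersectionNumber_ne_top_of_irreducible hδ.1 hδ'.1 h)
    refine ⟨i, n * i, hi.symm, ?_, rfl⟩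
    rw [intersectionNumber_algEquiv, intersectionNumber_powMap b hn, ← hi]
    push_cast
    rfl

theorem HasAxisOrder.powMap_zero_powMap_one {n : ℕ} (hn : 0 < n) {f : ConvSeries} {a : Fin 2}
    {m : ℕ} (h : HasAxisOrder a f m) : HasAxisOrder a (powMap 0 n (powMap 1 n f)) (n * m) := by
  have h01 : (0 : Fin 2) ≠ 1 := by decide
  obtain rfl | rfl : a = 0 ∨ a = 1 := by omega
  · exact ((HasAxisOrder.powMap_of_ne h01 hn).mpr h).powMap_self hn
  · exact (HasAxisOrder.powMap_of_ne h01.symm hn).mpr (h.powMap_self hn)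

/-- The behaviour of the local invariants of `f`, a reduced germ without components on the
coordinate axes, under the pull-back ramified along both axes. -/
theorem pullback_two {n : ℕ} (hn : 0 < n) (φ : ConvSeries →ₐ[ℂ] ConvSeries)
    (hφ : ∀ f, φ f = powMap 0 n (powMap 1 n f)) {f : ConvSeries} (hf : Squarefree f)
    (hf0 : evalZero f = 0) (hX : ∀ i, ¬ X i ∣ f) {a b : Fin 2} (hab : a ≠ b) :
    (∃ μP μQ m₁ m₂ : ℕ, milnorNumber f = μP ∧ milnorNumber (φ f) = μQ ∧
      intersectionNumber f (X a) = m₁ ∧ intersectionNumber f (X b) = m₂ ∧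
      (μQ : ℤ) = n ^ 2 * μP + (n - 1) * (n * (m₁ + m₂ - 1) - 1)) ∧
    (∀ δ : ConvSeries, IsBranch δ f → ∃ μP μQ m₁ m₂ : ℕ, milnorNumber δ = μP ∧
      milnorNumber (φ δ) = μQ ∧ intersectionNumber δ (X a) = m₁ ∧
      intersectionNumber δ (X b) = m₂ ∧
      (μQ : ℤ) = n ^ 2 * μP + (n - 1) * (n * (m₁ + m₂ - 1) - 1) ∧
      intersectionNumber (φ δ) (X a) = ((n * m₁ : ℕ) : ℕ∞) ∧
      intersectionNumber (φ δ) (X b) = ((n * m₂ : ℕ) : ℕ∞) ∧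
      (components (φ δ)).encard = ((n * Nat.gcd n (Nat.gcd m₁ m₂) : ℕ) : ℕ∞) ∧
      ∀ g g' : ConvSeries, IsBranch g (φ δ) → IsBranch g' (φ δ) → AnalyticallyIsomorphic g g') ∧
    (∀ δ δ' : ConvSeries, IsBranch δ f → IsBranch δ' f → ¬ Associated δ δ' →
      ∃ iP iQ : ℕ, intersectionNumber δ δ' = iP ∧ intersectionNumber (φ δ) (φ δ') = iQ ∧
        iQ = n ^ 2 * iP) := by
  simp only [hφ]
  -- The order on the axis with coordinate `X a` is the intersection number with `X b`, so `q` takes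
  -- the place of `m₁` and `m` that of `m₂`.
  have key : ∀ {f : ConvSeries}, Squarefree f → evalZero f = 0 → ∀ {m q : ℕ},
      HasAxisOrder a f m → HasAxisOrder b f q →
      ∃ μP μQ : ℕ, milnorNumber f = μP ∧ milnorNumber (powMap 0 n (powMap 1 n f)) = μQ ∧
      (μQ : ℤ) = n ^ 2 * μP + (n - 1) * (n * (q + m - 1) - 1) := by
    intro f hf hf0 m q hm hq
    have h : a = 0 ∧ b = 1 ∨ a = 1 ∧ b = 0 := by omega
    rcases h with ⟨rfl, rfl⟩ | ⟨rfl, rfl⟩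
    · rw [add_comm (q : ℤ)]
      exact exists_milnorNumber_pullback_two hn hf hf0 hm hq
    · exact exists_milnorNumber_pullback_two hn hf hf0 hq hm
  refine ⟨?_, fun δ hδ => ?_, fun δ δ' hδ hδ' h => ?_⟩
  · obtain ⟨m, hm⟩ := exists_hasAxisOrder_of_not_dvd hab (hX b)
    obtain ⟨q, hq⟩ := exists_hasAxisOrder_of_not_dvd hab.symm (hX a)
    obtain ⟨μP, μQ, h1, h2, h3⟩ := key hf hf0 hm hq
    exact ⟨μP, μQ, q, m, h1, h2, intersectionNumber_X hab.symm hq, intersectionNumber_X hab hm, h3⟩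
  · obtain ⟨m, hm⟩ := exists_hasAxisOrder_of_not_dvd hab fun h => hX b (h.trans hδ.2)
    obtain ⟨q, hq⟩ := exists_hasAxisOrder_of_not_dvd hab.symm fun h => hX a (h.trans hδ.2)
    obtain ⟨μP, μQ, h1, h2, h3⟩ := key hδ.1.squarefree (evalZero_of_irreducible hδ.1) hm hq
    refine ⟨μP, μQ, q, m, h1, h2, intersectionNumber_X hab.symm hq, intersectionNumber_X hab hm, h3,
      intersectionNumber_X hab.symm (hq.powMap_zero_powMap_one hn),
      intersectionNumber_X hab (hm.powMap_zero_powMap_one hn), ?_,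
      fun g g' hg hg' => analyticallyIsomorphic_of_isBranch hδ.1 hn hg hg'⟩
    have h : a = 0 ∧ b = 1 ∨ a = 1 ∧ b = 0 := by omega
    rcases h with ⟨rfl, rfl⟩ | ⟨rfl, rfl⟩
    · rw [Nat.gcd_comm q]
      exact (splitsInto_powMap_powMap hδ.1 hm hq hn).encard_components
    · exact (splitsInto_powMap_powMap hδ.1 hq hm hn).encard_components
  · obtain ⟨i, hi⟩ := ENat.ne_top_iff_exists.mp
      (intersectionNumber_ne_top_of_irreducible hδ.1 hδ'.1 h)
    refine ⟨i, n ^ 2 * i, hi.symm, ?_, rfl⟩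
    rw [intersectionNumber_powMap 0 hn, intersectionNumber_powMap 1 hn, ← hi]
    push_cast
    ring

end ConvSeries

/-! ### Squarefree polynomials -/

section Gauss

open Polynomial nonZeroDivisors

variable {D : Type*} [CommRing D] [IsDomain D] [UniqueFactorizationMonoid D]

/-- Gauss's lemma: the square of a factor over the fraction field can be replaced by the square of a
primitive polynomial over `D`, and the cofactor then has coefficients in `D`. -/
theorem squarefree_map_of_squarefree (K : Type*) [Field K] [Algebra D K] [IsFractionRing D K]
    {f : D[X]} (hf : Squarefree f) : Squarefree (f.map (algebraMap D K)) := by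
  classical
  let _ : NormalizedGCDMonoid D := Nonempty.some inferInstance
  intro q hq
  have hf0 : f.map (algebraMap D K) ≠ 0 :=
    (Polynomial.map_ne_zero_iff (IsFractionRing.injective D K)).mpr hf.ne_zero
  have hq0 : q ≠ 0 := by
    rintro rfl
    exact hf0 (by simpa using hq)
  obtain ⟨b, hb, e⟩ := IsLocalization.integerNormalization_spec D⁰ q
  set r := IsLocalization.integerNormalization D⁰ q
  have hr : r.primPart.map (algebraMap D K) ∣ q := by
    have hu : IsUnit (C (algebraMap D K b)) := by
      rw [isUnit_C, isUnit_iff_ne_zero]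
      exact IsFractionRing.to_map_ne_zero_of_mem_nonZeroDivisors hb
    have h1 : r.map (algebraMap D K) = C (algebraMap D K b) * q := by
      rw [e, Algebra.smul_def, Polynomial.algebraMap_apply]
    rw [← hu.dvd_mul_left, ← h1]
    exact Polynomial.map_dvd _ r.primPart_dvd
  obtain ⟨g, hg⟩ := (mul_dvd_mul hr hr).trans hq
  rw [← Polynomial.map_mul] at hg
  have hlift := (IsPrimitive.map_mul_mem_lifts_iff
    (r.isPrimitive_primPart.mul r.isPrimitive_primPart)).mp
    (hg ▸ (⟨f, rfl⟩ : f.map (algebraMap D K) ∈ lifts (algebraMap D K)))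
  obtain ⟨g', rfl⟩ := hlift
  have h2 : f = r.primPart * r.primPart * g' :=
    Polynomial.map_injective _ (IsFractionRing.injective D K)
      (by rw [Polynomial.map_mul, hg]; rfl)
  exact isUnit_or_eq_zero_of_isUnit_integerNormalization_primPart hq0
    (hf _ (Dvd.intro _ h2.symm))

/-- A squarefree polynomial over a factorial domain of characteristic zero and its derivative
generate an ideal that contains a nonzero constant. -/
theorem exists_mul_add_mul_derivative_eq_C [CharZero D] {f : D[X]} (hf : Squarefree f) :
    ∃ A B : D[X], ∃ c : D, c ≠ 0 ∧ A * f + B * derivative f = C c := by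
  have : CharZero (FractionRing D) :=
    charZero_of_injective_algebraMap (IsFractionRing.injective D (FractionRing D))
  -- Over the fraction field squarefree means separable; clearing denominators in the Bézout
  -- relation leaves the constant `a * b`.
  obtain ⟨A, B, hAB⟩ := PerfectField.separable_iff_squarefree.mpr
    (squarefree_map_of_squarefree (FractionRing D) hf)
  obtain ⟨a, ha, hA⟩ := IsLocalization.integerNormalization_spec D⁰ A
  obtain ⟨b, hb, hB⟩ := IsLocalization.integerNormalization_spec D⁰ B
  refine ⟨C b * IsLocalization.integerNormalization D⁰ A,
    C a * IsLocalization.integerNormalization D⁰ B, a * b,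
    mul_ne_zero (nonZeroDivisors.ne_zero ha) (nonZeroDivisors.ne_zero hb),
    Polynomial.map_injective _ (IsFractionRing.injective D (FractionRing D)) ?_⟩
  rw [derivative_map] at hAB
  simp only [Polynomial.map_add, Polynomial.map_mul, Polynomial.map_C, hA, hB, Algebra.smul_def,
    Polynomial.algebraMap_apply, map_mul]
  linear_combination C ((algebraMap D (FractionRing D)) a) *
    C ((algebraMap D (FractionRing D)) b) * hAB

end Gauss

open MvPolynomial in
/-- Polynomials in three variables as polynomials in the variable `X j`. -/
def splitVariable (j : Fin 3) :
    MvPolynomial (Fin 3) ℂ ≃ₐ[ℂ] Polynomial (MvPolynomial (Fin 2) ℂ) :=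
  AlgEquiv.ofAlgHom
    (aeval (j.insertNth (α := fun _ => Polynomial (MvPolynomial (Fin 2) ℂ)) Polynomial.X
      fun i => Polynomial.C (X i)))
    (Polynomial.eval₂AlgHom (rename j.succAbove) (X j) fun _ => Commute.all _ _)
    (by
      apply Polynomial.algHom_ext'
      · ext i : 1
        simp [Polynomial.CAlgHom]
      · simp)
    (by
      ext i : 1
      induction i using Fin.succAboveCases j with
      | _ => simp)

theorem splitVariable_X_self (j : Fin 3) : splitVariable j (MvPolynomial.X j) = Polynomial.X := by
  simp [splitVariable]

theorem splitVariable_X_succAbove (j : Fin 3) (i : Fin 2) :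
    splitVariable j (MvPolynomial.X (j.succAbove i)) = Polynomial.C (MvPolynomial.X i) := by
  simp [splitVariable]

theorem splitVariable_symm_C (j : Fin 3) (c : MvPolynomial (Fin 2) ℂ) :
    (splitVariable j).symm (Polynomial.C c) = MvPolynomial.rename j.succAbove c := by
  simp [splitVariable]

theorem derivative_algHom_of_X {j : Fin 3}
    (e : MvPolynomial (Fin 3) ℂ →ₐ[ℂ] Polynomial (MvPolynomial (Fin 2) ℂ))
    (he : ∀ i, Polynomial.derivative (e (MvPolynomial.X i)) = e (MvPolynomial.pderiv j
      (MvPolynomial.X i))) (F : MvPolynomial (Fin 3) ℂ) :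
    Polynomial.derivative (e F) = e (MvPolynomial.pderiv j F) := by
  induction F using MvPolynomial.induction_on with
  | C a =>
    rw [MvPolynomial.pderiv_C, map_zero, ← MvPolynomial.algebraMap_eq, AlgHom.commutes,
      IsScalarTower.algebraMap_apply ℂ (MvPolynomial (Fin 2) ℂ), Polynomial.algebraMap_eq,
      Polynomial.derivative_C]
  | add p q hp hq => rw [map_add, map_add, map_add, map_add, hp, hq]
  | mul_X p i hp =>
    rw [map_mul, Polynomial.derivative_mul, hp, MvPolynomial.pderiv_mul, map_add, map_mul, map_mul,
      he]

theorem derivative_splitVariable (j : Fin 3) (F : MvPolynomial (Fin 3) ℂ) :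
    Polynomial.derivative (splitVariable j F) = splitVariable j (MvPolynomial.pderiv j F) := by
  refine derivative_algHom_of_X (splitVariable j).toAlgHom (fun i => ?_) F
  change Polynomial.derivative (splitVariable j _) = splitVariable j _
  obtain rfl | ⟨i, rfl⟩ := Fin.eq_self_or_eq_succAbove j i
  · rw [splitVariable_X_self, Polynomial.derivative_X, MvPolynomial.pderiv_X_self, map_one]
  · rw [splitVariable_X_succAbove, Polynomial.derivative_C,
      MvPolynomial.pderiv_X_of_ne (Fin.succAbove_ne j i), map_zero]

/-- The right-hand side is a nonzero polynomial free of `X j`, in the manner of a discriminant. A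
repeated local factor of `F` must divide it. -/
theorem exists_mul_add_mul_pderiv_eq_rename {F : MvPolynomial (Fin 3) ℂ} (hF : Squarefree F)
    (j : Fin 3) : ∃ A B : MvPolynomial (Fin 3) ℂ, ∃ c : MvPolynomial (Fin 2) ℂ, c ≠ 0 ∧
      A * F + B * MvPolynomial.pderiv j F = MvPolynomial.rename j.succAbove c := by
  have h1 : Squarefree (splitVariable j F) := by
    intro x hx
    have h2 := map_dvd (splitVariable j).symm hx
    rw [map_mul, AlgEquiv.symm_apply_apply] at h2
    have h3 := (hF _ h2).map (splitVariable j)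
    rwa [AlgEquiv.apply_symm_apply] at h3
  obtain ⟨A, B, c, hc, e⟩ := exists_mul_add_mul_derivative_eq_C h1
  refine ⟨(splitVariable j).symm A, (splitVariable j).symm B, c, hc, ?_⟩
  rw [← splitVariable_symm_C, ← e, derivative_splitVariable]
  simp

namespace ConvSeries

/-! ### Local equations -/

/-- Polynomials as convergent power series. -/
def ofPoly : MvPolynomial (Fin 2) ℂ →ₐ[ℂ] ConvSeries :=
  AlgHom.codRestrict (MvPolynomial.coeToMvPowerSeries.algHom ℂ) ConvSeries fun p => by
    have := isConvergent_coe p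
    simpa using! this

theorem ofPoly_val (p : MvPolynomial (Fin 2) ℂ) :
    (ofPoly p).1 = (p : MvPowerSeries (Fin 2) ℂ) := by
  simp [ofPoly]

theorem ofPoly_injective : Function.Injective ofPoly := fun p q h => by
  have := congrArg Subtype.val h
  rwa [ofPoly_val, ofPoly_val, MvPolynomial.coe_inj] at this

theorem ofPoly_X (i : Fin 2) : ofPoly (MvPolynomial.X i) = X i :=
  Subtype.ext ((ofPoly_val _).trans (MvPolynomial.coe_X i))

/-- The substitution `X k ↦ t`, with the other two variables replaced by `t (u i + c i)`. -/
def germ (k : Fin 3) (t : ℂ) (c : Fin 2 → ℂ) : MvPolynomial (Fin 3) ℂ →ₐ[ℂ] ConvSeries :=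
  MvPolynomial.aeval (k.insertNth (α := fun _ => ConvSeries) (algebraMap ℂ ConvSeries t)
    fun i => algebraMap ℂ ConvSeries t * (X i + algebraMap ℂ ConvSeries (c i)))

theorem germ_X_self (k : Fin 3) (t : ℂ) (c : Fin 2 → ℂ) :
    germ k t c (MvPolynomial.X k) = algebraMap ℂ ConvSeries t := by
  simp [germ]

theorem germ_X_succAbove (k : Fin 3) (t : ℂ) (c : Fin 2 → ℂ) (i : Fin 2) :
    germ k t c (MvPolynomial.X (k.succAbove i)) =
      algebraMap ℂ ConvSeries t * (X i + algebraMap ℂ ConvSeries (c i)) := by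
  simp [germ]

theorem localEq_eq (k : Fin 3) (P : Plane) (G : MvPolynomial (Fin 3) ℂ) :
    localEq k P G = germ k 1 (affineCoord k P) G := by
  have h : localEq k P G = ofPoly (localPolynomial k P G) := Subtype.ext (ofPoly_val _).symm
  rw [h, localPolynomial, ← AlgHom.comp_apply]
  congr 1
  apply MvPolynomial.algHom_ext
  intro j
  rw [AlgHom.comp_apply, MvPolynomial.aeval_X]
  obtain rfl | ⟨i, rfl⟩ := Fin.eq_self_or_eq_succAbove k j
  · rw [germ_X_self, Fin.insertNth_apply_same, map_one, map_one]
  · rw [germ_X_succAbove, Fin.insertNth_apply_succAbove, map_add, ofPoly_X, map_one, one_mul,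
      ← MvPolynomial.algebraMap_eq, AlgHom.commutes]

theorem evalZero_germ (k : Fin 3) (t : ℂ) (c : Fin 2 → ℂ) (G : MvPolynomial (Fin 3) ℂ) :
    evalZero (germ k t c G) =
      MvPolynomial.eval (k.insertNth (α := fun _ => ℂ) t fun i => t * c i) G := by
  rw [← MvPolynomial.coe_aeval_eq_eval, ← AlgHom.comp_apply, RingHom.coe_coe]
  refine DFunLike.congr_fun (MvPolynomial.algHom_ext (f := evalZero.comp (germ k t c))
    fun j => ?_) G
  rw [AlgHom.comp_apply, MvPolynomial.aeval_X]
  obtain rfl | ⟨i, rfl⟩ := Fin.eq_self_or_eq_succAbove k j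
  · rw [germ_X_self, Fin.insertNth_apply_same, AlgHom.commutes, Algebra.algebraMap_self_apply]
  · rw [germ_X_succAbove, Fin.insertNth_apply_succAbove, map_mul, map_add, evalZero_X,
      AlgHom.commutes, AlgHom.commutes, Algebra.algebraMap_self_apply, Algebra.algebraMap_self_apply,
      zero_add]

/-- A polynomial that is not homogeneous may vanish identically on `X k = 1`, which is why `germ`
carries the parameter `t`. The value `t` is taken from a point where `X k * G` does not vanish. -/
theorem exists_germ_ne_zero (k : Fin 3) (c : Fin 2 → ℂ) {G : MvPolynomial (Fin 3) ℂ} (hG : G ≠ 0) :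
    ∃ t : ℂ, t ≠ 0 ∧ germ k t c G ≠ 0 := by
  have h : MvPolynomial.X k * G ≠ 0 := mul_ne_zero (MvPolynomial.X_ne_zero k) hG
  obtain ⟨v, hv⟩ : ∃ v, MvPolynomial.eval v (MvPolynomial.X k * G) ≠ 0 := by
    by_contra! h'
    exact h (MvPolynomial.funext fun v => by rw [h', map_zero])
  rw [map_mul, MvPolynomial.eval_X] at hv
  have ht := left_ne_zero_of_mul hv
  refine ⟨v k, ht, fun h0 => right_ne_zero_of_mul hv ?_⟩
  have h1 : ∀ G, germ k (v k) c G = ofPoly (MvPolynomial.aeval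
      (k.insertNth (α := fun _ => MvPolynomial (Fin 2) ℂ) (MvPolynomial.C (v k))
        fun i => MvPolynomial.C (v k) * (MvPolynomial.X i + MvPolynomial.C (c i))) G) := by
    refine fun G => DFunLike.congr_fun (g := ofPoly.comp (MvPolynomial.aeval _))
      (MvPolynomial.algHom_ext fun j => ?_) G
    rw [AlgHom.comp_apply, MvPolynomial.aeval_X]
    obtain rfl | ⟨i, rfl⟩ := Fin.eq_self_or_eq_succAbove k j
    · rw [germ_X_self, Fin.insertNth_apply_same, ← MvPolynomial.algebraMap_eq, AlgHom.commutes]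
    · rw [germ_X_succAbove, Fin.insertNth_apply_succAbove, map_mul, map_add, ofPoly_X,
        ← MvPolynomial.algebraMap_eq, AlgHom.commutes, AlgHom.commutes]
  rw [h1, ← map_zero ofPoly] at h0
  have h2 := congrArg (MvPolynomial.aeval (R := ℂ) fun i => v (k.succAbove i) / v k - c i)
    (ofPoly_injective h0)
  rw [map_zero, ← AlgHom.comp_apply] at h2
  rw [← h2, ← MvPolynomial.coe_aeval_eq_eval, RingHom.coe_coe]
  refine DFunLike.congr_fun (MvPolynomial.algHom_ext fun j => ?_) G
  rw [AlgHom.comp_apply, MvPolynomial.aeval_X, MvPolynomial.aeval_X]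
  obtain rfl | ⟨i, rfl⟩ := Fin.eq_self_or_eq_succAbove k j
  · rw [Fin.insertNth_apply_same]
    simp
  · rw [Fin.insertNth_apply_succAbove]
    simp only [map_mul, map_add, MvPolynomial.aeval_C, MvPolynomial.aeval_X,
      Algebra.algebraMap_self_apply, sub_add_cancel]
    field_simp

theorem _root_.MvPolynomial.IsHomogeneous.aeval_mul {σ A : Type*} [Fintype σ] [CommRing A]
    [Algebra ℂ A] {F : MvPolynomial σ ℂ} {d : ℕ} (hF : F.IsHomogeneous d) (r : A) (g : σ → A) :
    MvPolynomial.aeval (fun i => r * g i) F = r ^ d * MvPolynomial.aeval g F := by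
  rw [MvPolynomial.aeval_def, MvPolynomial.aeval_def, MvPolynomial.eval₂_eq',
    MvPolynomial.eval₂_eq', Finset.mul_sum]
  refine Finset.sum_congr rfl fun m hm => ?_
  have h : m.degree = d := by
    rw [Finsupp.degree_eq_weight_one]
    exact hF (MvPolynomial.mem_support_iff.mp hm)
  rw [Finsupp.degree_eq_sum] at h
  simp only [mul_pow, Finset.prod_mul_distrib, Finset.prod_pow_eq_pow_sum, h]
  ring

theorem germ_of_isHomogeneous {F : MvPolynomial (Fin 3) ℂ} {d : ℕ} (hF : F.IsHomogeneous d)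
    (k : Fin 3) (t : ℂ) (c : Fin 2 → ℂ) :
    germ k t c F = algebraMap ℂ ConvSeries t ^ d * germ k 1 c F := by
  rw [germ, germ, ← hF.aeval_mul]
  congr 2
  funext j
  obtain rfl | ⟨i, rfl⟩ := Fin.eq_self_or_eq_succAbove k j <;> simp

theorem germ_ne_zero {F : MvPolynomial (Fin 3) ℂ} {d : ℕ} (hF : F.IsHomogeneous d) (h0 : F ≠ 0)
    (k : Fin 3) (c : Fin 2 → ℂ) : germ k 1 c F ≠ 0 := by
  obtain ⟨t, -, ht⟩ := exists_germ_ne_zero k c h0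
  rw [germ_of_isHomogeneous hF] at ht
  exact right_ne_zero_of_mul ht

/-- Restricting the germ to the axis amounts to setting the corresponding variable of `F` to zero.
The result is homogeneous and nonzero, so its germ is nonzero. -/
theorem not_X_dvd_germ {F : MvPolynomial (Fin 3) ℂ} {d : ℕ} (hF : F.IsHomogeneous d) (k : Fin 3)
    {c : Fin 2 → ℂ} {b : Fin 2} (hb : c b = 0) (h : ¬ MvPolynomial.X (k.succAbove b) ∣ F) :
    ¬ X b ∣ germ k 1 c F := by
  obtain ⟨a, hab⟩ : ∃ a, a ≠ b := exists_ne b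
  set κ : MvPolynomial (Fin 3) ℂ →ₐ[ℂ] MvPolynomial (Fin 3) ℂ :=
    MvPolynomial.aeval (Function.update MvPolynomial.X (k.succAbove b) 0) with hκ
  have hκb : κ (MvPolynomial.X (k.succAbove b)) = 0 := by simp [hκ]
  have hκ' : ∀ j, j ≠ k.succAbove b → κ (MvPolynomial.X j) = MvPolynomial.X j := fun j hj => by
    simp [hκ, hj]
  have h1 : (axis a).comp (germ k 1 c) = (germ k 1 c).comp κ := by
    apply MvPolynomial.algHom_ext
    intro j
    rw [AlgHom.comp_apply, AlgHom.comp_apply]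
    obtain rfl | ⟨i, rfl⟩ := Fin.eq_self_or_eq_succAbove k j
    · rw [hκ' j (Fin.succAbove_ne j b).symm, germ_X_self, AlgHom.commutes]
    · by_cases hi : i = b
      · subst hi
        rw [hκb, germ_X_succAbove, hb, map_mul, map_add, axis_X_of_ne hab, AlgHom.commutes,
          AlgHom.commutes, map_zero, map_zero, add_zero, mul_zero]
      · obtain rfl : i = a := by omega
        rw [hκ' _ (fun e => hi (Fin.succAbove_right_injective e)), germ_X_succAbove, map_mul,
          map_add, axis_X_self, AlgHom.commutes, AlgHom.commutes]
  have h2 : (Ideal.Quotient.mkₐ ℂ (Ideal.span {MvPolynomial.X (k.succAbove b)})).comp κ =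
      Ideal.Quotient.mkₐ ℂ (Ideal.span {MvPolynomial.X (k.succAbove b)}) := by
    apply MvPolynomial.algHom_ext
    intro j
    rw [AlgHom.comp_apply]
    by_cases hj : j = k.succAbove b
    · subst hj
      rw [hκb, map_zero, eq_comm]
      exact Ideal.Quotient.eq_zero_iff_mem.mpr (Ideal.mem_span_singleton_self _)
    · rw [hκ' j hj]
  have h3 : κ F ≠ 0 := fun h0 => h <| by
    have h4 := DFunLike.congr_fun h2 F
    rw [AlgHom.comp_apply, h0, map_zero, eq_comm] at h4
    exact Ideal.mem_span_singleton.mp (Ideal.Quotient.eq_zero_iff_mem.mp h4)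
  have h5 : (κ F).IsHomogeneous d := by
    have := hF.aeval (n := 1) (Function.update (MvPolynomial.X : Fin 3 → MvPolynomial (Fin 3) ℂ)
      (k.succAbove b) 0) fun j => by
      by_cases hj : j = k.succAbove b
      · subst hj
        rw [Function.update_self]
        exact MvPolynomial.isHomogeneous_zero _ _ _
      · rw [Function.update_of_ne hj]
        exact MvPolynomial.isHomogeneous_X _ _
    rwa [one_mul] at this
  rw [← axis_eq_zero_iff hab, ← AlgHom.comp_apply, h1]
  exact germ_ne_zero h5 h3 k c

/-! ### Local equations of reduced curves are reduced. -/

theorem partialDeriv_germ (k : Fin 3) (t : ℂ) (c : Fin 2 → ℂ) (b : Fin 2)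
    (F : MvPolynomial (Fin 3) ℂ) : partialDeriv b (germ k t c F) =
      algebraMap ℂ ConvSeries t * germ k t c (MvPolynomial.pderiv (k.succAbove b) F) := by
  induction F using MvPolynomial.induction_on with
  | C x =>
    rw [MvPolynomial.pderiv_C, map_zero, mul_zero, ← MvPolynomial.algebraMap_eq, AlgHom.commutes,
      partialDeriv_C]
  | add p q hp hq => rw [map_add, map_add, map_add, partialDeriv_add, hp, hq, mul_add]
  | mul_X p j hp =>
    have hj : partialDeriv b (germ k t c (MvPolynomial.X j)) = algebraMap ℂ ConvSeries t *
        germ k t c (MvPolynomial.pderiv (k.succAbove b) (MvPolynomial.X j)) := by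
      obtain rfl | ⟨i, rfl⟩ := Fin.eq_self_or_eq_succAbove k j
      · rw [germ_X_self, partialDeriv_C, MvPolynomial.pderiv_X_of_ne (Fin.succAbove_ne j b).symm,
          map_zero, mul_zero]
      · rw [germ_X_succAbove, partialDeriv_mul, partialDeriv_add, partialDeriv_C, partialDeriv_C,
          partialDeriv_X]
        by_cases hi : b = i
        · subst hi
          rw [if_pos rfl, MvPolynomial.pderiv_X_self, map_one]
          ring
        · rw [if_neg hi, MvPolynomial.pderiv_X_of_ne
            (fun e => hi (Fin.succAbove_right_injective e).symm), map_zero]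
          ring
    rw [map_mul, partialDeriv_mul, hp, hj, MvPolynomial.pderiv_mul, map_add, map_mul, map_mul]
    ring

/-- A repeated factor divides the germs of `F` and of its derivative, hence by the Bézout relation
that of a polynomial free of the variable of index `b`. For a suitable `t` that germ is a power of
`X a` times a unit. -/
theorem exists_dvd_X_pow {F : MvPolynomial (Fin 3) ℂ} {d : ℕ} (hF : F.IsHomogeneous d)
    (hred : Squarefree F) (k : Fin 3) (c : Fin 2 → ℂ) {x : ConvSeries}
    (hx : x * x ∣ germ k 1 c F) {a b : Fin 2} (hab : a ≠ b) : ∃ m, x ∣ X a ^ m := by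
  obtain ⟨A, B, c₀, hc₀, e⟩ := exists_mul_add_mul_pderiv_eq_rename hred (k.succAbove b)
  obtain ⟨t, ht, hs⟩ := exists_germ_ne_zero k c (G := MvPolynomial.rename (k.succAbove b).succAbove c₀)
    fun h => hc₀ (MvPolynomial.rename_injective _ Fin.succAbove_right_injective
      (h.trans (map_zero _).symm))
  have hax : axis a (germ k t c (MvPolynomial.rename (k.succAbove b).succAbove c₀)) =
      germ k t c (MvPolynomial.rename (k.succAbove b).succAbove c₀) := by
    simp only [← AlgHom.comp_apply]
    refine DFunLike.congr_fun (MvPolynomial.algHom_ext fun j => ?_) c₀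
    simp only [AlgHom.comp_apply, MvPolynomial.rename_X]
    generalize hl : (k.succAbove b).succAbove j = l
    have hlb : l ≠ k.succAbove b := hl ▸ Fin.succAbove_ne _ _
    obtain rfl | ⟨i, rfl⟩ := Fin.eq_self_or_eq_succAbove k l
    · rw [germ_X_self, AlgHom.commutes]
    · obtain rfl : i = a := by
        have : i ≠ b := fun h => hlb (h ▸ rfl)
        omega
      rw [germ_X_succAbove, map_mul, map_add, axis_X_self, AlgHom.commutes, AlgHom.commutes]
  have h1 : x * x ∣ germ k t c F := by
    rw [germ_of_isHomogeneous hF]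
    exact hx.mul_left _
  have h2 : x ∣ germ k t c (MvPolynomial.pderiv (k.succAbove b) F) := by
    have hu : IsUnit (algebraMap ℂ ConvSeries t) := (isUnit_iff_ne_zero.mpr ht).map _
    rw [← hu.dvd_mul_left, ← partialDeriv_germ]
    obtain ⟨g, hg⟩ := h1
    rw [hg, partialDeriv_mul, partialDeriv_mul]
    exact ⟨partialDeriv b x * g + partialDeriv b x * g + x * partialDeriv b g, by ring⟩
  obtain ⟨m, w, hw, hm⟩ := exists_hasAxisOrder (a := a) (hax ▸ hs)
  refine ⟨m, ?_⟩
  have h3 := dvd_add (((dvd_mul_right x x).trans h1).mul_left (germ k t c A))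
    (h2.mul_left (germ k t c B))
  rw [← map_mul, ← map_mul, ← map_add, e, ← hax, hm] at h3
  exact hw.dvd_mul_right.mp h3

/-- Eliminating each of the two variables in turn, a repeated factor divides a power of `X 0` and a
power of `X 1`, so it is a unit. -/
theorem squarefree_germ {F : MvPolynomial (Fin 3) ℂ} {d : ℕ} (hF : F.IsHomogeneous d)
    (hred : Squarefree F) (k : Fin 3) (c : Fin 2 → ℂ) : Squarefree (germ k 1 c F) := by
  intro x hx
  have h01 : (0 : Fin 2) ≠ 1 := by decide
  obtain ⟨m, hm⟩ := exists_dvd_X_pow hF hred k c hx h01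
  obtain ⟨q, hq⟩ := exists_dvd_X_pow hF hred k c hx h01.symm
  have h : IsRelPrime (X 0) (X 1) := by
    rw [← intersectionNumber_ne_top_iff, intersectionNumber_X_X h01]
    exact ENat.one_ne_top
  exact h.pow hm hq

theorem pullback_X (n : ℕ) (k : Fin 3) (Q : Plane) (i : Fin 2) :
    pullback n k Q (X i) = (X i + algebraMap ℂ ConvSeries (affineCoord k Q i)) ^ n -
      algebraMap ℂ ConvSeries (affineCoord k Q i ^ n) := by
  have h : pullback n k Q (X i) = ofPoly (kummerLocal n k Q i) := by
    refine Subtype.ext (Eq.trans ?_ (ofPoly_val _).symm)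
    exact MvPowerSeries.substAlgHom_X
      (MvPowerSeries.hasSubst_of_constantCoeff_zero (constantCoeff_kummerLocal n k Q)) i
  rw [h, kummerLocal, map_sub, map_pow, map_add, ofPoly_X, ← MvPolynomial.algebraMap_eq,
    AlgHom.commutes, AlgHom.commutes]

end ConvSeries

open ConvSeries

theorem exists_rep_kummerMap (n : ℕ) (Q : Plane) :
    ∃ a : ℂ, a ≠ 0 ∧ (kummerMap n Q).rep = a • Q.rep ^ n := by
  obtain ⟨a, ha⟩ := Projectivization.exists_smul_eq_mk_rep ℂ (Q.rep ^ n)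
    (pow_ne_zero_of_ne_zero n Q.rep_nonzero)
  exact ⟨a, a.ne_zero, ha.symm⟩

theorem affineCoord_kummerMap (n : ℕ) (k : Fin 3) (Q : Plane) (i : Fin 2) :
    affineCoord k (kummerMap n Q) i = affineCoord k Q i ^ n := by
  obtain ⟨a, ha, e⟩ := exists_rep_kummerMap n Q
  simp only [affineCoord, e, Pi.smul_apply, Pi.pow_apply, smul_eq_mul, div_pow]
  rw [mul_div_mul_left _ _ ha]

theorem pullback_localEq (n : ℕ) (k : Fin 3) (Q : Plane) (F : MvPolynomial (Fin 3) ℂ) :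
    pullback n k Q (localEq k (kummerMap n Q) F) = localEq k Q (kummerTransform n F) := by
  rw [localEq_eq, localEq_eq, kummerTransform, ← AlgHom.comp_apply, ← AlgHom.comp_apply]
  refine DFunLike.congr_fun (MvPolynomial.algHom_ext fun j => ?_) F
  rw [AlgHom.comp_apply, AlgHom.comp_apply, MvPolynomial.expand_X, map_pow]
  obtain rfl | ⟨i, rfl⟩ := Fin.eq_self_or_eq_succAbove k j
  · rw [germ_X_self, germ_X_self, AlgHom.commutes, ← map_pow, one_pow]
  · rw [germ_X_succAbove, germ_X_succAbove, map_mul, map_add, pullback_X, AlgHom.commutes,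
      AlgHom.commutes, affineCoord_kummerMap, sub_add_cancel, map_one, one_mul, one_mul]

theorem localEq_X {k : Fin 3} {P : Plane} {i : Fin 2} (h : affineCoord k P i = 0) :
    localEq k P (MvPolynomial.X (k.succAbove i)) = X i := by
  rw [localEq_eq, germ_X_succAbove, h, map_one, map_zero, one_mul, add_zero]

theorem evalZero_localEq {F : MvPolynomial (Fin 3) ℂ} {d : ℕ} (hF : F.IsHomogeneous d) {P : Plane}
    (hP : OnCurve F P) {k : Fin 3} (hk : P.rep k ≠ 0) : evalZero (localEq k P F) = 0 := by
  have h1 := evalZero_germ k (P.rep k) (affineCoord k P) F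
  have h2 : (k.insertNth (α := fun _ => ℂ) (P.rep k) fun i => P.rep k * affineCoord k P i) =
      P.rep := by
    funext j
    obtain rfl | ⟨i, rfl⟩ := Fin.eq_self_or_eq_succAbove k j
    · rw [Fin.insertNth_apply_same]
    · rw [Fin.insertNth_apply_succAbove, affineCoord, mul_div_cancel₀ _ hk]
  rw [h2, hP, germ_of_isHomogeneous hF, map_mul, map_pow, AlgHom.commutes, ← localEq_eq] at h1
  exact (mul_eq_zero.mp h1).resolve_left (pow_ne_zero _ hk)

theorem onCurve_kummerMap {F : MvPolynomial (Fin 3) ℂ} {d : ℕ} (hF : F.IsHomogeneous d) {n : ℕ}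
    {Q : Plane} (hQ : OnCurve (kummerTransform n F) Q) : OnCurve F (kummerMap n Q) := by
  obtain ⟨a, ha, e⟩ := exists_rep_kummerMap n Q
  have h1 : MvPolynomial.eval (Q.rep ^ n) F = 0 := by
    rw [OnCurve, kummerTransform, MvPolynomial.eval_expand] at hQ
    exact hQ
  have h2 := hF.aeval_mul a (Q.rep ^ n)
  rw [MvPolynomial.aeval_eq_eval, MvPolynomial.aeval_eq_eval] at h2
  rw [OnCurve, e]
  exact h2.trans (by rw [h1, mul_zero])

/-! ### The Kummer cover in local coordinates -/

/-- In the direction `a` the cover is `u ↦ (u + c) ^ n - c ^ n` with derivative `n * c ^ (n - 1) ≠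
0` at the origin, hence a change of coordinate. Only the direction `b` is ramified. -/
theorem exists_pullback_eq {n : ℕ} (hn : 0 < n) {k : Fin 3} {Q : Plane} {a b : Fin 2} (hab : a ≠ b)
    (hb : affineCoord k Q b = 0) (ha : affineCoord k Q a ≠ 0) :
    ∃ ψ : ConvSeries ≃ₐ[ℂ] ConvSeries, ψ (X b) = X b ∧ axis a (ψ (X a)) = ψ (X a) ∧
      IsUnit (partialDeriv a (ψ (X a))) ∧ ∀ f, pullback n k Q f = ψ (powMap b n f) := by
  set c := affineCoord k Q a with hc
  set s : ConvSeries := (X a + algebraMap ℂ ConvSeries c) ^ n - algebraMap ℂ ConvSeries (c ^ n)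
    with hs
  have h1 : axis a s = s := by
    rw [hs, map_sub, map_pow, map_add, axis_X_self, AlgHom.commutes, AlgHom.commutes]
  have h2 : partialDeriv a s = n * (X a + algebraMap ℂ ConvSeries c) ^ (n - 1) := by
    have h : s = (X a + algebraMap ℂ ConvSeries c) ^ n + algebraMap ℂ ConvSeries (-c ^ n) := by
      rw [hs, map_neg, sub_eq_add_neg]
    rw [h, partialDeriv_add, partialDeriv_C, partialDeriv_pow, partialDeriv_add, partialDeriv_X,
      partialDeriv_C, if_pos rfl]
    ring
  have h3 : evalZero (partialDeriv a s) ≠ 0 := by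
    rw [h2, map_mul, map_pow, map_add, evalZero_X, AlgHom.commutes, map_natCast, zero_add]
    exact mul_ne_zero (Nat.cast_ne_zero.mpr hn.ne') (pow_ne_zero _ ha)
  obtain ⟨g, hg⟩ : X a ∣ s := by
    have := sub_dvd_pow_sub_pow (X a + algebraMap ℂ ConvSeries c) (algebraMap ℂ ConvSeries c) n
    rwa [add_sub_cancel_right, ← map_pow] at this
  have h4 : IsUnit g := by
    rw [hg, partialDeriv_mul, partialDeriv_X, if_pos rfl] at h3
    rw [isUnit_iff]
    simpa using h3
  have h5 : HasAxisOrder a s 1 :=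
    ⟨axis a g, h4.map _, by rw [hg, map_mul, axis_X_self, pow_one, mul_comm]⟩
  obtain ⟨ψ, hψa, hψb⟩ := exists_coordinate_change hab h1 h5
  refine ⟨ψ, hψb, by rw [hψa, h1], by rwa [hψa, isUnit_iff], fun f => ?_⟩
  refine DFunLike.congr_fun (f := pullback n k Q)
    (g := (ψ : ConvSeries →ₐ[ℂ] ConvSeries).comp (powMap b n)) (algHom_ext fun i => ?_) f
  rw [pullback_X]
  change _ = ψ (powMap b n (X i))
  by_cases hi : i = b
  · subst hi
    rw [powMap_X_self i hn, hb, zero_pow hn.ne', map_zero, add_zero, sub_zero, map_pow, hψb]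
  · obtain rfl : i = a := by omega
    rw [powMap_X_of_ne hi, hψa]

theorem pullback_eq_powMap_powMap {n : ℕ} (hn : 0 < n) {k : Fin 3} {Q : Plane}
    (h : ∀ i, affineCoord k Q i = 0) (f : ConvSeries) :
    pullback n k Q f = powMap 0 n (powMap 1 n f) := by
  have h01 : (0 : Fin 2) ≠ 1 := by decide
  have h1 : ∀ i, pullback n k Q (X i) = X i ^ n := fun i => by
    rw [pullback_X, h, zero_pow hn.ne', map_zero, add_zero, sub_zero]
  refine DFunLike.congr_fun (f := pullback n k Q) (g := (powMap 0 n).comp (powMap 1 n))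
    (algHom_ext2 ?_ ?_) f <;> rw [AlgHom.comp_apply, h1]
  · rw [powMap_X_of_ne h01, powMap_X_self 0 hn]
  · rw [powMap_X_self 1 hn, map_pow, powMap_X_of_ne h01.symm]

/-! ### Points of the projective plane -/

theorem ncard_onAxis {P : Plane} {l : ℕ} (h : HasType P l) :
    {j | OnAxis P j}.ncard + (l + 1) = 3 := by
  have h1 : {j | OnAxis P j} = {j : Fin 3 | P.rep j ≠ 0}ᶜ := by
    ext j
    simp [OnAxis]
  rw [h1, ← h, add_comm, Set.ncard_add_ncard_compl, Nat.card_fin]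

theorem existsUnique_onAxis {P : Plane} (h : HasType P 1) : ∃! j, OnAxis P j := by
  obtain ⟨j, hj⟩ := Set.ncard_eq_one.mp (show {j | OnAxis P j}.ncard = 1 by
    have := ncard_onAxis h
    omega)
  exact ⟨j, show j ∈ {j | OnAxis P j} from hj ▸ rfl, fun i hi => hj.subset hi⟩

theorem onAxis_succAbove {P : Plane} (h : HasType P 0) {k : Fin 3} (hk : P.rep k ≠ 0) (i : Fin 2) :
    OnAxis P (k.succAbove i) := by
  obtain ⟨j, hj⟩ := Set.ncard_eq_one.mp h
  by_contra hi
  have h1 : k = j := hj.subset hk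
  have h2 : k.succAbove i = j := hj.subset hi
  exact Fin.succAbove_ne k i (h2.trans h1.symm)

theorem affineCoord_eq_zero_iff {P : Plane} {k : Fin 3} (hk : P.rep k ≠ 0) (i : Fin 2) :
    affineCoord k P i = 0 ↔ OnAxis P (k.succAbove i) := by
  rw [affineCoord, div_eq_zero_iff, or_iff_left hk, OnAxis]

theorem exists_succAbove_of_onAxis {P : Plane} {k : Fin 3} (hk : P.rep k ≠ 0) {j : Fin 3}
    (hj : OnAxis P j) : ∃ b, j = k.succAbove b := by
  obtain rfl | h := Fin.eq_self_or_eq_succAbove k j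
  · exact absurd hj hk
  · exact h

end KummerCover

end

/-! ### The theorem on local invariants of Kummer covers. -/

open KummerCover in
theorem mainTheorem9 (n d : ℕ) (hn : 1 < n)
    -- the reduced projective curve `F = 0` of degree `d`
    (F : MvPolynomial (Fin 3) ℂ) (hF : F.IsHomogeneous d) (hred : Squarefree F)
    -- a point `Q` of its Kummer transform, and the image `P` of `Q`
    (P Q : Plane) (hQP : kummerMap n Q = P) (hQ : OnCurve (kummerTransform n F) Q)
    -- no axis through `P` is a component of the curve
    (haxes : ∀ j : Fin 3, OnAxis P j → ¬ MvPolynomial.X j ∣ F)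
    -- an affine chart `X_k ≠ 0` containing `P` and `Q`
    (k : Fin 3) (hk : P.rep k ≠ 0) :
    -- points of type 1
    (HasType P 1 →
      (∃! j : Fin 3, OnAxis P j) ∧
      ∀ j : Fin 3, OnAxis P j →
        (∃ μP μQ m : ℕ,
          milnorNumber (localEq k P F) = μP ∧
          milnorNumber (localEq k Q (kummerTransform n F)) = μQ ∧
          intersectionNumber (localEq k P F) (localEq k P (MvPolynomial.X j)) = m ∧
          (μQ : ℤ) = n * μP + (m - 1) * (n - 1)) ∧
        (∀ δ : ConvSeries, IsBranch δ (localEq k P F) →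
          ∃ μP μQ m : ℕ,
            milnorNumber δ = μP ∧
            milnorNumber (pullback n k Q δ) = μQ ∧
            intersectionNumber δ (localEq k P (MvPolynomial.X j)) = m ∧
            (μQ : ℤ) = n * μP + (m - 1) * (n - 1) ∧
            (components (pullback n k Q δ)).encard = (Nat.gcd n m : ℕ∞)) ∧
        (∀ δ δ' : ConvSeries, IsBranch δ (localEq k P F) → IsBranch δ' (localEq k P F) →
          ¬ Associated δ δ' →
          ∃ iP iQ : ℕ,
            intersectionNumber δ δ' = iP ∧
            intersectionNumber (pullback n k Q δ) (pullback n k Q δ') = iQ ∧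
            iQ = n * iP)) ∧
    -- points of type 0
    (HasType P 0 →
      {j : Fin 3 | OnAxis P j}.ncard = 2 ∧
      ∀ j₁ j₂ : Fin 3, j₁ ≠ j₂ → OnAxis P j₁ → OnAxis P j₂ →
        (∃ μP μQ m₁ m₂ : ℕ,
          milnorNumber (localEq k P F) = μP ∧
          milnorNumber (localEq k Q (kummerTransform n F)) = μQ ∧
          intersectionNumber (localEq k P F) (localEq k P (MvPolynomial.X j₁)) = m₁ ∧
          intersectionNumber (localEq k P F) (localEq k P (MvPolynomial.X j₂)) = m₂ ∧
          (μQ : ℤ) = n ^ 2 * μP + (n - 1) * (n * (m₁ + m₂ - 1) - 1)) ∧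
        (∀ δ : ConvSeries, IsBranch δ (localEq k P F) →
          ∃ μP μQ m₁ m₂ : ℕ,
            milnorNumber δ = μP ∧
            milnorNumber (pullback n k Q δ) = μQ ∧
            intersectionNumber δ (localEq k P (MvPolynomial.X j₁)) = m₁ ∧
            intersectionNumber δ (localEq k P (MvPolynomial.X j₂)) = m₂ ∧
            (μQ : ℤ) = n ^ 2 * μP + (n - 1) * (n * (m₁ + m₂ - 1) - 1) ∧
            intersectionNumber (pullback n k Q δ) (localEq k Q (MvPolynomial.X j₁)) =
              ((n * m₁ : ℕ) : ℕ∞) ∧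
            intersectionNumber (pullback n k Q δ) (localEq k Q (MvPolynomial.X j₂)) =
              ((n * m₂ : ℕ) : ℕ∞) ∧
            (components (pullback n k Q δ)).encard =
              ((n * Nat.gcd n (Nat.gcd m₁ m₂) : ℕ) : ℕ∞) ∧
            ∀ g g' : ConvSeries, IsBranch g (pullback n k Q δ) → IsBranch g' (pullback n k Q δ) →
              AnalyticallyIsomorphic g g') ∧
        (∀ δ δ' : ConvSeries, IsBranch δ (localEq k P F) → IsBranch δ' (localEq k P F) →
          ¬ Associated δ δ' →
          ∃ iP iQ : ℕ,
            intersectionNumber δ δ' = iP ∧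
            intersectionNumber (pullback n k Q δ) (pullback n k Q δ') = iQ ∧
            iQ = n ^ 2 * iP)) := by
  obtain rfl := hQP.symm
  have hn0 : 0 < n := by omega
  -- The affine coordinates of the image are `n`-th powers of those of `Q`, so both points lie on
  -- the same axes.
  have hcQ : ∀ i, affineCoord k Q i = 0 ↔ OnAxis (kummerMap n Q) (k.succAbove i) := fun i => by
    rw [← affineCoord_eq_zero_iff hk, affineCoord_kummerMap, pow_eq_zero_iff hn0.ne']
  have hcP := fun i => (affineCoord_eq_zero_iff hk i).mpr
  have h0 := evalZero_localEq hF (onCurve_kummerMap hF hQ) hk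
  have hsq : Squarefree (localEq k (kummerMap n Q) F) := by
    rw [ConvSeries.localEq_eq]
    exact ConvSeries.squarefree_germ hF hred k _
  have hX : ∀ b, OnAxis (kummerMap n Q) (k.succAbove b) →
      ¬ ConvSeries.X b ∣ localEq k (kummerMap n Q) F := fun b hb => by
    rw [ConvSeries.localEq_eq]
    exact ConvSeries.not_X_dvd_germ hF k (hcP b hb) (haxes _ hb)
  -- The curve upstairs is the pull-back of the local equation downstairs, so the whole curve and
  -- its branches are treated by the same local result.
  rw [← pullback_localEq]
  refine ⟨fun hP => ?_, fun hP => ?_⟩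
  · have huniq := existsUnique_onAxis hP
    refine ⟨huniq, fun j hj => ?_⟩
    obtain ⟨b, rfl⟩ := exists_succAbove_of_onAxis hk hj
    obtain ⟨a, hab⟩ : ∃ a, a ≠ b := exists_ne b
    obtain ⟨ψ, h1, h2, h3, h4⟩ := exists_pullback_eq hn0 hab ((hcQ b).mpr hj) fun ha =>
      hab (Fin.succAbove_right_injective (huniq.unique ((hcQ a).mp ha) hj))
    rw [localEq_X (hcP b hj)]
    exact ConvSeries.pullback_one hab hn0 ψ h1 h2 h3 _ h4 hsq h0 (hX b hj)
  · have hax := onAxis_succAbove hP hk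
    refine ⟨by have := ncard_onAxis hP; omega, fun j₁ j₂ hj h1 h2 => ?_⟩
    obtain ⟨a, rfl⟩ := exists_succAbove_of_onAxis hk h1
    obtain ⟨b, rfl⟩ := exists_succAbove_of_onAxis hk h2
    rw [localEq_X (hcP a h1), localEq_X (hcP b h2), localEq_X ((hcQ a).mpr h1),
      localEq_X ((hcQ b).mpr h2)]
    exact ConvSeries.pullback_two hn0 _ (pullback_eq_powMap_powMap hn0 fun i => (hcQ i).mpr (hax i))
      hsq h0 (fun i => hX i (hax i)) fun h => hj (h ▸ rfl)
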